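/- Let $n\ge 1$, let $\Omega\subseteq\mathbb{R}^n$ be a nonempty open set, $s\in\mathbb{R}$, $1<p<\infty$ and $\frac1p+\frac1{p'}=1$. All functions and distributions are real valued. For $s\ge 0$, $s=k+\theta$ with $k\in\mathbb{N}_0$, $0\le\theta<1$, $W^{s,p}(\Omega)$ is the Sobolev-Slobodeckij space with norm $\sum_{|\nu|\le k}\|\partial^\nu u\|_{L^p(\Omega)}$, plus, if $\theta\neq0$, $\sum_{|\nu|=k}\big(\iint_{\Omega\times\Omega}\frac{|\partial^\nu u(x)-\partial^\nu u(y)|^p}{|x-y|^{n+\theta p}}\,dx\,dy\big)^{1/p}$. For every real $s$, $W^{s,p}_0(\Omega)$ is the closure of $C_c^\infty(\Omega)$ in $W^{s,p}(\Omega)$, and for $s<0$, $W^{s,p}(\Omega)=[W^{-s,p'}_0(\Omega)]^*$ with the dual norm; its elements are identified with distributions by restriction to $C_c^\infty(\Omega)$. For compact $K\subset\Omega$, $W^{s,p}_K(\Omega)$ is the subspace of the $u\in W^{s,p}(\Omega)$ with $\operatorname{supp}u\subseteq K$, with the induced norm, and $W^{s,p}_{comp}(\Omega)=\bigcup_K W^{s,p}_K(\Omega)$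 carries the locally convex inductive limit topology. $W^{s,p}_{loc}(\Omega)$ is the space of the distributions $f$ on $\Omega$ with $\varphi f\in W^{s,p}(\Omega)$ for all $\varphi\in C_c^\infty(\Omega)$, with the topology induced by the seminorms $f\mapsto\|\varphi f\|_{W^{s,p}(\Omega)}$. The triple $(s,p,\Omega)$ is a smooth multiplication triple if for every $\varphi\in C_c^\infty(\Omega)$ the map $u\mapsto\varphi u$ is well defined and bounded from $W^{s,p}(\Omega)$ to itself. The pairing $\langle u,g\rangle$ of $u\in W^{-s,p'}_0(\Omega)$ and $g\in W^{s,p}_0(\Omega)$ comes from the identification $W^{-s,p'}_0(\Omega)=[W^{s,p}_0(\Omega)]^*$: it is the value at $g$ of the unique continuous linear functional on $W^{s,p}_0(\Omega)$ whose restriction to $C_c^\infty(\Omega)$ is the distribution $u$. **Theorem.** Suppose that $(s,p,\Omega)$ and $(-s,p',\Omega)$ are smooth multiplication triples. For $u\in W^{-s,p'}_{comp}(\Omega)$ and $f\in W^{s,p}_{loc}(\Omega)$ let $$[R(u)](f):=\langle u,\psi_u f\rangle_{W^{-s,p'}_0(\Omega)\times W^{s,p}_0(\Omega)},$$ where $\psi_u$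 is any function in $C_c^\infty(\Omega)$ that is equal to $1$ on a neighborhood of the support of $u$. Then: 1. Such functions $\psi_u$ exist, $u\in W^{-s,p'}_0(\Omega)$ and $\psi_u f\in W^{s,p}_0(\Omega)$, the pairing is defined, and $[R(u)](f)$ does not depend on the choice of $\psi_u$. 2. For every $u\in W^{-s,p'}_{comp}(\Omega)$, $R(u)$ is a continuous linear functional on $W^{s,p}_{loc}(\Omega)$. 3. $R: W^{-s,p'}_{comp}(\Omega)\to[W^{s,p}_{loc}(\Omega)]^*$ is linear and bijective; in particular the two spaces are isomorphic vector spaces. 4. $R$ is continuous if $[W^{s,p}_{loc}(\Omega)]^*$ is equipped with the strong topology. -/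

import Mathlib

open Distribution Set Filter Topology MeasureTheory TopologicalSpace
open scoped Distributions ENNReal NNReal

noncomputable section

namespace SobolevDuality

/-! ### Extended seminorms and the seminormed spaces they define -/

/-- A function `N : V → [0, ∞]` which is subadditive and satisfies `N (c • u) ≤ |c| N u` (hence
`N (c • u) = |c| N u` for `c ≠ 0`, and `N 0 = 0`). -/
structure ExtSeminorm (V : Type*) [AddCommGroup V] [Module ℝ V] where
  toFun : V → ℝ≥0∞
  add_le : ∀ u v, toFun (u + v) ≤ toFun u + toFun v
  smul_le : ∀ (c : ℝ) u, toFun (c • u) ≤ ‖c‖ₑ * toFun u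

namespace ExtSeminorm

variable {V : Type*} [AddCommGroup V] [Module ℝ V] (N : ExtSeminorm V)

theorem map_zero : N.toFun 0 = 0 := by
  simpa using N.smul_le 0 0

/-- The subspace on which `N` is finite. -/
def finite : Submodule ℝ V where
  carrier := {u | N.toFun u < ∞}
  add_mem' {u v} hu hv := (N.add_le u v).trans_lt (ENNReal.add_lt_top.2 ⟨hu, hv⟩)
  zero_mem' := by simp [N.map_zero]
  smul_mem' c u hu := (N.smul_le c u).trans_lt (ENNReal.mul_lt_top (by simp) hu)

/-- The space `{u | N u < ∞}`, to be equipped with the seminorm `N`. -/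
def Space : Type _ := N.finite

instance : AddCommGroup N.Space := inferInstanceAs (AddCommGroup N.finite)

instance : Module ℝ N.Space := inferInstanceAs (Module ℝ N.finite)

/-- The inclusion of `{u | N u < ∞}` into the ambient vector space. -/
def incl : N.Space →ₗ[ℝ] V := N.finite.subtype

/-- The extended seminorm `u ↦ N (T u)`. -/
def comp {W : Type*} [AddCommGroup W] [Module ℝ W] (T : W →ₗ[ℝ] V) : ExtSeminorm W where
  toFun u := N.toFun (T u)
  add_le u v := by simpa using N.add_le (T u) (T v)
  smul_le c u := by simpa using N.smul_le c (T u)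

/-- The sum of two extended seminorms. -/
instance : Add (ExtSeminorm V) where
  add N₁ N₂ :=
    { toFun := fun u => N₁.toFun u + N₂.toFun u
      add_le := fun u v =>
        (add_le_add (N₁.add_le u v) (N₂.add_le u v)).trans_eq (add_add_add_comm _ _ _ _)
      smul_le := fun c u =>
        (add_le_add (N₁.smul_le c u) (N₂.smul_le c u)).trans_eq (mul_add _ _ _).symm }

/-- The sum of a finite family of extended seminorms. -/
def sum {ι : Type*} (s : Finset ι) (M : ι → ExtSeminorm V) : ExtSeminorm V where
  toFun u := ∑ i ∈ s, (M i).toFun u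
  add_le u v := (Finset.sum_le_sum fun i _ => (M i).add_le u v).trans_eq Finset.sum_add_distrib
  smul_le c u :=
    (Finset.sum_le_sum fun i _ => (M i).smul_le c u).trans_eq (Finset.mul_sum _ _ _).symm

theorem toFun_incl_lt_top (u : N.Space) : N.toFun (N.incl u) < ∞ := u.2

/-- The real-valued seminorm `u ↦ N u` on `{u | N u < ∞}`. -/
def seminorm : Seminorm ℝ N.Space :=
  Seminorm.ofSMulLE (fun u => (N.toFun (N.incl u)).toReal)
    (by simp [N.map_zero])
    (fun u v => by
      rw [_root_.map_add, ← ENNReal.toReal_add (N.toFun_incl_lt_top u).ne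
        (N.toFun_incl_lt_top v).ne]
      exact ENNReal.toReal_mono (ENNReal.add_lt_top.2
        ⟨N.toFun_incl_lt_top u, N.toFun_incl_lt_top v⟩).ne (N.add_le _ _))
    (fun c u => by
      rw [_root_.map_smul, ← toReal_enorm, ← ENNReal.toReal_mul]
      exact ENNReal.toReal_mono (ENNReal.mul_lt_top (by simp) (N.toFun_incl_lt_top u)).ne
        (N.smul_le _ _))

instance : SeminormedAddCommGroup N.Space := N.seminorm.toSeminormedAddCommGroup

instance : NormedSpace ℝ N.Space where
  norm_smul_le c u := (map_smul_eq_mul N.seminorm c u).le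

end ExtSeminorm

/-! ### Distributions on an open set `Ω ⊆ ℝⁿ` -/

variable {n : ℕ} {Ω : Opens (EuclideanSpace ℝ (Fin n))}

/-- The function `f` is locally integrable on `Ω` and the distribution `u` is the distribution
`φ ↦ ∫_Ω f φ` that it defines. -/
def IsRepr (u : 𝓓'(Ω, ℝ)) (f : EuclideanSpace ℝ (Fin n) → ℝ) : Prop :=
  LocallyIntegrableOn f Ω ∧ ∀ φ : 𝓓(Ω, ℝ), u φ = ∫ x in Ω, f x * φ x

theorem integrableOn_mul {f : EuclideanSpace ℝ (Fin n) → ℝ} (hf : LocallyIntegrableOn f Ω)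
    (φ : 𝓓(Ω, ℝ)) : IntegrableOn (fun x => f x * φ x) Ω := by
  have := (TestFunction.integrable_bilin (ContinuousLinearMap.mul ℝ ℝ) hf φ).integrableOn (s := Ω)
  simpa [mul_comm] using this

theorem IsRepr.add {u v : 𝓓'(Ω, ℝ)} {f g : EuclideanSpace ℝ (Fin n) → ℝ} (hf : IsRepr u f)
    (hg : IsRepr v g) : IsRepr (u + v) (f + g) := by
  refine ⟨hf.1.add hg.1, fun φ => ?_⟩
  have : (u + v) φ = u φ + v φ := rfl
  rw [this, hf.2, hg.2, ← integral_add (integrableOn_mul hf.1 φ) (integrableOn_mul hg.1 φ)]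
  simp [add_mul]

theorem IsRepr.smul {u : 𝓓'(Ω, ℝ)} {f : EuclideanSpace ℝ (Fin n) → ℝ} (hf : IsRepr u f) (c : ℝ) :
    IsRepr (c • u) (c • f) := by
  refine ⟨hf.1.smul c, fun φ => ?_⟩
  have : (c • u) φ = c * u φ := rfl
  rw [this, hf.2, ← integral_const_mul]
  simp [mul_assoc]

theorem IsRepr.zero : IsRepr (0 : 𝓓'(Ω, ℝ)) 0 := by
  refine ⟨(locallyIntegrable_zero).locallyIntegrableOn _, fun φ => ?_⟩
  have : (0 : 𝓓'(Ω, ℝ)) φ = 0 := rfl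
  simp [this]

/-- Multiplication of test functions by a fixed test function `ψ`. -/
def mulTest (ψ : 𝓓(Ω, ℝ)) : 𝓓(Ω, ℝ) →L[ℝ] 𝓓(Ω, ℝ) :=
  TestFunction.limitCLM ℝ
    (fun φ => ⟨fun x => φ x * ψ x, φ.contDiff.mul ψ.contDiff, φ.hasCompactSupport.mul_right,
      (tsupport_mul_subset_left).trans φ.tsupport_subset⟩)
    (fun _ hK => (TestFunction.ofSupportedInCLM ℝ hK).comp
      (ContDiffMapSupportedIn.bilinLeftCLM (ContinuousLinearMap.mul ℝ ℝ) ψ.contDiff))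
    (fun _ _ _ => rfl)

theorem mulTest_apply (ψ φ : 𝓓(Ω, ℝ)) (x : EuclideanSpace ℝ (Fin n)) :
    mulTest ψ φ x = φ x * ψ x := rfl

/-- The product `ψ u` of a distribution `u` and `ψ ∈ C_c^∞(Ω)`: `⟨ψ u, φ⟩ = ⟨u, ψ φ⟩`. -/
def mulDist (ψ : 𝓓(Ω, ℝ)) : 𝓓'(Ω, ℝ) →ₗ[ℝ] 𝓓'(Ω, ℝ) :=
  ((mulTest ψ).precompCompactConvergenceCLM ℝ).toLinearMap

theorem mulDist_apply (ψ : 𝓓(Ω, ℝ)) (u : 𝓓'(Ω, ℝ)) (φ : 𝓓(Ω, ℝ)) :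
    mulDist ψ u φ = u (mulTest ψ φ) := rfl

/-- The distributional partial derivative `∂^α u = ∂₁^{α₁} ⋯ ∂ₙ^{αₙ} u`. -/
def partialDeriv (α : Fin n → ℕ) : 𝓓'(Ω, ℝ) →ₗ[ℝ] 𝓓'(Ω, ℝ) :=
  ((List.finRange n).map fun i =>
    ((Distribution.lineDerivCLM (EuclideanSpace.single i (1 : ℝ)) :
      𝓓'(Ω, ℝ) →L[ℝ] 𝓓'(Ω, ℝ)).toLinearMap : Module.End ℝ 𝓓'(Ω, ℝ)) ^ α i).prod

/-! ### Sobolev-Slobodeckij norms of nonnegative order -/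

/-- Applies a seminorm on functions to a distribution `u` through a function which represents it;
the value is `∞` if there is none. (Two functions which represent `u` agree almost everywhere on
`Ω`, so the infimum is over equal numbers as soon as `Φ` does not see null sets.) -/
def ofRepr (Ω : Opens (EuclideanSpace ℝ (Fin n)))
    (Φ : (EuclideanSpace ℝ (Fin n) → ℝ) → ℝ≥0∞)
    (hadd : ∀ f g, LocallyIntegrableOn f Ω → LocallyIntegrableOn g Ω → Φ (f + g) ≤ Φ f + Φ g)
    (hsmul : ∀ (c : ℝ) f, Φ (c • f) ≤ ‖c‖ₑ * Φ f) : ExtSeminorm 𝓓'(Ω, ℝ) where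
  toFun u := ⨅ (f : EuclideanSpace ℝ (Fin n) → ℝ) (_ : IsRepr u f), Φ f
  add_le u v := by
    have h : ∀ f g, IsRepr u f → IsRepr v g →
        ⨅ (k : EuclideanSpace ℝ (Fin n) → ℝ) (_ : IsRepr (u + v) k), Φ k ≤ Φ f + Φ g :=
      fun f g hf hg => (iInf₂_le (f + g) (hf.add hg)).trans (hadd f g hf.1 hg.1)
    simp only [ENNReal.iInf_add, ENNReal.add_iInf]
    exact le_iInf₂ fun _ hg => le_iInf₂ fun _ hf => h _ _ hf hg
  smul_le c u := by
    rcases eq_or_ne c 0 with rfl | hc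
    · have h : ⨅ (k : EuclideanSpace ℝ (Fin n) → ℝ) (_ : IsRepr ((0 : ℝ) • u) k), Φ k ≤ Φ 0 :=
        iInf₂_le 0 (by rw [zero_smul]; exact .zero)
      exact h.trans (by simpa using hsmul 0 0)
    · simp only [ENNReal.mul_iInf_of_ne (by simpa using hc : ‖c‖ₑ ≠ 0) enorm_ne_top]
      exact le_iInf₂ fun f hf => (iInf₂_le (c • f) (hf.smul c)).trans (hsmul c f)

/-- The norm `‖u‖_{L^p(Ω)}` of a distribution. -/
def lpNorm (Ω : Opens (EuclideanSpace ℝ (Fin n))) (p : ℝ) [hp : Fact (1 < p)] :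
    ExtSeminorm 𝓓'(Ω, ℝ) :=
  ofRepr Ω (fun f => eLpNorm f (ENNReal.ofReal p) (volume.restrict Ω))
    (fun _ _ hf hg => eLpNorm_add_le hf.aestronglyMeasurable hg.aestronglyMeasurable
      (by simpa using hp.out.le))
    (fun _ _ => eLpNorm_const_smul_le)

/-- The seminorm `(∬_{Ω×Ω} |u(x) - u(y)|^p / |x - y|^{n + θ p} dx dy)^{1/p}` of a distribution,
written as the `L^p(Ω × Ω)` norm of `(u(x) - u(y)) / |x - y|^{n/p + θ}`. -/
def slobodeckijSeminorm (Ω : Opens (EuclideanSpace ℝ (Fin n))) (θ p : ℝ) [hp : Fact (1 < p)] :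
    ExtSeminorm 𝓓'(Ω, ℝ) :=
  ofRepr Ω
    (fun f => eLpNorm
      (fun z : EuclideanSpace ℝ (Fin n) × EuclideanSpace ℝ (Fin n) =>
        (f z.1 - f z.2) / ‖z.1 - z.2‖ ^ ((n : ℝ) / p + θ))
      (ENNReal.ofReal p) ((volume.restrict Ω).prod (volume.restrict Ω)))
    (fun f g hf hg => by
      have hm : ∀ k : EuclideanSpace ℝ (Fin n) → ℝ, LocallyIntegrableOn k Ω →
          AEStronglyMeasurable
            (fun z : EuclideanSpace ℝ (Fin n) × EuclideanSpace ℝ (Fin n) =>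
              (k z.1 - k z.2) / ‖z.1 - z.2‖ ^ ((n : ℝ) / p + θ))
            ((volume.restrict (Ω : Set (EuclideanSpace ℝ (Fin n)))).prod
              (volume.restrict (Ω : Set (EuclideanSpace ℝ (Fin n))))) := fun k hk =>
        (hk.aestronglyMeasurable.comp_fst.sub hk.aestronglyMeasurable.comp_snd).div₀
          (by fun_prop : Measurable fun z : EuclideanSpace ℝ (Fin n) × EuclideanSpace ℝ (Fin n) =>
            ‖z.1 - z.2‖ ^ ((n : ℝ) / p + θ)).aestronglyMeasurable
      refine le_trans (le_of_eq ?_) (eLpNorm_add_le (hm f hf) (hm g hg) (by simpa using hp.out.le))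
      congr 1
      ext z
      simp only [Pi.add_apply]
      ring)
    (fun c f => by
      refine le_trans (le_of_eq ?_) (eLpNorm_const_smul_le (c := c))
      congr 1
      ext z
      simp only [Pi.smul_apply, smul_eq_mul]
      ring)

/-- The norm of `W^{s,p}(Ω)` for `s ≥ 0`: with `s = k + θ`, `k = ⌊s⌋` and `0 ≤ θ < 1`, the sum of
`‖∂^ν u‖_{L^p(Ω)}` over the multi-indices `|ν| ≤ k`, to which, if `θ ≠ 0`, the Slobodeckij
seminorms of exponent `θ` of the derivatives `∂^ν u`, `|ν| = k`, are added. -/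
def nonnegSobolevNorm (Ω : Opens (EuclideanSpace ℝ (Fin n))) (s p : ℝ) [Fact (1 < p)] :
    ExtSeminorm 𝓓'(Ω, ℝ) :=
  let lowerPart : ExtSeminorm 𝓓'(Ω, ℝ) :=
    .sum (Finset.range (⌊s⌋₊ + 1)) fun j =>
      .sum (Finset.piAntidiag Finset.univ j) fun ν => (lpNorm Ω p).comp (partialDeriv ν)
  if Int.fract s = 0 then lowerPart
  else lowerPart + .sum (Finset.piAntidiag Finset.univ ⌊s⌋₊) fun ν =>
    (slobodeckijSeminorm Ω (Int.fract s) p).comp (partialDeriv ν)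

/-! ### Closure of the test functions and duality -/

/-- The elements of `{u | N u < ∞}` which are (given by) test functions. -/
def testFunctions (N : ExtSeminorm 𝓓'(Ω, ℝ)) : Submodule ℝ N.Space where
  carrier := {w | ∃ φ : 𝓓(Ω, ℝ), IsRepr (N.incl w) φ}
  add_mem' := by
    rintro v w ⟨φ, hφ⟩ ⟨η, hη⟩
    exact ⟨φ + η, by simpa using hφ.add hη⟩
  zero_mem' := ⟨0, by simpa using IsRepr.zero⟩
  smul_mem' := by
    rintro c w ⟨φ, hφ⟩
    exact ⟨c • φ, by simpa using hφ.smul c⟩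

/-- The closure of `C_c^∞(Ω)` in the space `{u | N u < ∞}` with its seminorm `N`. -/
def TestClosure (N : ExtSeminorm 𝓓'(Ω, ℝ)) : Type _ := (testFunctions N).topologicalClosure

instance (N : ExtSeminorm 𝓓'(Ω, ℝ)) : SeminormedAddCommGroup (TestClosure N) :=
  inferInstanceAs (SeminormedAddCommGroup (testFunctions N).topologicalClosure)

instance (N : ExtSeminorm 𝓓'(Ω, ℝ)) : NormedSpace ℝ (TestClosure N) :=
  inferInstanceAs (NormedSpace ℝ (testFunctions N).topologicalClosure)

/-- The inclusion of the closure of `C_c^∞(Ω)` into the space `{u | N u < ∞}`. -/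
def TestClosure.toSpace {N : ExtSeminorm 𝓓'(Ω, ℝ)} : TestClosure N →ₗ[ℝ] N.Space :=
  (testFunctions N).topologicalClosure.subtype

/-- The distribution underlying an element of the closure of `C_c^∞(Ω)`. -/
def TestClosure.toDist {N : ExtSeminorm 𝓓'(Ω, ℝ)} : TestClosure N →ₗ[ℝ] 𝓓'(Ω, ℝ) :=
  N.incl ∘ₗ TestClosure.toSpace

/-- The restriction of the functional `F` to `C_c^∞(Ω)` is the distribution `u`. By density of
the test functions, `F` is determined by `u`; this is the identification of the dual of the
closure of `C_c^∞(Ω)` with a space of distributions. -/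
def RestrictsTo {N : ExtSeminorm 𝓓'(Ω, ℝ)} (F : StrongDual ℝ (TestClosure N)) (u : 𝓓'(Ω, ℝ)) :
    Prop :=
  ∀ (w : TestClosure N) (φ : 𝓓(Ω, ℝ)), IsRepr w.toDist φ → F w = u φ

/-- The norm of the dual of the closure of `C_c^∞(Ω)` for `N`, as an extended seminorm on
distributions: the norm `‖F‖` of the unique continuous linear functional `F` that restricts to
the distribution, and `∞` if there is none. -/
def dualNorm (N : ExtSeminorm 𝓓'(Ω, ℝ)) : ExtSeminorm 𝓓'(Ω, ℝ) where
  toFun u := ⨅ (F : StrongDual ℝ (TestClosure N)) (_ : RestrictsTo F u), ‖F‖ₑ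
  add_le u v := by
    have h : ∀ F G : StrongDual ℝ (TestClosure N), RestrictsTo F u → RestrictsTo G v →
        ⨅ (H : StrongDual ℝ (TestClosure N)) (_ : RestrictsTo H (u + v)), ‖H‖ₑ ≤ ‖F‖ₑ + ‖G‖ₑ :=
      fun F G hF hG => (iInf₂_le (F + G) fun w φ h =>
        congrArg₂ (· + ·) (hF w φ h) (hG w φ h)).trans (by
        rw [← ofReal_norm, ← ofReal_norm, ← ofReal_norm,
          ← ENNReal.ofReal_add (norm_nonneg _) (norm_nonneg _)]
        exact ENNReal.ofReal_le_ofReal (norm_add_le F G))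
    simp only [ENNReal.iInf_add, ENNReal.add_iInf]
    exact le_iInf₂ fun _ hG => le_iInf₂ fun _ hF => h _ _ hF hG
  smul_le c u := by
    rcases eq_or_ne c 0 with rfl | hc
    · have h : ⨅ (H : StrongDual ℝ (TestClosure N)) (_ : RestrictsTo H ((0 : ℝ) • u)), ‖H‖ₑ ≤
          ‖(0 : StrongDual ℝ (TestClosure N))‖ₑ :=
        iInf₂_le 0 fun w φ _ => (zero_mul (u φ)).symm
      exact h.trans (by rw [← ofReal_norm, norm_zero, ENNReal.ofReal_zero]; exact zero_le)
    · simp only [ENNReal.mul_iInf_of_ne (by simpa using hc : ‖c‖ₑ ≠ 0) enorm_ne_top]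
      exact le_iInf₂ fun F hF => (iInf₂_le (c • F) fun w φ h =>
        congrArg (c * ·) (hF w φ h)).trans (enorm_smul c F).le

/-! ### The spaces `W^{s,p}(Ω)`, `s ∈ ℝ` -/

/-- The norm of `W^{s,p}(Ω)`; for `s < 0` it is the norm of the dual of `W_0^{-s,p'}(Ω)`. -/
def sobolevNorm (Ω : Opens (EuclideanSpace ℝ (Fin n))) (s p : ℝ) [hp : Fact (1 < p)] :
    ExtSeminorm 𝓓'(Ω, ℝ) :=
  if 0 ≤ s then nonnegSobolevNorm Ω s p
  else
    haveI : Fact (1 < p.conjExponent) := ⟨(Real.HolderConjugate.conjExponent hp.out).symm.lt⟩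
    dualNorm (nonnegSobolevNorm Ω (-s) p.conjExponent)

section Spaces

variable (Ω : Opens (EuclideanSpace ℝ (Fin n))) (s p : ℝ) [Fact (1 < p)]

/-- The Sobolev-Slobodeckij space `W^{s,p}(Ω)`, `s ∈ ℝ`, `1 < p < ∞`, as a space of distributions. -/
abbrev Sobolev : Type _ := (sobolevNorm Ω s p).Space

/-- `W_0^{s,p}(Ω)`, the closure of `C_c^∞(Ω)` in `W^{s,p}(Ω)`. -/
abbrev SobolevZero : Type _ := TestClosure (sobolevNorm Ω s p)

/-- `(s, p, Ω)` is a smooth multiplication triple: multiplication by each `φ ∈ C_c^∞(Ω)` is a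
well-defined bounded linear map on `W^{s,p}(Ω)`. -/
def IsSmoothMultiplicationTriple : Prop :=
  ∀ φ : 𝓓(Ω, ℝ), ∃ m : Sobolev Ω s p →L[ℝ] Sobolev Ω s p,
    ∀ u, (sobolevNorm Ω s p).incl (m u) = mulDist φ ((sobolevNorm Ω s p).incl u)

end Spaces

theorem dsupport_add_subset (u v : 𝓓'(Ω, ℝ)) :
    dsupport (u + v) ⊆ dsupport u ∪ dsupport v := by
  intro x hx
  by_contra h
  simp only [mem_union, not_or] at h
  obtain ⟨⟨a, ha, hao, hxa⟩, ⟨b, hb, hbo, hxb⟩⟩ :=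
    And.intro ((notMem_dsupport_iff x).1 h.1) ((notMem_dsupport_iff x).1 h.2)
  refine (notMem_dsupport_iff x).2 ⟨a ∩ b, fun φ hφ => ?_, hao.inter hbo, hxa, hxb⟩ hx
  have : (u + v) φ = u φ + v φ := rfl
  rw [this, ha φ (hφ.trans inter_subset_left), hb φ (hφ.trans inter_subset_right), add_zero]

theorem dsupport_smul_subset (c : ℝ) (u : 𝓓'(Ω, ℝ)) : dsupport (c • u) ⊆ dsupport u :=
  dsupport_subset_dsupport fun _ _ h φ hφ => by
    have : (c • u) φ = c * u φ := rfl
    rw [this, h φ hφ, mul_zero]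

theorem dsupport_zero : dsupport ⇑(0 : 𝓓'(Ω, ℝ)) = ∅ :=
  eq_empty_of_forall_notMem fun x => (notMem_dsupport_iff x).2
    ⟨univ, fun _ _ => rfl, isOpen_univ, mem_univ x⟩

section Spaces

variable (Ω : Opens (EuclideanSpace ℝ (Fin n))) (s p : ℝ) [Fact (1 < p)]

/-! ### `W^{s,p}_K(Ω)` and `W^{s,p}_comp(Ω)` -/

/-- `W^{s,p}_K(Ω)`: the elements of `W^{s,p}(Ω)` with support in `K`, with the induced norm. -/
def SobolevOn (K : Compacts (EuclideanSpace ℝ (Fin n))) : Submodule ℝ (Sobolev Ω s p) where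
  carrier := {u | dsupport ((sobolevNorm Ω s p).incl u) ⊆ K}
  add_mem' {u v} hu hv := by
    simp only [mem_ofPred_eq, map_add] at *
    exact (dsupport_add_subset _ _).trans (union_subset hu hv)
  zero_mem' := by
    change dsupport ((sobolevNorm Ω s p).incl 0) ⊆ _
    rw [map_zero]
    exact (dsupport_zero (Ω := Ω)).trans_subset (empty_subset _)
  smul_mem' c u hu := by
    simp only [mem_ofPred_eq, map_smul] at *
    exact (dsupport_smul_subset _ _).trans hu

/-- The union of the spaces `W^{s,p}_K(Ω)` over the compact sets `K ⊆ Ω`, as a vector space. -/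
def compSubmodule : Submodule ℝ (Sobolev Ω s p) where
  carrier := {u | ∃ K : Compacts (EuclideanSpace ℝ (Fin n)), (K : Set (EuclideanSpace ℝ (Fin n))) ⊆ Ω ∧ u ∈ SobolevOn Ω s p K}
  add_mem' := by
    rintro u v ⟨K, hK, hu⟩ ⟨L, hL, hv⟩
    refine ⟨K ⊔ L, by rw [Compacts.coe_sup]; exact union_subset hK hL, ?_⟩
    change dsupport ((sobolevNorm Ω s p).incl (u + v)) ⊆ _
    rw [map_add]
    exact (dsupport_add_subset _ _).trans (by
      simpa using ⟨hu.trans subset_union_left, hv.trans subset_union_right⟩)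
  zero_mem' := ⟨⊥, by rw [Compacts.coe_bot]; exact empty_subset _, zero_mem _⟩
  smul_mem' := by
    rintro c u ⟨K, hK, hu⟩
    exact ⟨K, hK, Submodule.smul_mem _ c hu⟩

/-- `W^{s,p}_comp(Ω)`. -/
def SobolevComp : Type _ := compSubmodule Ω s p

instance : AddCommGroup (SobolevComp Ω s p) := inferInstanceAs (AddCommGroup (compSubmodule Ω s p))

instance : Module ℝ (SobolevComp Ω s p) := inferInstanceAs (Module ℝ (compSubmodule Ω s p))

/-- The inclusion of `W^{s,p}_K(Ω)` into `W^{s,p}_comp(Ω)`. -/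
def SobolevOn.toComp (K : Compacts (EuclideanSpace ℝ (Fin n))) (hK : (K : Set (EuclideanSpace ℝ (Fin n))) ⊆ Ω)
    (u : SobolevOn Ω s p K) : SobolevComp Ω s p :=
  ⟨u.1, K, hK, u.2⟩

/-- The inclusion of `W^{s,p}_comp(Ω)` into `W^{s,p}(Ω)`. -/
def SobolevComp.toSobolev {Ω : Opens (EuclideanSpace ℝ (Fin n))} {s p : ℝ} [Fact (1 < p)] :
    SobolevComp Ω s p →ₗ[ℝ] Sobolev Ω s p := (compSubmodule Ω s p).subtype

/-- The distribution underlying an element of `W^{s,p}_comp(Ω)`. -/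
def SobolevComp.toDist {Ω : Opens (EuclideanSpace ℝ (Fin n))} {s p : ℝ} [Fact (1 < p)] :
    SobolevComp Ω s p →ₗ[ℝ] 𝓓'(Ω, ℝ) :=
  (sobolevNorm Ω s p).incl ∘ₗ SobolevComp.toSobolev

/-- The inductive limit topology on `W^{s,p}_comp(Ω)`: the finest locally convex vector space
topology for which all the inclusions of the spaces `W^{s,p}_K(Ω)`, `K ⊆ Ω` compact, are
continuous. (In Mathlib, the finest topology is the smallest one.) -/
instance : TopologicalSpace (SobolevComp Ω s p) :=
  sInf {t : TopologicalSpace (SobolevComp Ω s p) |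
    @IsTopologicalAddGroup (SobolevComp Ω s p) t _ ∧
    @ContinuousSMul ℝ (SobolevComp Ω s p) _ _ t ∧
    @LocallyConvexSpace ℝ (SobolevComp Ω s p) _ _ _ _ t ∧
    ∀ (K : Compacts (EuclideanSpace ℝ (Fin n))) (hK : (K : Set (EuclideanSpace ℝ (Fin n))) ⊆ Ω),
      Continuous[_, t] (SobolevOn.toComp Ω s p K hK)}

/-! ### `W^{s,p}_loc(Ω)` -/

/-- The distributions `u` with `φ u ∈ W^{s,p}(Ω)` for all `φ ∈ C_c^∞(Ω)`, as a vector space. -/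
def locSubmodule : Submodule ℝ 𝓓'(Ω, ℝ) :=
  ⨅ φ : 𝓓(Ω, ℝ), (sobolevNorm Ω s p).finite.comap (mulDist φ)

/-- `W^{s,p}_loc(Ω)`. -/
def SobolevLoc : Type _ := locSubmodule Ω s p

instance : AddCommGroup (SobolevLoc Ω s p) := inferInstanceAs (AddCommGroup (locSubmodule Ω s p))

instance : Module ℝ (SobolevLoc Ω s p) := inferInstanceAs (Module ℝ (locSubmodule Ω s p))

/-- The distribution underlying an element of `W^{s,p}_loc(Ω)`. -/
def SobolevLoc.toDist {Ω : Opens (EuclideanSpace ℝ (Fin n))} {s p : ℝ} [Fact (1 < p)] :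
    SobolevLoc Ω s p →ₗ[ℝ] 𝓓'(Ω, ℝ) := (locSubmodule Ω s p).subtype

/-- The map `f ↦ φ f` from `W^{s,p}_loc(Ω)` to `W^{s,p}(Ω)`, for `φ ∈ C_c^∞(Ω)`. -/
def SobolevLoc.mul {Ω : Opens (EuclideanSpace ℝ (Fin n))} {s p : ℝ} [Fact (1 < p)] (φ : 𝓓(Ω, ℝ)) :
    SobolevLoc Ω s p →ₗ[ℝ] Sobolev Ω s p :=
  LinearMap.codRestrict (sobolevNorm Ω s p).finite (mulDist φ ∘ₗ SobolevLoc.toDist)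
    fun f => (Submodule.mem_iInf _).1 f.2 φ

/-- The seminorms `f ↦ ‖φ f‖_{W^{s,p}(Ω)}`, `φ ∈ C_c^∞(Ω)`, on `W^{s,p}_loc(Ω)`. -/
def SobolevLoc.seminormFamily : SeminormFamily ℝ (SobolevLoc Ω s p) 𝓓(Ω, ℝ) :=
  fun φ => (normSeminorm ℝ (Sobolev Ω s p)).comp (SobolevLoc.mul φ)

/-- The topology of `W^{s,p}_loc(Ω)` is the one induced by the seminorms `‖φ f‖_{W^{s,p}(Ω)}`. -/
instance : TopologicalSpace (SobolevLoc Ω s p) :=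
  (SobolevLoc.seminormFamily Ω s p).moduleFilterBasis.topology

theorem SobolevLoc.withSeminorms : WithSeminorms (SobolevLoc.seminormFamily Ω s p) := ⟨rfl⟩

end Spaces

/-! ### The duality pairing and cutoff functions -/

open Classical in
/-- The pairing `⟨u, g⟩` of `W_0^{-s,p'}(Ω)` and `W_0^{s,p}(Ω)`. The distribution
`u ∈ W_0^{-s,p'}(Ω)` is identified with the unique continuous linear functional on
`W_0^{s,p}(Ω)` whose restriction to `C_c^∞(Ω)` is `u`; the pairing is the value of this functional
at `g`. (The value is `0` if there is no such functional.) -/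
def dualPairing {s p p' : ℝ} [Fact (1 < p)] [Fact (1 < p')] (u : SobolevZero Ω (-s) p')
    (g : SobolevZero Ω s p) : ℝ :=
  if h : ∃ F : StrongDual ℝ (SobolevZero Ω s p), RestrictsTo F u.toDist then h.choose g else 0

/-- `ψ` is equal to `1` on a neighbourhood of the support of `u`. -/
def IsCutoff (ψ : 𝓓(Ω, ℝ)) (u : 𝓓'(Ω, ℝ)) : Prop :=
  ∀ᶠ x in 𝓝ˢ (dsupport u), ψ x = 1

end SobolevDuality

end

open SobolevDuality

/-! The pairing of `W_0^{-s,p'}` with `W_0^{s,p}` is localised by cutoff functions. A continuous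
functional `Λ` on `W^{s,p}_loc` is bounded by finitely many seminorms `‖φ f‖`, hence does not see
`f` outside the union `K` of the supports of these `φ`. On the test functions `Λ` is a distribution
`u` with support in `K` that is bounded by the norm of `W^{s,p}`, so `u` lies in `W^{-s,p'}_comp`;
and `Λ f = Λ (ψ f) = ⟨u, ψ f⟩` when `ψ = 1` near `K`. This gives surjectivity. Injectivity follows
by pairing with test functions. Continuity is checked on each `W_K`, where one cutoff serves all
`u`.

This argument is `exists_bijective_of_isDualPair`. Of the two norms it needs the properties
collected in `IsDualPair`: compactly supported elements lie in the closure of the test functions,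
the pairing is bounded by the product of the norms, and a distribution bounded by one norm on the
test functions is finite for the other.

To verify these properties, the norm of order `s ≥ 0` is treated as a finite sum of `L^p` norms of
linear images of `u` (derivatives and their difference quotients), each having a transpose that maps
test functions to test functions (`IsLpPiece`). Three facts follow. Mollification approximates
compactly supported elements (`hasCompactApprox_nonnegSobolevNorm`). By Hahn-Banach and the Riesz
theorem a functional is a sum of integrals against `L^q` functions, and approximating these by test
functions shows that the test functions are dense in the dual (`approximable_nonnegSobolevNorm`).
Finally, a distribution bounded by the dual norm has finite norm, which replaces reflexivity
(`nonnegSobolevNorm_lt_top_of_dualNorm`). The cases `s > 0`, `s = 0` and `s < 0` are put together in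
`isDualPair_sobolevNorm`. -/

open SobolevDuality

/-! ### Hahn-Banach extension and the dual of `L^p`. -/

/-- **Hahn-Banach theorem** for functionals which are bounded by the seminorm of a linear map. -/
theorem LinearMap.exists_strongDual_comp_eq {V W : Type*} [AddCommGroup V] [Module ℝ V]
    [SeminormedAddCommGroup W] [NormedSpace ℝ W] (T : V →ₗ[ℝ] W) (F : V →ₗ[ℝ] ℝ) {C : ℝ}
    (hC : 0 ≤ C) (h : ∀ v, |F v| ≤ C * ‖T v‖) :
    ∃ G : StrongDual ℝ W, (∀ v, G (T v) = F v) ∧ ‖G‖ ≤ C := by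
  -- The bound forces `F` to vanish on the kernel of `T`, so `F` descends to the range of `T`, where
  -- Hahn-Banach applies.
  have hker : F ∈ (LinearMap.ker T).dualAnnihilator := by
    refine (Submodule.mem_dualAnnihilator F).2 fun v hv => ?_
    have := h v
    rw [LinearMap.mem_ker.1 hv, norm_zero, mul_zero] at this
    exact abs_nonpos_iff.1 this
  rw [← LinearMap.range_dualMap_eq_dualAnnihilator_ker] at hker
  obtain ⟨F', hF'⟩ := hker
  have hF'' : ∀ v, F' (T v) = F v := fun v => congrArg (· v) hF'
  obtain ⟨G, hG, hGn⟩ := exists_extension_norm_eq (LinearMap.range T)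
    (LinearMap.mkContinuous (F' ∘ₗ (LinearMap.range T).subtype) C (by
      rintro ⟨_, v, rfl⟩
      simpa [hF''] using h v))
  refine ⟨G, fun v => ?_, hGn.trans_le (LinearMap.mkContinuous_norm_le _ hC _)⟩
  exact (hG ⟨T v, v, rfl⟩).trans (hF'' v)

namespace MeasureTheory

variable {α : Type*} [MeasurableSpace α] {μ : Measure α}

/-- Dominated convergence in `L^p`. -/
theorem tendsto_eLpNorm_sub_of_dominated {ι : Type*} {l : Filter ι} [l.IsCountablyGenerated]
    {p : ℝ≥0∞} (hp0 : p ≠ 0) (hp : p ≠ ∞) {F : ι → α → ℝ} {f g : α → ℝ}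
    (hF : ∀ i, AEStronglyMeasurable (F i) μ) (hf : AEStronglyMeasurable f μ)
    (hg : MemLp g p μ) (hFg : ∀ i, ∀ᵐ x ∂μ, ‖F i x‖ ≤ g x) (hfg : ∀ᵐ x ∂μ, ‖f x‖ ≤ g x)
    (hlim : ∀ᵐ x ∂μ, Tendsto (fun i => F i x) l (𝓝 (f x))) :
    Tendsto (fun i => eLpNorm (F i - f) p μ) l (𝓝 0) := by
  have hp' : 0 < p.toReal := ENNReal.toReal_pos hp0 hp
  have key : Tendsto (fun i => ∫⁻ x, ‖(F i - f) x‖ₑ ^ p.toReal ∂μ) l (𝓝 (∫⁻ _, 0 ∂μ)) := by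
    refine tendsto_lintegral_filter_of_dominated_convergence'
      (fun x => ‖(2 * g) x‖ₑ ^ p.toReal) (.of_forall fun i => ?_) (.of_forall fun i => ?_) ?_ ?_
    · exact ((hF i).sub hf).enorm.pow_const _
    · filter_upwards [hFg i, hfg] with x h₁ h₂
      gcongr
      rw [enorm_le_iff_norm_le]
      calc ‖(F i - f) x‖ ≤ ‖F i x‖ + ‖f x‖ := norm_sub_le _ _
        _ ≤ 2 * g x := by linarith
        _ ≤ ‖(2 * g) x‖ := le_abs_self _
    · have : MemLp (2 * g) p μ := by
        simpa [two_mul] using hg.add hg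
      exact (lintegral_rpow_enorm_lt_top_of_eLpNorm_lt_top hp0 hp this.2).ne
    · filter_upwards [hlim] with x hx
      have h0 : Tendsto (fun i => ‖(F i - f) x‖ₑ) l (𝓝 0) := by
        have := (hx.sub_const (f x)).enorm
        simpa using this
      simpa [hp', Function.comp_def] using (ENNReal.continuous_rpow_const (y := p.toReal)).tendsto 0
        |>.comp h0
  simp only [lintegral_zero] at key
  have := (ENNReal.continuous_rpow_const (y := 1 / p.toReal)).tendsto 0 |>.comp key
  simpa [Function.comp_def, eLpNorm_eq_lintegral_rpow_enorm_toReal hp0 hp, hp'] using this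

theorem MemLp.tendsto_toLp_of_dominated {ι : Type*} {l : Filter ι} [l.IsCountablyGenerated]
    {p : ℝ≥0∞} [Fact (1 ≤ p)] (hp : p ≠ ∞) {F : ι → α → ℝ} {f g : α → ℝ}
    (hF : ∀ i, MemLp (F i) p μ) (hf : MemLp f p μ)
    (hg : MemLp g p μ) (hFg : ∀ i, ∀ᵐ x ∂μ, ‖F i x‖ ≤ g x) (hfg : ∀ᵐ x ∂μ, ‖f x‖ ≤ g x)
    (hlim : ∀ᵐ x ∂μ, Tendsto (fun i => F i x) l (𝓝 (f x))) :
    Tendsto (fun i => (hF i).toLp (F i)) l (𝓝 (hf.toLp f)) := by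
  rw [Lp.tendsto_Lp_iff_tendsto_eLpNorm'']
  exact tendsto_eLpNorm_sub_of_dominated (one_pos.trans_le Fact.out).ne' hp (fun i => (hF i).1)
    hf.1 hg hFg hfg hlim

/-- On a σ-finite space such a weight replaces the constant `1`: its products with bounded functions
lie in `L^p`, so that a functional on `L^p` yields a finite signed measure. -/
theorem exists_pos_memLp (μ : Measure α) [SigmaFinite μ] {p : ℝ≥0∞} (hp0 : p ≠ 0) (hp : p ≠ ∞) :
    ∃ w : α → ℝ, (∀ x, 0 < w x) ∧ Measurable w ∧ MemLp w p μ := by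
  obtain ⟨g, hg0, hgm, hgi⟩ := exists_pos_lintegral_lt_of_sigmaFinite μ one_ne_zero
  have hp' : 0 < p.toReal := ENNReal.toReal_pos hp0 hp
  have hm : Measurable fun x => (g x : ℝ) ^ (1 / p.toReal) := by fun_prop
  refine ⟨fun x => (g x : ℝ) ^ (1 / p.toReal),
    fun x => Real.rpow_pos_of_pos (by exact_mod_cast hg0 x) _, hm, hm.aestronglyMeasurable, ?_⟩
  rw [eLpNorm_lt_top_iff_lintegral_rpow_enorm_lt_top hp0 hp]
  refine lt_of_le_of_lt (le_of_eq ?_) (hgi.trans ENNReal.one_lt_top)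
  refine lintegral_congr fun x => ?_
  rw [Real.enorm_of_nonneg (by positivity), ENNReal.ofReal_rpow_of_nonneg (by positivity) hp'.le,
    ← Real.rpow_mul (by positivity), one_div_mul_cancel hp'.ne', Real.rpow_one]
  simp

/-- Hölder's inequality. -/
theorem enorm_integral_mul_le {p q : ℝ} (hpq : p.HolderConjugate q) {f g : α → ℝ}
    (hf : AEStronglyMeasurable f μ) (hg : AEStronglyMeasurable g μ) :
    ‖∫ x, f x * g x ∂μ‖ₑ ≤ eLpNorm f (ENNReal.ofReal p) μ * eLpNorm g (ENNReal.ofReal q) μ := by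
  refine (enorm_integral_le_lintegral_enorm _).trans ?_
  simp only [enorm_mul]
  rw [eLpNorm_eq_lintegral_rpow_enorm_toReal (by simpa using hpq.pos) ENNReal.ofReal_ne_top,
    eLpNorm_eq_lintegral_rpow_enorm_toReal (by simpa using hpq.symm.pos) ENNReal.ofReal_ne_top,
    ENNReal.toReal_ofReal hpq.nonneg, ENNReal.toReal_ofReal hpq.symm.nonneg]
  exact ENNReal.lintegral_mul_le_Lp_mul_Lq μ hpq hf.enorm hg.enorm

theorem integrable_mul_of_memLp {p q : ℝ} (hpq : p.HolderConjugate q) {f g : α → ℝ}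
    (hf : MemLp f (ENNReal.ofReal p) μ) (hg : MemLp g (ENNReal.ofReal q) μ) :
    Integrable (fun x => f x * g x) μ := by
  have : ENNReal.HolderConjugate (ENNReal.ofReal p) (ENNReal.ofReal q) := hpq.ennrealOfReal
  exact hf.integrable_mul hg

end MeasureTheory

namespace MeasureTheory

variable {α : Type*} [MeasurableSpace α] {μ : Measure α}

theorem MemLp.toLp_eq_zero {p : ℝ≥0∞} {f : α → ℝ} (hf : MemLp f p μ) (h : f =ᵐ[μ] 0) :
    hf.toLp f = 0 :=
  (MemLp.toLp_congr hf MemLp.zero h).trans (MemLp.toLp_zero _)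

/-- The signed measure `A ↦ F (1_A w)` of a functional `F` on `L^p` and a function `w ∈ L^p`. -/
noncomputable def signedMeasureOfDual {p : ℝ≥0∞} [Fact (1 ≤ p)] (hp : p ≠ ∞)
    (F : StrongDual ℝ (Lp ℝ p μ)) {w : α → ℝ} (hw : MemLp w p μ) : SignedMeasure α where
  measureOf' A := open Classical in
    if hA : MeasurableSet A then F ((hw.indicator hA).toLp _) else 0
  empty' := by
    rw [dif_pos MeasurableSet.empty, MemLp.toLp_eq_zero _ (by simp; rfl), map_zero]
  not_measurable' A hA := by simp [hA]
  m_iUnion' f hf hd := by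
    simp only [hf, MeasurableSet.iUnion hf, dif_pos]
    -- Countable additivity: by linearity a finite sum of values is `F` of `w` cut off to the
    -- partial union, and these cut-offs converge in `L^p`, dominated by `|w|`.
    have hs : ∀ s : Finset ℕ, MemLp ((⋃ i ∈ s, f i).indicator w) p μ := fun s =>
      hw.indicator (s.measurableSet_biUnion fun i _ => hf i)
    have h1 : ∀ s : Finset ℕ, ∑ i ∈ s, F ((hw.indicator (hf i)).toLp _) = F ((hs s).toLp _) := by
      intro s
      rw [← map_sum]
      congr 1
      apply Lp.ext
      refine (Lp.coeFn_finsetSum _ _).trans ?_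
      have : ∀ᵐ x ∂μ, ∀ i, (hw.indicator (hf i)).toLp _ x = (f i).indicator w x :=
        ae_all_iff.2 fun i => MemLp.coeFn_toLp _
      filter_upwards [this, (hs s).coeFn_toLp] with x hx hx'
      rw [hx', Finset.indicator_biUnion_apply _ _ fun i _ j _ hij => hd hij]
      simp [hx]
    rw [HasSum]
    simp only [h1]
    refine (F.continuous.tendsto _).comp (MemLp.tendsto_toLp_of_dominated hp hs _ hw.norm ?_ ?_ ?_)
    · exact fun s => .of_forall fun x => norm_indicator_le_norm_self _ _
    · exact .of_forall fun x => norm_indicator_le_norm_self _ _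
    · refine .of_forall fun x => ?_
      by_cases hx : x ∈ ⋃ i, f i
      · obtain ⟨i, hi⟩ := mem_iUnion.1 hx
        refine tendsto_const_nhds.congr' ?_
        filter_upwards [eventually_ge_atTop {i}] with s hs
        rw [indicator_of_mem hx, indicator_of_mem]
        exact mem_biUnion (show i ∈ (s : Set ℕ) from hs (by simp)) hi
      · refine tendsto_const_nhds.congr fun s => ?_
        rw [indicator_of_notMem hx, indicator_of_notMem]
        exact fun h => hx (iUnion₂_subset_iUnion _ _ h)

theorem signedMeasureOfDual_apply {p : ℝ≥0∞} [Fact (1 ≤ p)] (hp : p ≠ ∞)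
    (F : StrongDual ℝ (Lp ℝ p μ)) {w : α → ℝ} (hw : MemLp w p μ) {A : Set α}
    (hA : MeasurableSet A) :
    signedMeasureOfDual hp F hw A = F ((hw.indicator hA).toLp _) :=
  dif_pos hA

/-- The function `g` is the Radon-Nikodym density of `A ↦ F (1_A w)`. The formula holds for
indicators by construction, for simple functions by linearity, and for bounded functions by
dominated convergence on both sides. -/
theorem exists_integrable_forall_dual_mul_eq [SigmaFinite μ] {p : ℝ≥0∞} [Fact (1 ≤ p)] (hp : p ≠ ∞)
    (F : StrongDual ℝ (Lp ℝ p μ)) {w : α → ℝ} (hw : MemLp w p μ) :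
    ∃ g : α → ℝ, Measurable g ∧ Integrable g μ ∧ ∀ (φ : α → ℝ) (C : ℝ), Measurable φ → (∀ x, ‖φ x‖ ≤
      C) →
      ∀ h : MemLp (fun x => φ x * w x) p μ, F (h.toLp _) = ∫ x, φ x * g x ∂μ := by
  set ν := signedMeasureOfDual hp F hw with hν
  have hac : ν ≪ᵥ μ.toENNRealVectorMeasure := by
    refine VectorMeasure.AbsolutelyContinuous.mk fun A hA h => ?_
    rw [Measure.toENNRealVectorMeasure_apply_measurable hA] at h
    rw [hν, signedMeasureOfDual_apply hp F hw hA]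
    rw [MemLp.toLp_eq_zero, map_zero]
    filter_upwards [measure_eq_zero_iff_ae_notMem.1 h] with x hx
    simp [hx]
  set g := ν.rnDeriv μ with hg
  have hgi : Integrable g μ := SignedMeasure.integrable_rnDeriv _ _
  have hgm : Measurable g := SignedMeasure.measurable_rnDeriv _ _
  have hset : ∀ A (hA : MeasurableSet A), F ((hw.indicator hA).toLp _) = ∫ x in A, g x ∂μ := by
    intro A hA
    rw [← signedMeasureOfDual_apply hp F hw hA, ← hν,
      ← SignedMeasure.withDensityᵥ_rnDeriv_eq ν μ hac, withDensityᵥ_apply hgi hA]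
  have hmul : ∀ φ : α → ℝ, ∀ C : ℝ, Measurable φ → (∀ x, ‖φ x‖ ≤ C) →
      MemLp (fun x => φ x * w x) p μ := fun φ C hφ hC =>
    (hw.const_mul C).mono (hφ.aestronglyMeasurable.mul hw.1) (.of_forall fun x => by
      rw [norm_mul, norm_mul]
      gcongr
      exact (hC x).trans (le_abs_self _))
  have hmuli : ∀ φ : α → ℝ, ∀ C : ℝ, Measurable φ → (∀ x, ‖φ x‖ ≤ C) →
      Integrable (fun x => φ x * g x) μ := fun φ C hφ hC =>
    hgi.bdd_mul hφ.aestronglyMeasurable (.of_forall hC)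
  have hsimple : ∀ φ : SimpleFunc α ℝ, ∀ h : MemLp (fun x => φ x * w x) p μ,
      F (h.toLp _) = ∫ x, φ x * g x ∂μ := by
    intro φ
    induction φ using SimpleFunc.induction with
    | @const c s hs =>
      intro h
      have h1 : h.toLp _ = c • (hw.indicator hs).toLp _ := by
        rw [← MemLp.toLp_const_smul]
        congr 1
        ext x
        by_cases hx : x ∈ s <;> simp [hx, SimpleFunc.piecewise_apply]
      rw [h1, map_smul, hset s hs, smul_eq_mul, ← integral_const_mul, ← integral_indicator hs]
      congr 1
      ext x
      by_cases hx : x ∈ s <;> simp [hx, SimpleFunc.piecewise_apply]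
    | @add f g' hd hf hg' =>
      intro h
      obtain ⟨C, hC⟩ := f.exists_forall_norm_le
      obtain ⟨D, hD⟩ := g'.exists_forall_norm_le
      have hfm := hmul f C f.measurable hC
      have hgm := hmul g' D g'.measurable hD
      have h1 : h.toLp _ = hfm.toLp _ + hgm.toLp _ := by
        rw [← MemLp.toLp_add]
        congr 1
        ext x
        simp [add_mul]
      rw [h1, map_add, hf, hg', ← integral_add (hmuli f C f.measurable hC)
        (hmuli g' D g'.measurable hD)]
      simp [add_mul]
  refine ⟨g, hgm, hgi, fun φ C hφ hC h => ?_⟩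
  set S := fun n => SimpleFunc.approxOn φ hφ univ 0 (mem_univ _) n
  -- The simple approximants are bounded only by twice `|φ|`, whence the constant `C + C`.
  have hS : ∀ n x, ‖S n x‖ ≤ C + C := fun n x =>
    (SimpleFunc.norm_approxOn_zero_le hφ _ x n).trans (add_le_add (hC x) (hC x))
  have hlim : ∀ x, Tendsto (fun n => S n x) atTop (𝓝 (φ x)) := fun x =>
    SimpleFunc.tendsto_approxOn hφ _ (by simp)
  have hb : ∀ (ψ : α → ℝ) (D : ℝ) (v : α → ℝ), (∀ x, ‖ψ x‖ ≤ D) → ∀ x, ‖ψ x * v x‖ ≤ D * ‖v x‖ := by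
    intro ψ D v hψ x
    rw [norm_mul]
    exact mul_le_mul_of_nonneg_right (hψ x) (norm_nonneg _)
  have hCC : ∀ x, ‖φ x‖ ≤ C + C := fun x => by linarith [hC x, norm_nonneg (φ x)]
  have t1 : Tendsto (fun n => F ((hmul (S n) _ (S n).measurable (hS n)).toLp _)) atTop
      (𝓝 (F (h.toLp _))) :=
    (F.continuous.tendsto _).comp (MemLp.tendsto_toLp_of_dominated hp _ _
      (hw.norm.const_mul (C + C)) (fun n => .of_forall (hb _ _ _ (hS n)))
      (.of_forall (hb _ _ _ hCC)) (.of_forall fun x => (hlim x).mul_const _))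
  have t2 : Tendsto (fun n => ∫ x, S n x * g x ∂μ) atTop (𝓝 (∫ x, φ x * g x ∂μ)) :=
    tendsto_integral_of_dominated_convergence (fun x => (C + C) * ‖g x‖)
      (fun n => ((S n).measurable.mul hgm).aestronglyMeasurable) (hgi.norm.const_mul _)
      (fun n => .of_forall (hb _ _ _ (hS n))) (.of_forall fun x => (hlim x).mul_const _)
  exact tendsto_nhds_unique (t1.congr fun n => hsimple _ _) t2

/-- **Riesz representation theorem** for the dual of `L^p`, `1 < p < ∞`. -/
theorem exists_memLp_forall_dual_eq_integral [SigmaFinite μ] {p q : ℝ} (hpq : p.HolderConjugate q)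
    [Fact (1 ≤ ENNReal.ofReal p)] (F : StrongDual ℝ (Lp ℝ (ENNReal.ofReal p) μ)) :
    ∃ G : α → ℝ, MemLp G (ENNReal.ofReal q) μ ∧
      ∀ (f : α → ℝ) (hf : MemLp f (ENNReal.ofReal p) μ), F (hf.toLp f) = ∫ x, G x * f x ∂μ := by
  have hp0 : ENNReal.ofReal p ≠ 0 := by simpa using hpq.pos
  have hq0 : ENNReal.ofReal q ≠ 0 := by simpa using hpq.symm.pos
  obtain ⟨w, hw0, hwm, hw⟩ := exists_pos_memLp μ hp0 ENNReal.ofReal_ne_top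
  obtain ⟨g, hgm, hgi, hF⟩ := exists_integrable_forall_dual_mul_eq ENNReal.ofReal_ne_top F hw
  -- Division by the weight turns the density of `φ ↦ F (φ w)` into the density of `F` itself.
  set G : α → ℝ := fun x => g x / w x with hG
  have hGm : Measurable G := hgm.div hwm
  have hGw : ∀ x, G x * w x = g x := fun x => div_mul_cancel₀ _ (hw0 x).ne'
  -- the functional on functions which are dominated by a multiple of `w`
  have hF' : ∀ (f : α → ℝ) (C : ℝ), Measurable f → (∀ x, ‖f x‖ ≤ C * w x) →
      ∀ h : MemLp f (ENNReal.ofReal p) μ, F (h.toLp _) = ∫ x, G x * f x ∂μ := by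
    intro f C hf hC h
    have h1 : (fun x => f x / w x * w x) = f := funext fun x => div_mul_cancel₀ _ (hw0 x).ne'
    have := hF (fun x => f x / w x) C (hf.div hwm) (fun x => by
      rw [norm_div, Real.norm_of_nonneg (hw0 x).le, div_le_iff₀ (hw0 x)]
      exact hC x) (by rwa [h1])
    simp only [h1] at this
    rw [this]
    congr 1
    ext x
    simp only [hG]
    ring
  have hGq : MemLp G (ENNReal.ofReal q) μ := by
    -- On `B n` the extremal function `sign(G) |G|^(q-1)` of Hölder's inequality is dominated by `n
    -- w`, so the representation of `F` is already known for it. This bounds `∫ |G|^q` over `B n`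
    -- uniformly in `n`, and the sets `B n` exhaust the space.
    set B : ℕ → Set α := fun n => {x | |G x| ^ (q - 1) ≤ n * w x}
    have hBm : ∀ n, MeasurableSet (B n) := fun n =>
      measurableSet_le ((continuous_abs.measurable.comp hGm).pow_const _) (hwm.const_mul _)
    have hBmono : Monotone B := by
      intro i j hij
      refine ofPred_subset_ofPred.2 fun x hx => hx.trans ?_
      gcongr
      exact (hw0 x).le
    have hBU : ⋃ n, B n = univ := eq_univ_of_forall fun x => by
      obtain ⟨n, hn⟩ := exists_nat_ge (|G x| ^ (q - 1) / w x)
      exact mem_iUnion.2 ⟨n, (div_le_iff₀ (hw0 x)).1 hn⟩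
    have hbound : ∀ n, ∫⁻ x in B n, ‖G x‖ₑ ^ q ∂μ ≤ ‖F‖ₑ ^ q := by
      intro n
      set I := ∫⁻ x in B n, ‖G x‖ₑ ^ q ∂μ with hI
      set f : α → ℝ := (B n).indicator fun x => G x / |G x| * |G x| ^ (q - 1) with hf
      have hfm : Measurable f :=
        ((hGm.div (continuous_abs.measurable.comp hGm)).mul
          ((continuous_abs.measurable.comp hGm).pow_const _)).indicator (hBm n)
      have habs : ∀ x, |f x| ≤ |G x| ^ (q - 1) := by
        intro x
        have h0 : 0 ≤ |G x| ^ (q - 1) := by positivity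
        by_cases hx : x ∈ B n
        · rw [hf, indicator_of_mem hx, abs_mul, abs_of_nonneg h0]
          refine mul_le_of_le_one_left h0 ?_
          rw [abs_div, abs_abs]
          exact div_self_le_one _
        · rw [hf, indicator_of_notMem hx, abs_zero]
          exact h0
      have hfw : ∀ x, ‖f x‖ ≤ n * w x := by
        intro x
        by_cases hx : x ∈ B n
        · exact (habs x).trans hx
        · rw [hf, indicator_of_notMem hx, norm_zero]
          exact mul_nonneg n.cast_nonneg (hw0 x).le
      have hfp : MemLp f (ENNReal.ofReal p) μ :=
        (hw.const_mul n).mono' hfm.aestronglyMeasurable (.of_forall hfw)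
      have hGf : (fun x => G x * f x) = (B n).indicator fun x => |G x| ^ q := by
        ext x
        by_cases hx : x ∈ B n
        · rw [hf, indicator_of_mem hx, indicator_of_mem hx, ← mul_assoc]
          rcases eq_or_ne (G x) 0 with h0 | h0
          · simp [h0, hpq.symm.ne_zero]
          · rw [mul_div_assoc', ← abs_mul_abs_self, mul_div_cancel_right₀ _ (abs_ne_zero.2 h0),
              ← Real.rpow_one_add' (abs_nonneg _) (by simpa using hpq.symm.ne_zero)]
            congr 1
            ring
        · simp [hf, hx]
      have hGe : ∀ x, ENNReal.ofReal (|G x| ^ q) = ‖G x‖ₑ ^ q := fun x => by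
        rw [← ENNReal.ofReal_rpow_of_nonneg (abs_nonneg _) hpq.symm.nonneg,
          ← Real.norm_eq_abs, ofReal_norm]
      have hGqm : Measurable fun x => |G x| ^ q := (continuous_abs.measurable.comp hGm).pow_const _
      have hint : IntegrableOn (fun x => |G x| ^ q) (B n) μ := by
        refine Integrable.mono' (hgi.norm.const_mul n).integrableOn
          hGqm.aestronglyMeasurable ?_
        filter_upwards [ae_restrict_mem (hBm n)] with x hx
        rw [Real.norm_of_nonneg (by positivity), ← hGw, norm_mul, Real.norm_eq_abs,
          Real.norm_of_nonneg (hw0 x).le]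
        calc |G x| ^ q = |G x| * |G x| ^ (q - 1) := by
              rw [← Real.rpow_one_add' (abs_nonneg _) (by simpa using hpq.symm.ne_zero)]
              congr 1
              ring
          _ ≤ |G x| * (n * w x) := by gcongr; exact hx
          _ = _ := by ring
      have hIeq : ENNReal.ofReal (F (hfp.toLp f)) = I := by
        rw [hF' f n hfm hfw, hGf, integral_indicator (hBm n),
          ofReal_integral_eq_lintegral_ofReal hint (.of_forall fun x => by positivity)]
        exact lintegral_congr hGe
      -- Finiteness comes from the truncation to `B n`; it permits the cancellation of `I ^ (1 / p)`
      -- in `I ≤ ‖F‖ I ^ (1 / p)`.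
      have hIfin : I ≠ ∞ := hIeq ▸ ENNReal.ofReal_ne_top
      have hfn : eLpNorm f (ENNReal.ofReal p) μ ≤ I ^ (1 / p) := by
        rw [eLpNorm_eq_lintegral_rpow_enorm_toReal hp0 ENNReal.ofReal_ne_top,
          ENNReal.toReal_ofReal hpq.nonneg, hI, ← lintegral_indicator (hBm n)]
        refine ENNReal.rpow_le_rpow (lintegral_mono fun x => ?_) (by simpa using hpq.nonneg)
        by_cases hx : x ∈ B n
        · rw [indicator_of_mem hx, ← hGe, ← ofReal_norm,
            ENNReal.ofReal_rpow_of_nonneg (norm_nonneg _) hpq.nonneg]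
          refine ENNReal.ofReal_le_ofReal ?_
          calc ‖f x‖ ^ p ≤ (|G x| ^ (q - 1)) ^ p := by
                gcongr
                · exact hpq.nonneg
                · exact habs x
            _ = |G x| ^ q := by
                rw [← Real.rpow_mul (abs_nonneg _), hpq.symm.sub_one_mul_conj]
        · simp [hf, hx, hpq.pos]
      have hle : I ≤ ‖F‖ₑ * I ^ (1 / p) := by
        calc I = ENNReal.ofReal (F (hfp.toLp f)) := hIeq.symm
          _ ≤ ‖F (hfp.toLp f)‖ₑ := by
            rw [← ofReal_norm]
            exact ENNReal.ofReal_le_ofReal (le_abs_self _)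
          _ ≤ ‖F‖ₑ * ‖hfp.toLp f‖ₑ := F.le_opENorm _
          _ ≤ ‖F‖ₑ * I ^ (1 / p) := by
            rw [Lp.enorm_toLp]
            gcongr
      rcases eq_or_ne I 0 with h0 | h0
      · rw [h0]
        exact zero_le
      have h2 : I ^ (1 / q) ≤ ‖F‖ₑ := by
        have h3 : I = I ^ (1 / q) * I ^ (1 / p) := by
          rw [← ENNReal.rpow_add _ _ h0 hIfin, one_div, one_div, add_comm, hpq.inv_add_inv_eq_one,
            ENNReal.rpow_one]
        have h4 : I ^ (1 / p) ≠ 0 := by simp [h0, hIfin, hpq.pos]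
        have h5 : I ^ (1 / p) ≠ ∞ := by simp [h0, hIfin, hpq.pos]
        exact (ENNReal.mul_le_mul_iff_left h4 h5).1 (h3.symm.trans_le hle)
      calc I = (I ^ (1 / q)) ^ q := by
            rw [← ENNReal.rpow_mul, one_div_mul_cancel hpq.symm.ne_zero, ENNReal.rpow_one]
        _ ≤ ‖F‖ₑ ^ q := ENNReal.rpow_le_rpow h2 hpq.symm.nonneg
    refine ⟨hGm.aestronglyMeasurable, ?_⟩
    rw [eLpNorm_lt_top_iff_lintegral_rpow_enorm_lt_top hq0 ENNReal.ofReal_ne_top,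
      ENNReal.toReal_ofReal hpq.symm.nonneg, ← setLIntegral_univ, ← hBU,
      setLIntegral_iUnion_of_directed _ hBmono.directed_le]
    exact (iSup_le hbound).trans_lt (ENNReal.rpow_lt_top_of_nonneg hpq.symm.nonneg enorm_ne_top)
  refine ⟨G, hGq, fun f hf => ?_⟩
  obtain ⟨f', hf'm, hff'⟩ := hf.1.aemeasurable
  have hf' : MemLp f' (ENNReal.ofReal p) μ := hf.ae_eq hff'
  rw [MemLp.toLp_congr hf hf' hff', integral_congr_ae (g := fun x => G x * f' x)
    (hff'.mono fun x hx => by simp only [hx])]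
  -- The truncations of `f'` to the sets `A n` are dominated by multiples of `w` and converge to
  -- `f'` in `L^p`.
  set A : ℕ → Set α := fun n => {x | |f' x| ≤ n * w x}
  have hAm : ∀ n, MeasurableSet (A n) := fun n =>
    measurableSet_le (continuous_abs.measurable.comp hf'm) (hwm.const_mul _)
  have hlim : ∀ x, Tendsto (fun n => (A n).indicator f' x) atTop (𝓝 (f' x)) := by
    intro x
    obtain ⟨n, hn⟩ := exists_nat_ge (|f' x| / w x)
    refine tendsto_const_nhds.congr' ?_
    filter_upwards [eventually_ge_atTop n] with m hm
    rw [indicator_of_mem]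
    refine ((div_le_iff₀ (hw0 x)).1 hn).trans ?_
    gcongr
    exact (hw0 x).le
  have t1 : Tendsto (fun n => F ((hf'.indicator (hAm n)).toLp _)) atTop (𝓝 (F (hf'.toLp _))) :=
    (F.continuous.tendsto _).comp (MemLp.tendsto_toLp_of_dominated ENNReal.ofReal_ne_top _ _
      hf'.norm (fun n => .of_forall fun x => norm_indicator_le_norm_self _ _)
      (.of_forall fun x => le_rfl) (.of_forall hlim))
  have t2 : Tendsto (fun n => ∫ x, G x * (A n).indicator f' x ∂μ) atTop
      (𝓝 (∫ x, G x * f' x ∂μ)) :=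
    tendsto_integral_of_dominated_convergence (fun x => ‖G x * f' x‖)
      (fun n => (hGm.mul (hf'm.indicator (hAm n))).aestronglyMeasurable)
      (integrable_mul_of_memLp hpq.symm hGq hf').norm
      (fun n => .of_forall fun x => by
        rw [norm_mul, norm_mul]
        gcongr
        exact norm_indicator_le_norm_self _ _)
      (.of_forall fun x => (hlim x).const_mul _)
  refine tendsto_nhds_unique (t1.congr fun n => ?_) t2
  refine hF' _ n (hf'm.indicator (hAm n)) (fun x => ?_) _
  by_cases hx : x ∈ A n
  · rw [indicator_of_mem hx]
    exact hx
  · rw [indicator_of_notMem hx, norm_zero]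
    exact mul_nonneg n.cast_nonneg (hw0 x).le

/-- A linear functional which is bounded by the `L^p` norm of a linear map is represented by a
function in `L^q`. -/
theorem exists_memLp_forall_eq_integral [SigmaFinite μ] {p q : ℝ} (hpq : p.HolderConjugate q)
    {V : Type*} [AddCommGroup V] [Module ℝ V] (T : V →ₗ[ℝ] α → ℝ)
    (hT : ∀ v, MemLp (T v) (ENNReal.ofReal p) μ) (F : V →ₗ[ℝ] ℝ) (C : ℝ≥0)
    (hF : ∀ v, ‖F v‖ₑ ≤ C * eLpNorm (T v) (ENNReal.ofReal p) μ) :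
    ∃ G : α → ℝ, MemLp G (ENNReal.ofReal q) μ ∧ ∀ v, F v = ∫ x, G x * T v x ∂μ := by
  have : Fact (1 ≤ ENNReal.ofReal p) := ⟨by simpa using hpq.lt.le⟩
  let T' : V →ₗ[ℝ] Lp ℝ (ENNReal.ofReal p) μ :=
    { toFun := fun v => (hT v).toLp _
      map_add' := fun v w => by
        rw [← MemLp.toLp_add]
        exact MemLp.toLp_congr _ _ (by simp)
      map_smul' := fun c v => by
        rw [RingHom.id_apply, ← MemLp.toLp_const_smul]
        exact MemLp.toLp_congr _ _ (by simp) }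
  obtain ⟨L, hL, -⟩ := T'.exists_strongDual_comp_eq F C.2 fun v => by
    have := ENNReal.toReal_mono (ENNReal.mul_ne_top ENNReal.coe_ne_top (hT v).2.ne) (hF v)
    rw [toReal_enorm, ENNReal.toReal_mul] at this
    change |F v| ≤ C * ‖(hT v).toLp _‖
    rwa [Lp.norm_toLp]
  obtain ⟨G, hG, hLG⟩ := exists_memLp_forall_dual_eq_integral hpq L
  exact ⟨G, hG, fun v => (hL v).symm.trans (hLG _ (hT v))⟩

end MeasureTheory

/-! ### Cutoff functions and density of the test functions in `L^q`. -/

/-- A compact subset of an open set has a smooth cutoff function. -/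
theorem IsCompact.exists_testFunction_eq_one {E : Type*} [NormedAddCommGroup E] [NormedSpace ℝ E]
    [FiniteDimensional ℝ E] {K : Set E} (hK : IsCompact K) {U : Opens E} (hKU : K ⊆ U) :
    ∃ χ : 𝓓(U, ℝ), (∀ᶠ x in 𝓝ˢ K, χ x = 1) ∧ ∀ x, χ x ∈ Icc (0 : ℝ) 1 := by
  obtain ⟨L, hL, hKL, hLU⟩ := exists_compact_between hK U.isOpen hKU
  obtain ⟨f, hf1, hf0, hf⟩ := exists_contMDiffMap_one_nhds_of_subset_interior
    (n := (⊤ : ℕ∞)) (modelWithCornersSelf ℝ E) hK.isClosed hKL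
  have hsupp : tsupport f ⊆ L := closure_minimal
    (fun x hx => by_contra fun h => hx (hf0 x h)) hL.isClosed
  exact ⟨⟨f, f.contMDiff.contDiff, hL.of_isClosed_subset (isClosed_tsupport _) hsupp,
    hsupp.trans hLU⟩, hf1, hf⟩

namespace MeasureTheory

variable {E : Type*} [NormedAddCommGroup E] [NormedSpace ℝ E] [FiniteDimensional ℝ E]
  [MeasurableSpace E] [BorelSpace E] {μ : Measure E} [IsFiniteMeasureOnCompacts μ]

theorem _root_.TopologicalSpace.Opens.exists_monotone_isCompact_iUnion_eq {E : Type*}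
    [PseudoMetricSpace E] [ProperSpace E]
    [Nonempty E] (U : Opens E) :
    ∃ K : ℕ → Set E, Monotone K ∧ (∀ i, IsCompact (K i)) ∧ ⋃ i, K i = U := by
  obtain ⟨F, hF, hFU, hU, hmono⟩ := U.isOpen.exists_iUnion_isClosed
  obtain ⟨x₀⟩ := ‹Nonempty E›
  have hb : Monotone fun i : ℕ => Metric.closedBall x₀ (i : ℝ) := fun i j hij =>
    Metric.closedBall_subset_closedBall (by exact_mod_cast hij)
  refine ⟨fun i => F i ∩ Metric.closedBall x₀ i, hmono.inter hb,
    fun i => (isCompact_closedBall _ _).inter_left (hF i), ?_⟩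
  rw [iUnion_inter_of_monotone hmono hb, hU, Metric.iUnion_closedBall_nat, inter_univ]

/-- The test functions on an open set `U` are dense in `L^q(U)`. -/
theorem MemLp.exists_testFunction_eLpNorm_sub_le {U : Opens E} {q : ℝ≥0∞} (hq1 : 1 ≤ q)
    (hq : q ≠ ∞) {G : E → ℝ} (hG : MemLp G q (μ.restrict U)) {ε : ℝ≥0∞} (hε : 0 < ε) :
    ∃ g : 𝓓(U, ℝ), eLpNorm (G - ⇑g) q (μ.restrict U) ≤ ε := by
  obtain ⟨K, hKm, hKc, hKU⟩ := U.exists_monotone_isCompact_iUnion_eq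
  have h1 : Tendsto (fun i => eLpNorm ((K i).indicator G - G) q (μ.restrict U)) atTop (𝓝 0) := by
    refine tendsto_eLpNorm_sub_of_dominated (one_pos.trans_le hq1).ne' hq
      (fun i => hG.1.indicator (hKc i).measurableSet) hG.1 hG.norm
      (fun i => .of_forall fun x => norm_indicator_le_norm_self _ _) (.of_forall fun x => le_rfl) ?_
    filter_upwards [ae_restrict_mem U.isOpen.measurableSet] with x hx
    obtain ⟨i, hi⟩ := mem_iUnion.1 (hKU.symm ▸ hx)
    refine tendsto_const_nhds.congr' ?_
    filter_upwards [eventually_ge_atTop i] with j hj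
    rw [indicator_of_mem (hKm hj hi)]
  obtain ⟨δ, hδ0, hδ⟩ : ∃ δ : ℝ, 0 < δ ∧ ENNReal.ofReal δ ≤ ε / 2 := by
    obtain ⟨δ, hδ0, hδ⟩ := ENNReal.lt_iff_exists_nnreal_btwn.1 (ENNReal.half_pos hε.ne')
    exact ⟨δ, by exact_mod_cast hδ0, by simpa using hδ.le⟩
  obtain ⟨i, hi⟩ := (h1.eventually (ge_mem_nhds (ENNReal.half_pos hε.ne'))).exists
  have hKiU : K i ⊆ U := hKU ▸ subset_iUnion K i
  have hGK : MemLp ((K i).indicator G) q μ := by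
    rw [memLp_indicator_iff_restrict (hKc i).measurableSet]
    exact hG.mono_measure (Measure.restrict_mono hKiU le_rfl)
  obtain ⟨h, -, hhs, hhG⟩ := hGK.exist_eLpNorm_sub_le hq hq1 hδ0
  obtain ⟨χ, hχ1, hχ⟩ := (hKc i).exists_testFunction_eq_one hKiU
  -- Multiplying by `χ` brings the support into `U`. It does not increase the error: `χ` fixes `1_K
  -- G`, and `0 ≤ χ ≤ 1`.
  refine ⟨⟨fun x => χ x * h x, χ.contDiff.mul hhs, χ.hasCompactSupport.mul_right,
    (tsupport_mul_subset_left).trans χ.tsupport_subset⟩, ?_⟩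
  have hGKm : AEStronglyMeasurable ((K i).indicator G) (μ.restrict U) :=
    hG.1.indicator (hKc i).measurableSet
  set g : E → ℝ := fun x => χ x * h x with hg
  have hgm : AEStronglyMeasurable g (μ.restrict U) :=
    (χ.continuous.mul hhs.continuous).aestronglyMeasurable
  change eLpNorm (G - g) q _ ≤ ε
  have hsplit : G - g = (G - (K i).indicator G) + ((K i).indicator G - g) := by abel
  rw [hsplit]
  refine (eLpNorm_add_le (hG.1.sub hGKm) (hGKm.sub hgm) hq1).trans ?_
  rw [← ENNReal.add_halves ε]
  refine add_le_add (by rwa [eLpNorm_sub_comm]) (le_trans ?_ (hhG.trans hδ))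
  refine (eLpNorm_mono_measure _ Measure.restrict_le_self).trans (eLpNorm_mono fun x => ?_)
  have : ((K i).indicator G - g) x = χ x * ((K i).indicator G - h) x := by
    by_cases hx : x ∈ K i
    · simp [hg, hx, (hχ1.self_of_nhdsSet x hx)]
    · simp [hg, hx]
  rw [this, norm_mul, Real.norm_of_nonneg (hχ x).1]
  exact mul_le_of_le_one_left (norm_nonneg _) (hχ x).2

end MeasureTheory

/-! ### Distributions represented by functions. -/

namespace SobolevDuality

variable {n : ℕ} {Ω : Opens (EuclideanSpace ℝ (Fin n))}

theorem dist_add_apply (u v : 𝓓'(Ω, ℝ)) (φ : 𝓓(Ω, ℝ)) : (u + v) φ = u φ + v φ := rfl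

theorem dist_zero_apply (φ : 𝓓(Ω, ℝ)) : (0 : 𝓓'(Ω, ℝ)) φ = 0 := rfl

/-- A locally integrable function defines a distribution. -/
theorem exists_isRepr {f : EuclideanSpace ℝ (Fin n) → ℝ} (hf : LocallyIntegrableOn f Ω) :
    ∃ u : 𝓓'(Ω, ℝ), IsRepr u f := by
  refine ⟨UniformConvergenceCLM.ofFun _ _ _ (TestFunction.integralAgainstBilinCLM
    (ContinuousLinearMap.mul ℝ ℝ) volume f), hf, fun φ => ?_⟩
  change TestFunction.integralAgainstBilinCLM (ContinuousLinearMap.mul ℝ ℝ) volume f φ = _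
  rw [TestFunction.integralAgainstBilinCLM_eq_integral hf,
    setIntegral_eq_integral_of_forall_compl_eq_zero]
  · simp [mul_comm]
  · intro x hx
    rw [image_eq_zero_of_notMem_tsupport fun h => hx (φ.tsupport_subset h), mul_zero]

theorem testFunction_locallyIntegrableOn (φ : 𝓓(Ω, ℝ)) : LocallyIntegrableOn φ Ω :=
  (φ.continuous.locallyIntegrable (μ := volume)).locallyIntegrableOn _

/-- Two functions which represent the same distribution agree almost everywhere. -/
theorem IsRepr.ae_eq {u : 𝓓'(Ω, ℝ)} {f g : EuclideanSpace ℝ (Fin n) → ℝ} (hf : IsRepr u f)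
    (hg : IsRepr u g) : f =ᵐ[volume.restrict Ω] g := by
  have hfg : IsRepr (u + (-1 : ℝ) • u) (f + (-1 : ℝ) • g) := hf.add (hg.smul _)
  have := Ω.isOpen.ae_eq_zero_of_integral_contDiff_smul_eq_zero (μ := volume) hfg.1 (by
    intro φ hφ hφc hφs
    have h := hfg.2 ⟨φ, hφ, hφc, hφs⟩
    have h0 : u + (-1 : ℝ) • u = 0 := by simp
    rw [h0, dist_zero_apply, setIntegral_eq_integral_of_forall_compl_eq_zero] at h
    · rw [h]
      exact integral_congr_ae (.of_forall fun x => mul_comm _ _)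
    · intro x hx
      change _ * φ x = 0
      rw [image_eq_zero_of_notMem_tsupport fun h => hx (hφs h), mul_zero])
  rw [Filter.EventuallyEq, ae_restrict_iff' Ω.isOpen.measurableSet]
  filter_upwards [this] with x hx hxΩ
  have := hx hxΩ
  simp at this
  linarith

theorem IsRepr.congr {u : 𝓓'(Ω, ℝ)} {f g : EuclideanSpace ℝ (Fin n) → ℝ} (hf : IsRepr u f)
    (hfg : f =ᵐ[volume.restrict Ω] g) : IsRepr u g := by
  refine ⟨fun x hx => ?_, fun φ => ?_⟩
  · obtain ⟨s, hs, hfs⟩ := hf.1 x hx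
    refine ⟨s ∩ Ω, inter_mem hs self_mem_nhdsWithin, ?_⟩
    refine (hfs.mono_set inter_subset_left).congr ?_
    exact ae_restrict_of_ae_restrict_of_subset inter_subset_right hfg
  · rw [hf.2]
    exact integral_congr_ae (hfg.mono fun x hx => by simp only [hx])

theorem IsRepr.ext {u v : 𝓓'(Ω, ℝ)} {f : EuclideanSpace ℝ (Fin n) → ℝ} (hu : IsRepr u f)
    (hv : IsRepr v f) : u = v := by
  ext φ
  rw [hu.2, hv.2]

theorem IsRepr.sub {u v : 𝓓'(Ω, ℝ)} {f g : EuclideanSpace ℝ (Fin n) → ℝ} (hf : IsRepr u f)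
    (hg : IsRepr v g) : IsRepr (u - v) (f - g) := by
  have := hf.add (hg.smul (-1))
  simpa [sub_eq_add_neg] using this

/-- The distribution defined by a test function. -/
noncomputable def testDist : 𝓓(Ω, ℝ) →ₗ[ℝ] 𝓓'(Ω, ℝ) where
  toFun φ := (exists_isRepr (testFunction_locallyIntegrableOn φ)).choose
  map_add' φ η := IsRepr.ext (exists_isRepr (testFunction_locallyIntegrableOn (φ + η))).choose_spec
    ((exists_isRepr (testFunction_locallyIntegrableOn φ)).choose_spec.add
      (exists_isRepr (testFunction_locallyIntegrableOn η)).choose_spec)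
  map_smul' c φ := IsRepr.ext (exists_isRepr (testFunction_locallyIntegrableOn (c • φ))).choose_spec
    ((exists_isRepr (testFunction_locallyIntegrableOn φ)).choose_spec.smul c)

theorem isRepr_testDist (φ : 𝓓(Ω, ℝ)) : IsRepr (testDist φ) φ :=
  (exists_isRepr (testFunction_locallyIntegrableOn φ)).choose_spec

theorem testDist_apply (φ η : 𝓓(Ω, ℝ)) : testDist φ η = ∫ x in Ω, φ x * η x :=
  (isRepr_testDist φ).2 η

theorem testDist_comm (φ η : 𝓓(Ω, ℝ)) : testDist φ η = testDist η φ := by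
  simp only [testDist_apply, mul_comm]

theorem IsRepr.eq_testDist {u : 𝓓'(Ω, ℝ)} {φ : 𝓓(Ω, ℝ)} (h : IsRepr u φ) : u = testDist φ :=
  h.ext (isRepr_testDist φ)

theorem mulDist_testDist (ψ φ : 𝓓(Ω, ℝ)) : mulDist ψ (testDist φ) = testDist (mulTest ψ φ) := by
  ext η
  rw [mulDist_apply, testDist_apply, testDist_apply]
  simp only [mulTest_apply]
  congr 1
  ext x
  ring

/-! ### Distributions and supports -/

/-- Partition of unity: with `χ` supported in `V` and equal to `1` near the part of the support of
`φ` outside `W`, the function `χ φ` lives in `V` and `(1 - χ) φ` lives in `W`. -/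
theorem isVanishingOn_union {u : 𝓓'(Ω, ℝ)} {V W : Set (EuclideanSpace ℝ (Fin n))} (hV : IsOpen V)
    (hW : IsOpen W) (h₁ : IsVanishingOn u V) (h₂ : IsVanishingOn u W) :
    IsVanishingOn u (V ∪ W) := by
  intro φ hφ
  obtain ⟨χ, hχ1, -⟩ := (φ.hasCompactSupport.isCompact.diff hW).exists_testFunction_eq_one
    (U := ⟨V ∩ Ω, hV.inter Ω.isOpen⟩) (fun x hx => ⟨(hφ hx.1).resolve_right hx.2,
      φ.tsupport_subset hx.1⟩)
  let ψ : 𝓓(Ω, ℝ) := ⟨χ, χ.contDiff, χ.hasCompactSupport,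
    χ.tsupport_subset.trans inter_subset_right⟩
  have h3 : u (mulTest ψ φ) = 0 := h₁ _ <|
    (tsupport_mul_subset_right (f := φ) (g := ψ)).trans (χ.tsupport_subset.trans inter_subset_left)
  have h4 : u (φ - mulTest ψ φ) = 0 := by
    refine h₂ _ fun x hx => ?_
    by_contra hxW
    have hx' : x ∈ tsupport φ := by
      refine closure_mono (fun y (hy : φ y - φ y * ψ y ≠ 0) (hy0 : φ y = 0) => hy ?_) hx
      rw [hy0]
      ring
    refine (notMem_tsupport_iff_eventuallyEq.2 ?_) hx
    have := (eventually_nhdsSet_iff_forall.1 hχ1) x ⟨hx', hxW⟩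
    filter_upwards [this] with y hy
    change φ y - φ y * χ y = 0
    rw [hy]
    ring
  rw [map_sub, h3, sub_zero] at h4
  exact h4

/-- The complement of `dsupport u` is described pointwise; by compactness finitely many open sets on
which `u` vanishes cover the support of `φ`, and they are glued by `isVanishingOn_union`. -/
theorem apply_eq_zero_of_disjoint_dsupport {u : 𝓓'(Ω, ℝ)} {φ : 𝓓(Ω, ℝ)}
    (h : Disjoint (tsupport φ) (dsupport u)) : u φ = 0 := by
  obtain ⟨V, -, hVu, hV⟩ : ∃ V, IsOpen V ∧ IsVanishingOn u V ∧ tsupport φ ⊆ V := by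
    refine IsCompact.induction_on (p := fun s => ∃ V, IsOpen V ∧ IsVanishingOn u V ∧ s ⊆ V)
      φ.hasCompactSupport.isCompact ?_ ?_ ?_ ?_
    · refine ⟨∅, isOpen_empty, fun φ hφ => ?_, empty_subset _⟩
      rw [subset_empty_iff, tsupport_eq_empty_iff] at hφ
      rw [show φ = 0 from DFunLike.coe_injective hφ, map_zero]
    · rintro s t hst ⟨V, hV, hVu, htV⟩
      exact ⟨V, hV, hVu, hst.trans htV⟩
    · rintro s t ⟨V, hV, hVu, hsV⟩ ⟨W, hW, hWu, htW⟩
      exact ⟨V ∪ W, hV.union hW, isVanishingOn_union hV hW hVu hWu, union_subset_union hsV htW⟩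
    · intro x hx
      obtain ⟨V, hVu, hV, hxV⟩ := (notMem_dsupport_iff x).1 (disjoint_left.1 h hx)
      exact ⟨V, mem_nhdsWithin_of_mem_nhds (hV.mem_nhds hxV), V, hV, hVu, subset_rfl⟩
  exact hVu φ hV

theorem apply_eq_of_eventuallyEq {u : 𝓓'(Ω, ℝ)} {φ η : 𝓓(Ω, ℝ)}
    (h : ∀ᶠ x in 𝓝ˢ (dsupport u), φ x = η x) : u φ = u η := by
  rw [← sub_eq_zero, ← map_sub]
  refine apply_eq_zero_of_disjoint_dsupport (disjoint_right.2 fun x hx => ?_)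
  refine notMem_tsupport_iff_eventuallyEq.2 ?_
  filter_upwards [(eventually_nhdsSet_iff_forall.1 h) x hx] with y hy
  exact sub_eq_zero.2 hy

theorem IsCutoff.mulDist_eq {ψ : 𝓓(Ω, ℝ)} {u : 𝓓'(Ω, ℝ)} (h : IsCutoff ψ u) : mulDist ψ u = u := by
  ext φ
  refine apply_eq_of_eventuallyEq (h.mono fun x hx => ?_)
  change φ x * ψ x = φ x
  rw [hx, mul_one]

theorem dsupport_mulDist_subset (ψ : 𝓓(Ω, ℝ)) (u : 𝓓'(Ω, ℝ)) :
    dsupport (mulDist ψ u) ⊆ tsupport ψ := by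
  refine fun x hx => by_contra fun h => (notMem_dsupport_iff x).2 ⟨(tsupport ψ)ᶜ, fun φ hφ => ?_,
    (isClosed_tsupport _).isOpen_compl, h⟩ hx
  rw [mulDist_apply]
  convert map_zero u
  ext x
  rw [mulTest_apply]
  by_cases hx : x ∈ tsupport ψ
  · rw [image_eq_zero_of_notMem_tsupport fun h => hφ h hx, zero_mul]
    rfl
  · rw [image_eq_zero_of_notMem_tsupport hx, mul_zero]
    rfl

/-- A function which represents a distribution vanishes off its support. -/
theorem IsRepr.ae_eq_zero_of_dsupport_subset {u : 𝓓'(Ω, ℝ)} {f : EuclideanSpace ℝ (Fin n) → ℝ}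
    (hf : IsRepr u f) {K : Set (EuclideanSpace ℝ (Fin n))} (hK : IsClosed K)
    (h : dsupport u ⊆ K) : ∀ᵐ x ∂volume.restrict Ω, x ∉ K → f x = 0 := by
  have := (Ω.isOpen.inter hK.isOpen_compl).ae_eq_zero_of_integral_contDiff_smul_eq_zero
    (μ := volume) (hf.1.mono_set inter_subset_left) (by
    intro φ hφ hφc hφs
    have h1 := hf.2 ⟨φ, hφ, hφc, hφs.trans inter_subset_left⟩
    rw [apply_eq_zero_of_disjoint_dsupport, setIntegral_eq_integral_of_forall_compl_eq_zero] at h1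
    · rw [h1]
      exact integral_congr_ae (.of_forall fun x => mul_comm _ _)
    · intro x hx
      change _ * φ x = 0
      rw [image_eq_zero_of_notMem_tsupport fun h => hx (hφs h).1, mul_zero]
    · exact disjoint_left.2 fun x hx hxu => (hφs hx).2 (h hxu))
  rw [ae_restrict_iff' Ω.isOpen.measurableSet]
  filter_upwards [this] with x hx hxΩ hxK using hx ⟨hxΩ, hxK⟩

end SobolevDuality

/-! ### The closure of the test functions and abstract dual pairs. -/

namespace SobolevDuality

variable {n : ℕ} {Ω : Opens (EuclideanSpace ℝ (Fin n))} {N M : ExtSeminorm 𝓓'(Ω, ℝ)}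

theorem ExtSeminorm.enorm_eq {V : Type*} [AddCommGroup V] [Module ℝ V] (N : ExtSeminorm V)
    (u : N.Space) : ‖u‖ₑ = N.toFun (N.incl u) := by
  rw [← ofReal_norm]
  exact ENNReal.ofReal_toReal (N.toFun_incl_lt_top u).ne

theorem ExtSeminorm.incl_injective {V : Type*} [AddCommGroup V] [Module ℝ V] (N : ExtSeminorm V) :
    Function.Injective N.incl := Subtype.val_injective

theorem TestClosure.enorm_eq (w : TestClosure N) : ‖w‖ₑ = N.toFun w.toDist :=
  N.enorm_eq w.toSpace

theorem TestClosure.toSpace_injective :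
    Function.Injective (TestClosure.toSpace : TestClosure N →ₗ[ℝ] N.Space) :=
  Subtype.val_injective

theorem TestClosure.toDist_injective :
    Function.Injective (TestClosure.toDist : TestClosure N →ₗ[ℝ] 𝓓'(Ω, ℝ)) :=
  N.incl_injective.comp TestClosure.toSpace_injective

/-- The test functions have finite norm. -/
def FiniteOnTest (N : ExtSeminorm 𝓓'(Ω, ℝ)) : Prop := ∀ φ : 𝓓(Ω, ℝ), N.toFun (testDist φ) < ∞

/-- The map from the test functions to their closure. -/
noncomputable def FiniteOnTest.map (hN : FiniteOnTest N) : 𝓓(Ω, ℝ) →ₗ[ℝ] TestClosure N where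
  toFun φ := ⟨⟨testDist φ, hN φ⟩, subset_closure ⟨φ, isRepr_testDist φ⟩⟩
  map_add' φ η := TestClosure.toDist_injective (map_add testDist φ η)
  map_smul' c φ := TestClosure.toDist_injective (map_smul testDist c φ)

theorem FiniteOnTest.toDist_map (hN : FiniteOnTest N) (φ : 𝓓(Ω, ℝ)) :
    (hN.map φ).toDist = testDist φ := rfl

theorem FiniteOnTest.enorm_map (hN : FiniteOnTest N) (φ : 𝓓(Ω, ℝ)) :
    ‖hN.map φ‖ₑ = N.toFun (testDist φ) := TestClosure.enorm_eq _

theorem FiniteOnTest.denseRange_map (hN : FiniteOnTest N) : DenseRange hN.map := by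
  intro w
  have hw : w.toSpace ∈ closure (testFunctions N : Set N.Space) := w.2
  have hind : Topology.IsInducing (TestClosure.toSpace : TestClosure N → N.Space) :=
    Topology.IsInducing.subtypeVal
  rw [hind.closure_eq_preimage_closure_image]
  refine closure_mono ?_ hw
  rintro x ⟨φ, hφ⟩
  exact ⟨hN.map φ, ⟨φ, rfl⟩, N.incl_injective hφ.eq_testDist.symm⟩

theorem restrictsTo_iff (hN : FiniteOnTest N) {F : StrongDual ℝ (TestClosure N)} {u : 𝓓'(Ω, ℝ)} :
    RestrictsTo F u ↔ ∀ φ, F (hN.map φ) = u φ := by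
  refine ⟨fun h φ => h _ _ (isRepr_testDist φ), fun h w φ hw => ?_⟩
  rw [← h φ]
  congr 1
  exact TestClosure.toDist_injective hw.eq_testDist

/-- Density of the test functions. It makes the functional chosen in `dualPairing` irrelevant. -/
theorem RestrictsTo.unique (hN : FiniteOnTest N) {F G : StrongDual ℝ (TestClosure N)}
    {u : 𝓓'(Ω, ℝ)} (hF : RestrictsTo F u) (hG : RestrictsTo G u) : F = G := by
  refine ContinuousLinearMap.ext fun w => congrFun
    (hN.denseRange_map.equalizer F.continuous G.continuous (funext fun φ => ?_)) w
  exact ((restrictsTo_iff hN).1 hF φ).trans ((restrictsTo_iff hN).1 hG φ).symm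

/-- A bound on test functions alone suffices: Hahn-Banach is applied to the map of the test
functions into their closure. -/
theorem exists_restrictsTo (hN : FiniteOnTest N) {u : 𝓓'(Ω, ℝ)} {C : ℝ≥0}
    (h : ∀ φ, ‖u φ‖ₑ ≤ C * N.toFun (testDist φ)) :
    ∃ F : StrongDual ℝ (TestClosure N), RestrictsTo F u ∧ ‖F‖ ≤ C := by
  obtain ⟨F, hF, hFC⟩ := hN.map.exists_strongDual_comp_eq
    (F := { toFun := u, map_add' := map_add u, map_smul' := map_smul u }) C.2 fun φ => by
      have := h φ
      rw [← hN.enorm_map] at this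
      have := ENNReal.toReal_mono (by finiteness) this
      rwa [ENNReal.toReal_mul, toReal_enorm, toReal_enorm] at this
  exact ⟨F, (restrictsTo_iff hN).2 hF, hFC⟩

theorem RestrictsTo.enorm_le (hN : FiniteOnTest N) {F : StrongDual ℝ (TestClosure N)}
    {u : 𝓓'(Ω, ℝ)} (hF : RestrictsTo F u) (φ : 𝓓(Ω, ℝ)) :
    ‖u φ‖ₑ ≤ ‖F‖ₑ * N.toFun (testDist φ) := by
  rw [← (restrictsTo_iff hN).1 hF, ← hN.enorm_map]
  exact F.le_opENorm _

/-- On test functions with support in a fixed compact set, the norm is bounded by a continuous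
seminorm. -/
def BoundedOnTest (N : ExtSeminorm 𝓓'(Ω, ℝ)) : Prop :=
  ∀ (K : Compacts (EuclideanSpace ℝ (Fin n))) (hK : (K : Set (EuclideanSpace ℝ (Fin n))) ⊆ Ω),
    ∃ q : Seminorm ℝ 𝓓_{K}(EuclideanSpace ℝ (Fin n), ℝ), Continuous q ∧
      ∀ φ, N.toFun (testDist (TestFunction.ofSupportedIn hK φ)) ≤ ENNReal.ofReal (q φ)

theorem BoundedOnTest.finite (hN : BoundedOnTest N) : FiniteOnTest N := fun φ => by
  obtain ⟨q, -, hq⟩ := hN ⟨tsupport φ, φ.hasCompactSupport⟩ φ.tsupport_subset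
  exact (hq (.of_support_subset φ.contDiff (subset_tsupport φ))).trans_lt ENNReal.ofReal_lt_top

/-- A linear functional on the test functions which is bounded by a norm is a distribution. -/
theorem BoundedOnTest.exists_dist (hN : BoundedOnTest N) (T : 𝓓(Ω, ℝ) →ₗ[ℝ] ℝ) (C : ℝ≥0)
    (hT : ∀ φ, ‖T φ‖ₑ ≤ C * N.toFun (testDist φ)) : ∃ u : 𝓓'(Ω, ℝ), ∀ φ, u φ = T φ := by
  have hc : Continuous T := by
    rw [TestFunction.continuous_iff_continuous_comp]
    intro K hK
    obtain ⟨q, hqc, hq⟩ := hN K hK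
    let S : 𝓓_{K}(EuclideanSpace ℝ (Fin n), ℝ) →ₗ[ℝ] ℝ :=
      T ∘ₗ (TestFunction.ofSupportedInCLM ℝ hK).toLinearMap
    have hS : ∀ φ, ‖S φ‖ ≤ C * q φ := fun φ => by
      have := (hT (TestFunction.ofSupportedIn hK φ)).trans (mul_le_mul_right (hq φ) _)
      have := ENNReal.toReal_mono (by finiteness) this
      rwa [ENNReal.toReal_mul, toReal_enorm, ENNReal.toReal_ofReal (apply_nonneg q φ)] at this
    have hS0 : Tendsto S (𝓝 0) (𝓝 (S 0)) := by
      rw [map_zero]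
      refine squeeze_zero_norm hS ?_
      have := (hqc.tendsto 0).const_mul (C : ℝ)
      simpa using this
    exact continuous_of_continuousAt_zero S hS0
  exact ⟨UniformConvergenceCLM.ofFun _ _ _ ⟨T, hc⟩, fun φ => rfl⟩

/-- The properties of the pair of norms of `W^{s,p}(Ω)` and `W^{-s,p'}(Ω)` on which the duality
of `W^{s,p}_loc(Ω)` and `W^{-s,p'}_comp(Ω)` rests. -/
structure IsDualPair (N M : ExtSeminorm 𝓓'(Ω, ℝ)) : Prop where
  bounded_left : BoundedOnTest N
  bounded_right : BoundedOnTest M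
  apply_le : ∀ φ : 𝓓(Ω, ℝ), ∃ C : ℝ≥0, ∀ u, ‖u φ‖ₑ ≤ C * M.toFun u
  testDist_le : ∀ φ η : 𝓓(Ω, ℝ),
    ‖testDist φ η‖ₑ ≤ M.toFun (testDist φ) * N.toFun (testDist η)
  right_finite : ∀ (v : 𝓓'(Ω, ℝ)) (C : ℝ≥0),
    (∀ φ, ‖v φ‖ₑ ≤ C * N.toFun (testDist φ)) → M.toFun v < ∞
  closure_left : ∀ (u : N.Space) (K : Compacts (EuclideanSpace ℝ (Fin n))),
    (K : Set (EuclideanSpace ℝ (Fin n))) ⊆ Ω → dsupport (N.incl u) ⊆ K →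
      u ∈ (testFunctions N).topologicalClosure
  closure_right : ∀ (u : M.Space) (K : Compacts (EuclideanSpace ℝ (Fin n))),
    (K : Set (EuclideanSpace ℝ (Fin n))) ⊆ Ω → dsupport (M.incl u) ⊆ K →
      u ∈ (testFunctions M).topologicalClosure

namespace IsDualPair

theorem finite_left (h : IsDualPair N M) : FiniteOnTest N := h.bounded_left.finite

theorem finite_right (h : IsDualPair N M) : FiniteOnTest M := h.bounded_right.finite

/-- For a test function `v` this is `testDist_le`. Both sides are continuous in `v`, the left one
because of `apply_le`, so the inequality passes to the closure. -/
theorem toDist_apply_le (h : IsDualPair N M) (v : TestClosure M) (η : 𝓓(Ω, ℝ)) :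
    ‖v.toDist η‖ₑ ≤ ‖v‖ₑ * N.toFun (testDist η) := by
  obtain ⟨C, hC⟩ := h.apply_le η
  have hc : Continuous fun v : TestClosure M => v.toDist η := by
    let T : TestClosure M →ₗ[ℝ] ℝ :=
      { toFun := fun v => v.toDist η
        map_add' := fun v w => by rw [map_add]; rfl
        map_smul' := fun c v => by rw [map_smul]; rfl }
    refine (T.mkContinuous C fun v => ?_).continuous
    have := hC v.toDist
    rw [← TestClosure.enorm_eq] at this
    have := ENNReal.toReal_mono (by finiteness) this
    rwa [ENNReal.toReal_mul, toReal_enorm, toReal_enorm] at this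
  have hcl : IsClosed {v : TestClosure M | ‖v.toDist η‖ₑ ≤ ‖v‖ₑ * N.toFun (testDist η)} :=
    isClosed_le hc.enorm (ENNReal.continuous_mul_const (h.finite_left η).ne |>.comp
      continuous_enorm)
  refine h.finite_right.denseRange_map.induction_on v hcl fun φ => ?_
  rw [h.finite_right.toDist_map, h.finite_right.enorm_map]
  exact h.testDist_le φ η

theorem exists_functional (h : IsDualPair N M) (v : TestClosure M) :
    ∃ F : StrongDual ℝ (TestClosure N), RestrictsTo F v.toDist ∧ ‖F‖ ≤ ‖v‖ :=
  exists_restrictsTo h.finite_left (C := ‖v‖₊) fun φ => h.toDist_apply_le v φ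

/-- The pairing of the closures of the test functions. -/
noncomputable def pair (h : IsDualPair N M) : TestClosure M →L[ℝ] StrongDual ℝ (TestClosure N) :=
  LinearMap.mkContinuous
    { toFun := fun v => (h.exists_functional v).choose
      map_add' := fun v w => RestrictsTo.unique h.finite_left
        (h.exists_functional (v + w)).choose_spec.1 ((restrictsTo_iff h.finite_left).2 fun φ => by
          have h1 := (restrictsTo_iff h.finite_left).1 (h.exists_functional v).choose_spec.1 φ
          have h2 := (restrictsTo_iff h.finite_left).1 (h.exists_functional w).choose_spec.1 φ
          rw [add_apply, h1, h2, map_add]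
          rfl)
      map_smul' := fun c v => RestrictsTo.unique h.finite_left
        (h.exists_functional (c • v)).choose_spec.1 ((restrictsTo_iff h.finite_left).2 fun φ => by
          have h1 := (restrictsTo_iff h.finite_left).1 (h.exists_functional v).choose_spec.1 φ
          rw [RingHom.id_apply, smul_apply, h1, map_smul]
          rfl) } 1 fun v => by
    rw [one_mul]
    exact (h.exists_functional v).choose_spec.2

theorem restrictsTo_pair (h : IsDualPair N M) (v : TestClosure M) :
    RestrictsTo (h.pair v) v.toDist :=
  (h.exists_functional v).choose_spec.1

theorem pair_map (h : IsDualPair N M) (v : TestClosure M) (φ : 𝓓(Ω, ℝ)) :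
    h.pair v (h.finite_left.map φ) = v.toDist φ :=
  (restrictsTo_iff h.finite_left).1 (h.restrictsTo_pair v) φ

end IsDualPair

/-- Multiplication by test functions is bounded. -/
def HasMul (N : ExtSeminorm 𝓓'(Ω, ℝ)) : Prop :=
  ∀ φ : 𝓓(Ω, ℝ), ∃ m : N.Space →L[ℝ] N.Space, ∀ u, N.incl (m u) = mulDist φ (N.incl u)

theorem HasMul.exists_le (hm : HasMul N) (φ : 𝓓(Ω, ℝ)) :
    ∃ C : ℝ≥0, ∀ u, N.toFun u < ∞ → N.toFun (mulDist φ u) ≤ C * N.toFun u := by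
  obtain ⟨m, hm⟩ := hm φ
  refine ⟨‖m‖₊, fun u hu => ?_⟩
  obtain ⟨w, rfl⟩ : ∃ w : N.Space, N.incl w = u := ⟨⟨u, hu⟩, rfl⟩
  have h1 := m.le_opENorm w
  rw [N.enorm_eq, N.enorm_eq, hm] at h1
  exact h1

/-- Multiplication by a test function, on the closure of the test functions. -/
theorem HasMul.exists_closure (hm : HasMul N) (φ : 𝓓(Ω, ℝ)) :
    ∃ m : TestClosure N →L[ℝ] TestClosure N, ∀ w, (m w).toDist = mulDist φ w.toDist := by
  obtain ⟨m, hm⟩ := hm φ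
  have hmem : ∀ w : TestClosure N, m w.toSpace ∈ (testFunctions N).topologicalClosure := by
    intro w
    refine map_mem_closure m.continuous w.2 ?_
    rintro x ⟨η, hη⟩
    refine ⟨mulTest φ η, ?_⟩
    rw [hm, hη.eq_testDist, mulDist_testDist]
    exact isRepr_testDist _
  have hc : Continuous (TestClosure.toSpace : TestClosure N → N.Space) := continuous_subtype_val
  exact ⟨⟨LinearMap.codRestrict (testFunctions N).topologicalClosure
    (m.toLinearMap ∘ₗ TestClosure.toSpace) hmem, (m.continuous.comp hc).subtype_mk _⟩,
    fun w => hm _⟩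

/-- For a test function `φ`, `⟨v, ψ φ⟩ = ⟨ψ v, φ⟩ = ⟨v, φ⟩`, since `ψ v = v`. As multiplication by
`ψ` is bounded, density extends this to all `g`. -/
theorem IsDualPair.pair_eq_of_mulDist (h : IsDualPair N M) (hm : HasMul N) {ψ : 𝓓(Ω, ℝ)}
    {v : TestClosure M} (hψ : IsCutoff ψ v.toDist) {g g' : TestClosure N}
    (hg : g'.toDist = mulDist ψ g.toDist) : h.pair v g' = h.pair v g := by
  obtain ⟨m, hm⟩ := hm.exists_closure ψ
  have hg' : g' = m g := TestClosure.toDist_injective (hg.trans (hm g).symm)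
  rw [hg']
  refine congrFun (h.finite_left.denseRange_map.equalizer ((h.pair v).continuous.comp m.continuous)
    (h.pair v).continuous (funext fun φ => ?_)) g
  have : m (h.finite_left.map φ) = h.finite_left.map (mulTest ψ φ) :=
    TestClosure.toDist_injective ((hm _).trans (mulDist_testDist ψ φ))
  simp only [Function.comp_apply]
  rw [this, h.pair_map, h.pair_map, ← mulDist_apply, hψ.mulDist_eq]

theorem mulDist_comm (φ ψ : 𝓓(Ω, ℝ)) (u : 𝓓'(Ω, ℝ)) :
    mulDist φ (mulDist ψ u) = mulDist ψ (mulDist φ u) := by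
  ext η
  simp only [mulDist_apply]
  congr 1
  ext x
  simp only [mulTest_apply]
  ring

end SobolevDuality

/-! ### The isomorphism `R`, given a dual pair. -/

namespace SobolevDuality

variable {n : ℕ} {Ω : Opens (EuclideanSpace ℝ (Fin n))} {s p p' : ℝ} [Fact (1 < p)]
  [Fact (1 < p')]

theorem IsDualPair.dualPairing_eq
    (h : IsDualPair (sobolevNorm Ω s p) (sobolevNorm Ω (-s) p')) (v : SobolevZero Ω (-s) p')
    (g : SobolevZero Ω s p) : dualPairing v g = h.pair v g := by
  have hF : ∃ F : StrongDual ℝ (SobolevZero Ω s p), RestrictsTo F v.toDist :=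
    ⟨_, h.restrictsTo_pair v⟩
  rw [dualPairing, dif_pos hF, hF.choose_spec.unique h.finite_left (h.restrictsTo_pair v)]

theorem exists_isCutoff (u : SobolevComp Ω s p) :
    ∃ ψ : 𝓓(Ω, ℝ), IsCutoff ψ (SobolevComp.toDist u) := by
  obtain ⟨u, K, hK, hu⟩ := u
  obtain ⟨χ, hχ, -⟩ := K.isCompact.exists_testFunction_eq_one hK
  exact ⟨χ, hχ.filter_mono (nhdsSet_mono hu)⟩

/-! ### Maps between the spaces -/

instance : IsTopologicalAddGroup (SobolevLoc Ω s p) :=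
  (SobolevLoc.withSeminorms Ω s p).topologicalAddGroup

/-- The map `f ↦ ψ f` from `W^{s,p}_loc(Ω)` to `W_0^{s,p}(Ω)`. -/
theorem IsDualPair.exists_locMul {M : ExtSeminorm 𝓓'(Ω, ℝ)}
    (h : IsDualPair (sobolevNorm Ω s p) M) (ψ : 𝓓(Ω, ℝ)) :
    ∃ T : SobolevLoc Ω s p →L[ℝ] SobolevZero Ω s p, ∀ f, (T f).toSpace = SobolevLoc.mul ψ f := by
  let T : SobolevLoc Ω s p →ₗ[ℝ] SobolevZero Ω s p :=
    LinearMap.codRestrict (testFunctions _).topologicalClosure (SobolevLoc.mul ψ) fun f =>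
      h.closure_left _ ⟨tsupport ψ, ψ.hasCompactSupport⟩ ψ.tsupport_subset
        (dsupport_mulDist_subset ψ f.toDist)
  have hc : Continuous T := by
    refine continuous_of_continuousAt_zero T ?_
    rw [ContinuousAt, map_zero, tendsto_zero_iff_norm_tendsto_zero]
    have := ((SobolevLoc.withSeminorms Ω s p).continuous_seminorm ψ).tendsto 0
    rw [map_zero] at this
    exact this
  exact ⟨⟨T, hc⟩, fun f => rfl⟩

/-- The inclusion of `W^{s,p}_comp(Ω)` into `W_0^{s,p}(Ω)`. -/
theorem IsDualPair.exists_compIncl {N : ExtSeminorm 𝓓'(Ω, ℝ)}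
    (h : IsDualPair N (sobolevNorm Ω s p)) :
    ∃ T : SobolevComp Ω s p →ₗ[ℝ] SobolevZero Ω s p, ∀ u, (T u).toSpace = u.toSobolev :=
  ⟨LinearMap.codRestrict (testFunctions _).topologicalClosure SobolevComp.toSobolev fun u =>
    u.2.elim fun K hK => h.closure_right _ K hK.1 hK.2, fun _ => rfl⟩

theorem HasMul.mem_locSubmodule (hm : HasMul (sobolevNorm Ω s p)) {u : 𝓓'(Ω, ℝ)}
    (hu : (sobolevNorm Ω s p).toFun u < ∞) : u ∈ locSubmodule Ω s p :=
  (Submodule.mem_iInf _).2 fun φ => by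
    obtain ⟨C, hC⟩ := hm.exists_le φ
    exact (hC u hu).trans_lt (ENNReal.mul_lt_top ENNReal.coe_lt_top hu)

/-- The inclusion of `W_0^{s,p}(Ω)` into `W^{s,p}_loc(Ω)`. -/
theorem HasMul.exists_zeroToLoc (hm : HasMul (sobolevNorm Ω s p)) :
    ∃ T : SobolevZero Ω s p →L[ℝ] SobolevLoc Ω s p, ∀ g, (T g).toDist = g.toDist := by
  let T : SobolevZero Ω s p →ₗ[ℝ] SobolevLoc Ω s p :=
    LinearMap.codRestrict (locSubmodule Ω s p) TestClosure.toDist fun g =>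
      hm.mem_locSubmodule ((sobolevNorm Ω s p).toFun_incl_lt_top g.toSpace)
  have hc : Continuous T := by
    refine (SobolevLoc.withSeminorms Ω s p).continuous_normedSpace_dom _ T fun φ => ?_
    obtain ⟨C, hC⟩ := hm.exists_le φ
    refine ⟨C, fun g => ?_⟩
    have h1 := hC g.toDist ((sobolevNorm Ω s p).toFun_incl_lt_top g.toSpace)
    rw [← TestClosure.enorm_eq] at h1
    have h2 : ‖SobolevLoc.mul φ (T g)‖ₑ ≤ C * ‖g‖ₑ := (ExtSeminorm.enorm_eq _ _).trans_le h1
    exact_mod_cast ENNReal.toReal_mono (by finiteness) h2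
  exact ⟨⟨T, hc⟩, fun f => rfl⟩

/-! ### The duality -/

theorem IsCutoff.anti {ψ : 𝓓(Ω, ℝ)} {u v : 𝓓'(Ω, ℝ)} (h : IsCutoff ψ u)
    (hv : dsupport v ⊆ dsupport u) : IsCutoff ψ v :=
  h.filter_mono (nhdsSet_mono hv)

theorem exists_isCutoff_isCutoff (u v : SobolevComp Ω s p) :
    ∃ ψ : 𝓓(Ω, ℝ), IsCutoff ψ (SobolevComp.toDist u) ∧ IsCutoff ψ (SobolevComp.toDist v) := by
  obtain ⟨u, K, hK, hu⟩ := u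
  obtain ⟨v, L, hL, hv⟩ := v
  obtain ⟨χ, hχ, -⟩ := (K ⊔ L).isCompact.exists_testFunction_eq_one (U := Ω) (by
    rw [Compacts.coe_sup]
    exact union_subset hK hL)
  rw [Compacts.coe_sup] at hχ
  exact ⟨χ, hχ.filter_mono (nhdsSet_mono (hu.trans subset_union_left)),
    hχ.filter_mono (nhdsSet_mono (hv.trans subset_union_right))⟩

/-- Both values are equal to the pairing of `v` with `ψ₁ ψ₂ f`. -/
theorem IsDualPair.pair_eq_of_isCutoff {N M : ExtSeminorm 𝓓'(Ω, ℝ)} (h : IsDualPair N M)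
    (hm : HasMul N) {v : TestClosure M} {ψ₁ ψ₂ : 𝓓(Ω, ℝ)} (h₁ : IsCutoff ψ₁ v.toDist)
    (h₂ : IsCutoff ψ₂ v.toDist) {f : 𝓓'(Ω, ℝ)} {g₁ g₂ : TestClosure N}
    (hg₁ : g₁.toDist = mulDist ψ₁ f) (hg₂ : g₂.toDist = mulDist ψ₂ f) :
    h.pair v g₁ = h.pair v g₂ := by
  obtain ⟨m, hm'⟩ := hm.exists_closure ψ₂
  rw [← h.pair_eq_of_mulDist hm h₂ (hm' g₁)]
  refine h.pair_eq_of_mulDist hm h₁ ?_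
  rw [hm', hg₁, hg₂, mulDist_comm]

/-- The duality argument proper. About the norms it uses only the axioms of a dual pair and the
boundedness of multiplication on `W^{s,p}`. -/
theorem exists_bijective_of_isDualPair
    (h : IsDualPair (sobolevNorm Ω s p) (sobolevNorm Ω (-s) p'))
    (hm : HasMul (sobolevNorm Ω s p)) :
    ∃ R : SobolevComp Ω (-s) p' →ₗ[ℝ] StrongDual ℝ (SobolevLoc Ω s p),
      (∀ (u : SobolevComp Ω (-s) p') (f : SobolevLoc Ω s p) (ψ : 𝓓(Ω, ℝ)),
        IsCutoff ψ (SobolevComp.toDist u) →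
          ∃ (v : SobolevZero Ω (-s) p') (g : SobolevZero Ω s p),
            v.toSpace = SobolevComp.toSobolev u ∧ g.toSpace = SobolevLoc.mul ψ f ∧
            (∃ F : StrongDual ℝ (SobolevZero Ω s p), RestrictsTo F v.toDist) ∧
            R u f = dualPairing v g) ∧
      Function.Bijective R ∧ Continuous R := by
  choose L hL using fun ψ => h.exists_locMul ψ
  have hL' : ∀ ψ f, (L ψ f).toDist = mulDist ψ f.toDist := fun ψ f =>
    congrArg (sobolevNorm Ω s p).incl (hL ψ f)
  obtain ⟨ι, hι⟩ := h.exists_compIncl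
  have hι' : ∀ u, (ι u).toDist = SobolevComp.toDist u := fun u =>
    congrArg (sobolevNorm Ω (-s) p').incl (hι u)
  obtain ⟨Z, hZ⟩ := hm.exists_zeroToLoc
  choose c hc using fun u : SobolevComp Ω (-s) p' => exists_isCutoff u
  -- The functional is defined with one chosen cutoff per `u`. Freedom to change the cutoff is
  -- needed already for additivity, where `u`, `v` and `u + v` have to share one.
  have key : ∀ u ψ f, IsCutoff ψ (SobolevComp.toDist u) →
      h.pair (ι u) (L (c u) f) = h.pair (ι u) (L ψ f) := fun u ψ f hψ =>
    h.pair_eq_of_isCutoff hm (by rw [hι']; exact hc u) (by rw [hι']; exact hψ) (hL' _ _) (hL' _ _)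
  let R : SobolevComp Ω (-s) p' →ₗ[ℝ] StrongDual ℝ (SobolevLoc Ω s p) :=
    { toFun := fun u => (h.pair (ι u)).comp (L (c u))
      map_add' := fun u v => by
        ext f
        obtain ⟨ψ, hu, hv⟩ := exists_isCutoff_isCutoff u v
        have huv : IsCutoff ψ (SobolevComp.toDist (u + v)) := by
          rw [map_add]
          refine Eventually.filter_mono (nhdsSet_mono (dsupport_add_subset _ _)) ?_
          rw [nhdsSet_union]
          exact eventually_sup.2 ⟨hu, hv⟩
        change h.pair (ι (u + v)) (L _ f) = h.pair (ι u) (L _ f) + h.pair (ι v) (L _ f)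
        rw [key _ ψ f huv, key _ ψ f hu, key _ ψ f hv, map_add, map_add]
        rfl
      map_smul' := fun a u => by
        ext f
        have hau : IsCutoff (c u) (SobolevComp.toDist (a • u)) := by
          rw [map_smul]
          exact (hc u).anti (dsupport_smul_subset _ _)
        change h.pair (ι (a • u)) (L _ f) = a • h.pair (ι u) (L _ f)
        rw [key _ _ f hau, map_smul, map_smul]
        rfl }
  have hR : ∀ u ψ f, IsCutoff ψ (SobolevComp.toDist u) → R u f = h.pair (ι u) (L ψ f) := key
  refine ⟨R, fun u f ψ hψ => ⟨ι u, L ψ f, hι u, hL ψ f, ⟨_, h.restrictsTo_pair _⟩, ?_⟩, ⟨?_, ?_⟩,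
    ?_⟩
  · rw [h.dualPairing_eq, hR u ψ f hψ]
  · rw [← LinearMap.ker_eq_bot, LinearMap.ker_eq_bot']
    intro u hu
    -- A test function `η` is an element of `W_loc`, and `R u` takes the value `u η` there.
    have h0 : SobolevComp.toDist u = 0 := by
      ext η
      rw [← hι', ← h.pair_map, ← h.pair_eq_of_mulDist hm (ψ := c u) (by rw [hι']; exact hc u)
        (g' := L (c u) (Z (h.finite_left.map η))) (by rw [hL', hZ]), ← hR u _ _ (hc u), hu]
      rfl
    exact Subtype.val_injective (Subtype.val_injective h0)
  · intro Λ
    obtain ⟨S, C, -, hS⟩ := Seminorm.bound_of_continuous (SobolevLoc.withSeminorms Ω s p)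
      ((normSeminorm ℝ ℝ).comp Λ.toLinearMap) (continuous_norm.comp Λ.continuous)
    -- `Λ` is bounded by the finitely many seminorms in `S`, so it kills every `f` with `φ f = 0`
    -- for all `φ ∈ S`. This controls the support of the distribution to be constructed and allows
    -- `f` to be replaced by `ψ f` at the end.
    have hΛ : ∀ f, (∀ φ ∈ S, mulDist φ f.toDist = 0) → Λ f = 0 := by
      intro f hf
      have h1 : S.sup (SobolevLoc.seminormFamily Ω s p) f ≤ 0 := by
        refine Seminorm.finset_sup_apply_le le_rfl fun φ hφ => ?_
        have : SobolevLoc.mul φ f = 0 := Subtype.val_injective (hf φ hφ)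
        change ‖SobolevLoc.mul φ f‖ ≤ 0
        rw [this, norm_zero]
      have h2 : ‖Λ f‖ ≤ C * S.sup (SobolevLoc.seminormFamily Ω s p) f := hS f
      exact norm_le_zero_iff.1 (h2.trans (mul_nonpos_of_nonneg_of_nonpos C.2 h1))
    let G : StrongDual ℝ (SobolevZero Ω s p) := Λ.comp Z
    have hG : ∀ η, ‖G (h.finite_left.map η)‖ₑ ≤ ‖G‖₊ * (sobolevNorm Ω s p).toFun (testDist η) := by
      intro η
      rw [← h.finite_left.enorm_map]
      exact G.le_opENorm _
    -- The preimage of `Λ` is its restriction to the test functions. It is a distribution by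
    -- `bounded_left` and has finite norm by `right_finite`.
    obtain ⟨v, hv⟩ := h.bounded_left.exists_dist (G.toLinearMap ∘ₗ h.finite_left.map) ‖G‖₊ hG
    have hvM := h.right_finite v ‖G‖₊ fun φ => by rw [hv]; exact hG φ
    let K : Compacts (EuclideanSpace ℝ (Fin n)) :=
      ⟨⋃ φ ∈ S, tsupport φ, S.isCompact_biUnion fun φ _ => φ.hasCompactSupport⟩
    have hK : (K : Set (EuclideanSpace ℝ (Fin n))) ⊆ Ω := iUnion₂_subset fun φ _ =>
      φ.tsupport_subset
    have hmul : ∀ φ ∈ S, ∀ η : 𝓓(Ω, ℝ), (∀ x ∈ K, η x = 0) → mulTest φ η = 0 := by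
      intro φ hφ η hη
      ext x
      rw [mulTest_apply]
      by_cases hx : x ∈ tsupport φ
      · rw [hη x (mem_iUnion₂.2 ⟨φ, hφ, hx⟩), zero_mul]
        rfl
      · rw [image_eq_zero_of_notMem_tsupport hx, mul_zero]
        rfl
    have hvK : dsupport v ⊆ K := by
      refine fun x hx => by_contra fun hxK => (notMem_dsupport_iff x).2 ⟨(K : Set _)ᶜ, fun η hη =>
        ?_,
        K.isCompact.isClosed.isOpen_compl, hxK⟩ hx
      refine (hv η).trans (hΛ (Z (h.finite_left.map η)) fun φ hφ => ?_)
      rw [hZ, h.finite_left.toDist_map, mulDist_testDist, hmul φ hφ η fun x hx =>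
        image_eq_zero_of_notMem_tsupport fun hxη => hη hxη hx, map_zero]
    let u : SobolevComp Ω (-s) p' := ⟨⟨v, hvM⟩, K, hK, hvK⟩
    have hu : (ι u).toDist = v := hι' u
    refine ⟨u, ?_⟩
    ext f
    obtain ⟨ψ, hψ, -⟩ := K.isCompact.exists_testFunction_eq_one hK
    have hpG : h.pair (ι u) = G := by
      refine (h.restrictsTo_pair (ι u)).unique h.finite_left ?_
      rw [hu, restrictsTo_iff h.finite_left]
      exact fun φ => (hv φ).symm
    rw [hR u ψ f (hψ.filter_mono (nhdsSet_mono hvK)), hpG]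
    change Λ (Z (L ψ f)) = Λ f
    rw [← sub_eq_zero, ← map_sub]
    -- Since `ψ = 1` on `K`, which contains the supports of the `φ ∈ S`, all the products `φ (ψ f -
    -- f)` vanish.
    refine hΛ _ fun φ hφ => ?_
    rw [map_sub, hZ, hL', map_sub, sub_eq_zero]
    ext η
    simp only [mulDist_apply]
    rw [← sub_eq_zero, ← map_sub]
    convert map_zero f.toDist
    have : mulTest φ (mulTest ψ η - η) = 0 := hmul φ hφ _ fun x hx => by
      have : ψ x = 1 := (eventually_nhdsSet_iff_forall.1 hψ x hx).self_of_nhds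
      change η x * ψ x - η x = 0
      rw [this, mul_one, sub_self]
    rw [← this]
    ext x
    change η x * φ x * ψ x - η x * φ x = (η x * ψ x - η x) * φ x
    ring
  -- Universal property of the inductive limit: the topology induced by `R` is one of those whose
  -- infimum defines the topology of `W_comp`, provided that `R` is continuous on each `W_K`.
  · rw [continuous_iff_le_induced]
    refine sInf_le ⟨topologicalAddGroup_induced R, continuousSMul_induced R, ?_, fun K hK => ?_⟩
    · exact LocallyConvexSpace.induced (F := StrongDual ℝ (SobolevLoc Ω s p)) R
    rw [continuous_induced_rng]
    obtain ⟨ψ, hψ, -⟩ := K.isCompact.exists_testFunction_eq_one hK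
    let J : SobolevOn Ω (-s) p' K →ₗ[ℝ] SobolevZero Ω (-s) p' :=
      LinearMap.codRestrict (testFunctions _).topologicalClosure (SobolevOn Ω (-s) p' K).subtype
        fun u => h.closure_right _ K hK u.2
    have hJ : Continuous J := continuous_subtype_val.subtype_mk _
    -- A cutoff for `K` serves every `u` with support in `K`. On `W_K`, therefore, `R` is the
    -- inclusion into `W_0`, followed by the pairing and by the transpose of `f ↦ ψ f`, which is
    -- continuous for the strong topologies.
    have : R ∘ SobolevOn.toComp Ω (-s) p' K hK =
        (ContinuousLinearMap.precomp ℝ (L ψ)) ∘ h.pair ∘ J := by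
      funext u
      ext f
      have hu : ι (SobolevOn.toComp Ω (-s) p' K hK u) = J u := TestClosure.toSpace_injective (hι _)
      have hcut : IsCutoff ψ (SobolevComp.toDist (SobolevOn.toComp Ω (-s) p' K hK u)) :=
        hψ.filter_mono (nhdsSet_mono u.2)
      rw [Function.comp_apply, hR _ ψ f hcut, hu]
      rfl
    rw [this]
    exact (ContinuousLinearMap.precomp ℝ (L ψ)).continuous.comp (h.pair.continuous.comp hJ)

end SobolevDuality

namespace SobolevDuality

/-! ### Sums of extended seminorms -/

theorem ExtSeminorm.ext {V : Type*} [AddCommGroup V] [Module ℝ V] {N M : ExtSeminorm V}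
    (h : ∀ u, N.toFun u = M.toFun u) : N = M := by
  cases N
  cases M
  congr
  exact funext h

theorem ExtSeminorm.add_toFun {V : Type*} [AddCommGroup V] [Module ℝ V] (N M : ExtSeminorm V)
    (u : V) : (N + M).toFun u = N.toFun u + M.toFun u := rfl

theorem ExtSeminorm.sum_toFun {V ι : Type*} [AddCommGroup V] [Module ℝ V] (s : Finset ι)
    (M : ι → ExtSeminorm V) (u : V) : (sum s M).toFun u = ∑ i ∈ s, (M i).toFun u := rfl

theorem ExtSeminorm.comp_toFun {V W : Type*} [AddCommGroup V] [Module ℝ V] [AddCommGroup W]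
    [Module ℝ W] (N : ExtSeminorm V) (T : W →ₗ[ℝ] V) (u : W) :
    (N.comp T).toFun u = N.toFun (T u) := rfl

theorem ExtSeminorm.sum_induction {V ι : Type*} [AddCommGroup V] [Module ℝ V]
    (P : ExtSeminorm V → Prop) (h0 : ∀ N : ExtSeminorm V, (∀ u, N.toFun u = 0) → P N)
    (hadd : ∀ N M, P N → P M → P (N + M)) (s : Finset ι) (M : ι → ExtSeminorm V)
    (h : ∀ i ∈ s, P (M i)) : P (sum s M) := by
  classical
  induction s using Finset.induction_on with
  | empty => exact h0 _ fun u => by rw [sum_toFun, Finset.sum_empty]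
  | insert a s ha ih =>
    have : sum (insert a s) M = M a + sum s M := ExtSeminorm.ext fun u => Finset.sum_insert ha
    rw [this]
    exact hadd _ _ (h a (Finset.mem_insert_self a s))
      (ih fun i hi => h i (Finset.mem_insert_of_mem hi))

variable {n : ℕ} {Ω : Opens (EuclideanSpace ℝ (Fin n))} {N M N' : ExtSeminorm 𝓓'(Ω, ℝ)}

theorem BoundedOnTest.add (hN : BoundedOnTest N) (hM : BoundedOnTest M) :
    BoundedOnTest (N + M) := fun K hK => by
  obtain ⟨q, hq, hqN⟩ := hN K hK
  obtain ⟨r, hr, hrM⟩ := hM K hK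
  refine ⟨q + r, hq.add hr, fun φ => ?_⟩
  rw [add_apply, ENNReal.ofReal_add (apply_nonneg _ _) (apply_nonneg _ _)]
  exact add_le_add (hqN φ) (hrM φ)

theorem BoundedOnTest.of_eq_zero (hN : ∀ u, N.toFun u = 0) : BoundedOnTest N := fun K hK =>
  ⟨0, continuous_const, fun φ => by simp [hN]⟩

/-- The functionals on the test functions which are bounded by the norm can be approximated by
test functions. -/
def Approximable (N : ExtSeminorm 𝓓'(Ω, ℝ)) : Prop :=
  ∀ (F : 𝓓(Ω, ℝ) →ₗ[ℝ] ℝ) (C : ℝ≥0), (∀ φ, ‖F φ‖ₑ ≤ C * N.toFun (testDist φ)) →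
    ∀ ε : ℝ≥0∞, 0 < ε → ∃ ψ : 𝓓(Ω, ℝ), ∀ φ, ‖F φ - testDist ψ φ‖ₑ ≤ ε * N.toFun (testDist φ)

theorem Approximable.of_eq_zero (hN : ∀ u, N.toFun u = 0) : Approximable N := by
  intro F C hF ε hε
  refine ⟨0, fun φ => ?_⟩
  have := hF φ
  rw [hN, mul_zero, nonpos_iff_eq_zero, enorm_eq_zero] at this
  rw [this, map_zero, dist_zero_apply, sub_zero, enorm_zero]
  exact zero_le

/-- A functional bounded by `N + M` factors through the diagonal map into the product of the two
spaces. Hahn-Banach extends it to the product, and restriction to the factors splits it into a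
functional bounded by `N` and one bounded by `M`. -/
theorem Approximable.add (hN : FiniteOnTest N) (hM : FiniteOnTest M) (aN : Approximable N)
    (aM : Approximable M) : Approximable (N + M) := by
  intro F C hF ε hε
  let TN : 𝓓(Ω, ℝ) →ₗ[ℝ] N.Space := TestClosure.toSpace ∘ₗ hN.map
  let TM : 𝓓(Ω, ℝ) →ₗ[ℝ] M.Space := TestClosure.toSpace ∘ₗ hM.map
  have eN : ∀ φ, ‖TN φ‖ₑ = N.toFun (testDist φ) := fun φ => hN.enorm_map φ
  have eM : ∀ φ, ‖TM φ‖ₑ = M.toFun (testDist φ) := fun φ => hM.enorm_map φ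
  -- The product carries the maximum norm, which dominates the sum up to the factor `2`.
  obtain ⟨G, hG, -⟩ := LinearMap.exists_strongDual_comp_eq (TN.prod TM) F (C := 2 * C)
    (by positivity) (fun φ => by
      have h1 := hF φ
      rw [ExtSeminorm.add_toFun, ← eN, ← eM] at h1
      have h2 := ENNReal.toReal_mono (by finiteness) h1
      rw [ENNReal.toReal_mul, ENNReal.toReal_add (by finiteness) (by finiteness), toReal_enorm,
        toReal_enorm, toReal_enorm, ENNReal.coe_toReal] at h2
      refine h2.trans ?_
      have h3 : ‖TN φ‖ ≤ ‖(TN.prod TM) φ‖ := le_max_left _ _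
      have h4 : ‖TM φ‖ ≤ ‖(TN.prod TM) φ‖ := le_max_right _ _
      nlinarith [C.2])
  let GN : StrongDual ℝ N.Space := G.comp (ContinuousLinearMap.inl ℝ _ _)
  let GM : StrongDual ℝ M.Space := G.comp (ContinuousLinearMap.inr ℝ _ _)
  obtain ⟨ψ, hψ⟩ := aN (GN.toLinearMap ∘ₗ TN) ‖GN‖₊ (fun φ => by
    rw [← eN]; exact GN.le_opENorm _) ε hε
  obtain ⟨χ, hχ⟩ := aM (GM.toLinearMap ∘ₗ TM) ‖GM‖₊ (fun φ => by
    rw [← eM]; exact GM.le_opENorm _) ε hε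
  refine ⟨ψ + χ, fun φ => ?_⟩
  have hFφ : F φ = GN (TN φ) + GM (TM φ) := by
    rw [← hG φ]
    change G (TN φ, TM φ) = G (TN φ, 0) + G (0, TM φ)
    rw [← map_add, Prod.mk_add_mk, add_zero, zero_add]
  rw [map_add, dist_add_apply, hFφ, add_sub_add_comm, ExtSeminorm.add_toFun, mul_add]
  exact (enorm_add_le _ _).trans (add_le_add (hψ φ) (hχ φ))

/-! ### Norms given by an `L^p` norm of a linear map -/

/-- On the test functions, `N` is the `L^p(U)` norm of the image under a linear map `T`, whose
transpose maps test functions on `U` to test functions. -/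
structure IsLpPiece {E : Type*} [NormedAddCommGroup E] [NormedSpace ℝ E] [MeasurableSpace E]
    (N : ExtSeminorm 𝓓'(Ω, ℝ)) (p : ℝ) (μ : Measure E) (U : Opens E)
    (T : 𝓓(Ω, ℝ) →ₗ[ℝ] E → ℝ) (A : 𝓓(U, ℝ) →ₗ[ℝ] 𝓓(Ω, ℝ)) : Prop where
  memLp : ∀ φ, MemLp (T φ) (ENNReal.ofReal p) (μ.restrict U)
  eq : ∀ φ, N.toFun (testDist φ) = eLpNorm (T φ) (ENNReal.ofReal p) (μ.restrict U)
  adj : ∀ g φ, testDist (A g) φ = ∫ x in U, g x * T φ x ∂μ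

namespace IsLpPiece

variable {E : Type*} [NormedAddCommGroup E] [NormedSpace ℝ E] [FiniteDimensional ℝ E]
  [MeasurableSpace E] [BorelSpace E] {p q : ℝ} {μ : Measure E} [IsLocallyFiniteMeasure μ]
  {U : Opens E} {T : 𝓓(Ω, ℝ) →ₗ[ℝ] E → ℝ} {A : 𝓓(U, ℝ) →ₗ[ℝ] 𝓓(Ω, ℝ)}

theorem memLp_testFunction (g : 𝓓(U, ℝ)) (r : ℝ≥0∞) : MemLp g r (μ.restrict U) :=
  (g.continuous.memLp_of_hasCompactSupport g.hasCompactSupport).restrict _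

/-- By Hölder's inequality, the dual norm of `A g` is at most the `L^q` norm of `g`. -/
theorem enorm_testDist_le (h : IsLpPiece N p μ U T A) (hpq : p.HolderConjugate q) (g : 𝓓(U, ℝ))
    (φ : 𝓓(Ω, ℝ)) : ‖testDist (A g) φ‖ₑ ≤
      eLpNorm g (ENNReal.ofReal q) (μ.restrict U) * N.toFun (testDist φ) := by
  rw [h.adj, h.eq]
  exact enorm_integral_mul_le hpq.symm (memLp_testFunction (μ := μ) g 1).1 (h.memLp φ).1

/-- By Riesz, `F φ = ∫ G Tφ` with `G ∈ L^q`. Replacing `G` by a nearby test function `g` gives the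
functional of the test function `A g`, and Hölder's inequality controls the error. -/
theorem approximable (h : IsLpPiece N p μ U T A) (hpq : p.HolderConjugate q) :
    Approximable N := by
  intro F C hF ε hε
  obtain ⟨G, hG, hFG⟩ := exists_memLp_forall_eq_integral hpq T h.memLp F C fun φ => by
    rw [← h.eq]; exact hF φ
  obtain ⟨g, hg⟩ := hG.exists_testFunction_eLpNorm_sub_le (by simpa using hpq.symm.lt.le)
    ENNReal.ofReal_ne_top hε
  refine ⟨A g, fun φ => ?_⟩
  rw [hFG, h.adj, ← integral_sub (integrable_mul_of_memLp hpq.symm hG (h.memLp φ))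
    (integrable_mul_of_memLp hpq.symm (memLp_testFunction g _) (h.memLp φ))]
  simp only [← sub_mul]
  refine (enorm_integral_mul_le hpq.symm (hG.1.sub (memLp_testFunction (μ := μ) g 1).1)
    (h.memLp φ).1).trans ?_
  rw [h.eq]
  exact mul_le_mul_left hg _

/-- A substitute for reflexivity. The dual norm of `A g` is at most `‖g‖_q`, so `g ↦ v (A g)` is
bounded on `L^q` and is represented by a function in `L^p`, the weak form of `T v`. In applications
`N'` is the full Sobolev norm and `N` one of its terms. -/
theorem exists_memLp (h : IsLpPiece N p μ U T A) (hpq : p.HolderConjugate q)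
    (hN' : FiniteOnTest N') (hle : ∀ u, N.toFun u ≤ N'.toFun u) {v : 𝓓'(Ω, ℝ)} {C : ℝ≥0}
    (hv : ∀ φ, ‖v φ‖ₑ ≤ C * (dualNorm N').toFun (testDist φ)) :
    ∃ G : E → ℝ, MemLp G (ENNReal.ofReal p) (μ.restrict U) ∧
      ∀ g, v (A g) = ∫ x in U, G x * g x ∂μ := by
  let J : 𝓓(U, ℝ) →ₗ[ℝ] E → ℝ :=
    { toFun := fun g => g
      map_add' := fun _ _ => rfl
      map_smul' := fun _ _ => rfl }
  refine exists_memLp_forall_eq_integral hpq.symm J (fun g => memLp_testFunction g _)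
    (v.toLinearMap ∘ₗ A) C fun g => (hv (A g)).trans ?_
  refine mul_le_mul_right ?_ _
  have hfin := (memLp_testFunction (μ := μ) g (ENNReal.ofReal q)).2
  obtain ⟨F, hF, hFle⟩ := exists_restrictsTo hN' (u := testDist (A g))
    (C := (eLpNorm g (ENNReal.ofReal q) (μ.restrict U)).toNNReal) fun φ => by
      rw [ENNReal.coe_toNNReal hfin.ne]
      exact (h.enorm_testDist_le hpq g φ).trans (mul_le_mul_right (hle _) _)
  refine (iInf₂_le F hF).trans ?_
  rw [← ofReal_norm]
  refine (ENNReal.ofReal_le_ofReal hFle).trans ?_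
  rw [ENNReal.ofReal_coe_nnreal, ENNReal.coe_toNNReal hfin.ne]
  rfl

end IsLpPiece

end SobolevDuality

/-! ### Differential operators and their transposes. -/

namespace SobolevDuality

variable {n : ℕ} {Ω : Opens (EuclideanSpace ℝ (Fin n))}

theorem setIntegral_mul_testFunction (f : EuclideanSpace ℝ (Fin n) → ℝ) (φ : 𝓓(Ω, ℝ)) :
    ∫ x in Ω, f x * φ x = ∫ x, f x * φ x :=
  setIntegral_eq_integral_of_forall_compl_eq_zero fun x hx => by
    rw [image_eq_zero_of_notMem_tsupport fun h => hx (φ.tsupport_subset h), mul_zero]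

/-- The linear map `D` of distributions is a differential operator: `P` is its transpose, `A` its
restriction to the test functions, and `P` is given by the local and translation invariant
operator `a` on functions. -/
structure IsDiffOp (D : 𝓓'(Ω, ℝ) →ₗ[ℝ] 𝓓'(Ω, ℝ)) (P A : 𝓓(Ω, ℝ) →L[ℝ] 𝓓(Ω, ℝ))
    (a : (EuclideanSpace ℝ (Fin n) → ℝ) → EuclideanSpace ℝ (Fin n) → ℝ) : Prop where
  apply : ∀ u φ, D u φ = u (P φ)
  testDist : ∀ φ, D (testDist φ) = testDist (A φ)
  coe : ∀ φ, ⇑(P φ) = a φ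
  congr : ∀ f g x, f =ᶠ[𝓝 x] g → a f =ᶠ[𝓝 x] a g
  translate : ∀ f z, (a fun x => f (x + z)) = fun x => a f (x + z)
  restrict : ∀ (K : Compacts (EuclideanSpace ℝ (Fin n)))
    (hK : (K : Set (EuclideanSpace ℝ (Fin n))) ⊆ Ω),
    ∃ B : 𝓓_{K}(EuclideanSpace ℝ (Fin n), ℝ) →L[ℝ] 𝓓_{K}(EuclideanSpace ℝ (Fin n), ℝ),
      ∀ φ, A (TestFunction.ofSupportedIn hK φ) = TestFunction.ofSupportedIn hK (B φ)

namespace IsDiffOp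

variable {D D' : 𝓓'(Ω, ℝ) →ₗ[ℝ] 𝓓'(Ω, ℝ)} {P A P' A' : 𝓓(Ω, ℝ) →L[ℝ] 𝓓(Ω, ℝ)}
  {a a' : (EuclideanSpace ℝ (Fin n) → ℝ) → EuclideanSpace ℝ (Fin n) → ℝ}

theorem one : IsDiffOp (1 : Module.End ℝ 𝓓'(Ω, ℝ)) (.id ℝ _) (.id ℝ _) id where
  apply _ _ := rfl
  testDist _ := rfl
  coe _ := rfl
  congr _ _ _ h := h
  translate _ _ := rfl
  restrict _ _ := ⟨.id ℝ _, fun _ => rfl⟩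

theorem mul (h : IsDiffOp D P A a) (h' : IsDiffOp D' P' A' a') :
    IsDiffOp ((D * D' : Module.End ℝ 𝓓'(Ω, ℝ))) (P'.comp P) (A.comp A') (a' ∘ a) where
  apply u φ := (h.apply (D' u) φ).trans (h'.apply u _)
  testDist φ := by
    rw [Module.End.mul_apply, h'.testDist, h.testDist]
    rfl
  coe φ := by
    change ⇑(P' (P φ)) = _
    rw [h'.coe, h.coe]
    rfl
  congr f g x hfg := h'.congr _ _ x (h.congr f g x hfg)
  translate f z := by
    rw [Function.comp_apply, h.translate, h'.translate]
    rfl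
  restrict K hK := by
    obtain ⟨B, hB⟩ := h.restrict K hK
    obtain ⟨B', hB'⟩ := h'.restrict K hK
    refine ⟨B.comp B', fun φ => ?_⟩
    change A (A' _) = _
    rw [hB', hB]
    rfl

/-- Integration by parts: the transpose `P` carries the minus sign, while `A`, the action on test
functions, does not. -/
theorem lineDeriv (v : EuclideanSpace ℝ (Fin n)) :
    IsDiffOp (Distribution.lineDerivCLM v : 𝓓'(Ω, ℝ) →L[ℝ] 𝓓'(Ω, ℝ)).toLinearMap
      (-TestFunction.lineDerivCLM ℝ v) (TestFunction.lineDerivCLM ℝ v)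
      (fun f x => -fderiv ℝ f x v) where
  apply u φ := (map_neg u _).symm
  testDist φ := by
    have hd : ∀ ψ : 𝓓(Ω, ℝ), ⇑(TestFunction.lineDerivCLM ℝ v ψ : 𝓓(Ω, ℝ)) =
        fun x => fderiv ℝ ψ x v := fun ψ => by
      ext x
      rw [TestFunction.lineDerivCLM_eq_fderivCLM, TestFunction.fderivCLM_apply_of_le _ le_top]
    have hi : ∀ φ ψ : 𝓓(Ω, ℝ), Integrable fun x => φ x * ψ x := fun φ ψ =>
      (φ.continuous.mul ψ.continuous).integrable_of_hasCompactSupport φ.hasCompactSupport.mul_right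
    have hdiff : ∀ ψ : 𝓓(Ω, ℝ), Differentiable ℝ ψ := fun ψ => ψ.contDiff.differentiable (by simp)
    ext ψ
    change -(SobolevDuality.testDist φ (TestFunction.lineDerivCLM ℝ v ψ)) = _
    rw [testDist_apply, testDist_apply, setIntegral_mul_testFunction, setIntegral_mul_testFunction]
    have h1 := hi (TestFunction.lineDerivCLM ℝ v φ) ψ
    have h2 := hi φ (TestFunction.lineDerivCLM ℝ v ψ)
    rw [hd] at h1 h2
    rw [hd, hd, integral_mul_fderiv_eq_neg_fderiv_mul_of_integrable h1 h2 (hi φ ψ)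
      (fun x _ => hdiff φ x) (fun x _ => hdiff ψ x), neg_neg]
  coe φ := by
    ext x
    change -(TestFunction.lineDerivCLM ℝ v φ : 𝓓(Ω, ℝ)) x = _
    rw [TestFunction.lineDerivCLM_eq_fderivCLM, TestFunction.fderivCLM_apply_of_le _ le_top]
  congr f g x h := by
    filter_upwards [h.fderiv (𝕜 := ℝ)] with y hy
    rw [hy]
  translate f z := by
    ext x
    rw [fderiv_comp_add_right]
  restrict K hK := by
    refine ⟨(ContDiffMapSupportedIn.postcompCLM (ContinuousLinearMap.apply ℝ ℝ v)).comp
      (ContDiffMapSupportedIn.fderivCLM ℝ ⊤ ⊤), fun φ => ?_⟩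
    ext x
    rw [TestFunction.lineDerivCLM_eq_fderivCLM, TestFunction.fderivCLM_ofSupportedIn]
    rfl

theorem exists_pow (h : IsDiffOp D P A a) (k : ℕ) :
    ∃ P A a, IsDiffOp ((D : Module.End ℝ 𝓓'(Ω, ℝ)) ^ k) P A a := by
  induction k with
  | zero => exact ⟨_, _, _, by rw [pow_zero]; exact one⟩
  | succ k ih =>
    obtain ⟨P, A, a, ih⟩ := ih
    exact ⟨_, _, _, by rw [pow_succ]; exact ih.mul h⟩

theorem exists_partialDeriv (α : Fin n → ℕ) :
    ∃ P A a, IsDiffOp (partialDeriv α : 𝓓'(Ω, ℝ) →ₗ[ℝ] 𝓓'(Ω, ℝ)) P A a := by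
  rw [partialDeriv]
  induction List.finRange n with
  | nil => exact ⟨_, _, _, one⟩
  | cons i l ih =>
    obtain ⟨P, A, a, ih⟩ := ih
    obtain ⟨P', A', a', h⟩ := (lineDeriv (Ω := Ω) (EuclideanSpace.single i (1 : ℝ))).exists_pow
      (α i)
    exact ⟨_, _, _, by rw [List.map_cons, List.prod_cons]; exact h.mul ih⟩

theorem tsupport_subset (h : IsDiffOp D P A a) (φ : 𝓓(Ω, ℝ)) : tsupport (P φ) ⊆ tsupport φ := by
  refine fun x hx => by_contra fun hφ => notMem_tsupport_iff_eventuallyEq.2 ?_ hx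
  rw [notMem_tsupport_iff_eventuallyEq] at hφ
  have h0 : a 0 = 0 := by
    have := h.coe 0
    rw [map_zero] at this
    exact this.symm
  have := h.congr _ _ _ hφ
  rwa [h0, ← h.coe] at this

theorem dsupport_subset (h : IsDiffOp D P A a) (u : 𝓓'(Ω, ℝ)) : dsupport (D u) ⊆ dsupport u :=
  dsupport_subset_dsupport fun s _ hs φ hφ => by
    rw [h.apply]
    exact hs _ ((h.tsupport_subset φ).trans hφ)

theorem boundedOnTest (h : IsDiffOp D P A a) {N : ExtSeminorm 𝓓'(Ω, ℝ)} (hN : BoundedOnTest N) :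
    BoundedOnTest (N.comp D) := fun K hK => by
  obtain ⟨q, hq, hqN⟩ := hN K hK
  obtain ⟨B, hB⟩ := h.restrict K hK
  refine ⟨q.comp B.toLinearMap, hq.comp B.continuous, fun φ => ?_⟩
  rw [ExtSeminorm.comp_toFun, h.testDist, hB]
  exact hqN (B φ)

end IsDiffOp

end SobolevDuality

namespace SobolevDuality

variable {n : ℕ} {Ω : Opens (EuclideanSpace ℝ (Fin n))} {p q : ℝ}

/-! ### Norms of functions applied to distributions -/

theorem ofRepr_eq {Φ : (EuclideanSpace ℝ (Fin n) → ℝ) → ℝ≥0∞}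
    {hadd : ∀ f g, LocallyIntegrableOn f Ω → LocallyIntegrableOn g Ω → Φ (f + g) ≤ Φ f + Φ g}
    {hsmul : ∀ (c : ℝ) f, Φ (c • f) ≤ ‖c‖ₑ * Φ f}
    (hΦ : ∀ f g, f =ᵐ[volume.restrict Ω] g → Φ f = Φ g)
    {u : 𝓓'(Ω, ℝ)} {f : EuclideanSpace ℝ (Fin n) → ℝ} (hf : IsRepr u f) :
    (ofRepr Ω Φ hadd hsmul).toFun u = Φ f :=
  le_antisymm (iInf₂_le f hf) (le_iInf₂ fun _ hg => (hΦ _ _ (hf.ae_eq hg)).le)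

theorem exists_isRepr_of_ofRepr_lt_top {Φ : (EuclideanSpace ℝ (Fin n) → ℝ) → ℝ≥0∞}
    {hadd : ∀ f g, LocallyIntegrableOn f Ω → LocallyIntegrableOn g Ω → Φ (f + g) ≤ Φ f + Φ g}
    {hsmul : ∀ (c : ℝ) f, Φ (c • f) ≤ ‖c‖ₑ * Φ f} {u : 𝓓'(Ω, ℝ)}
    (hu : (ofRepr Ω Φ hadd hsmul).toFun u < ∞) : ∃ f, IsRepr u f := by
  by_contra! h
  refine hu.ne ?_
  exact iInf₂_eq_top.2 fun f hf => (h f hf).elim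

section lpNorm

variable [Fact (1 < p)]

theorem lpNorm_eq {u : 𝓓'(Ω, ℝ)} {f : EuclideanSpace ℝ (Fin n) → ℝ} (hf : IsRepr u f) :
    (lpNorm Ω p).toFun u = eLpNorm f (ENNReal.ofReal p) (volume.restrict Ω) :=
  ofRepr_eq (fun _ _ h => eLpNorm_congr_ae h) hf

theorem exists_isRepr_memLp {u : 𝓓'(Ω, ℝ)} (hu : (lpNorm Ω p).toFun u < ∞) :
    ∃ f, IsRepr u f ∧ MemLp f (ENNReal.ofReal p) (volume.restrict Ω) := by
  obtain ⟨f, hf⟩ := exists_isRepr_of_ofRepr_lt_top hu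
  exact ⟨f, hf, hf.1.aestronglyMeasurable, by rwa [← lpNorm_eq hf]⟩

/-- For `φ` supported in `K`, the `L^p` norm is at most `sup |φ|` times the `L^p` norm of `1_K`. -/
theorem boundedOnTest_lpNorm : BoundedOnTest (lpNorm Ω p) := fun K hK => by
  have hp : ENNReal.ofReal p ≠ 0 := by simpa using zero_lt_one.trans (Fact.out : 1 < p)
  let S := (ContDiffMapSupportedIn.toBoundedContinuousFunctionCLM ℝ :
    𝓓_{K}(EuclideanSpace ℝ (Fin n), ℝ) →L[ℝ] _)
  let c : ℝ≥0 := (eLpNorm (indicator (K : Set (EuclideanSpace ℝ (Fin n))) fun _ => (1 : ℝ))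
    (ENNReal.ofReal p) volume).toNNReal
  have hc : (c : ℝ≥0∞) = eLpNorm (indicator (K : Set (EuclideanSpace ℝ (Fin n))) fun _ => (1 : ℝ))
      (ENNReal.ofReal p) volume :=
    ENNReal.coe_toNNReal (memLp_indicator_const _ K.isCompact.measurableSet _
      (Or.inr K.isCompact.measure_lt_top.ne)).2.ne
  refine ⟨c • (normSeminorm ℝ _).comp S.toLinearMap, ?_, fun φ => ?_⟩
  · exact (continuous_norm.comp S.continuous).const_smul c
  · rw [lpNorm_eq (isRepr_testDist _)]
    refine (eLpNorm_mono_measure _ Measure.restrict_le_self).trans ?_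
    have h1 : ∀ x, ‖φ x‖ ≤ ‖S φ‖ * ‖indicator (K : Set (EuclideanSpace ℝ (Fin n)))
        (fun _ => (1 : ℝ)) x‖ := fun x => by
      by_cases hx : x ∈ K
      · rw [indicator_of_mem hx, norm_one, mul_one]
        exact (S φ).norm_coe_le_norm x
      · rw [φ.zero_on_compl hx, Pi.zero_apply, norm_zero]
        positivity
    refine (eLpNorm_le_mul_eLpNorm_of_ae_le_mul (.of_forall h1) _).trans ?_
    rw [← hc, mul_comm, ← ENNReal.ofReal_coe_nnreal, ← ENNReal.ofReal_mul c.coe_nonneg]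
    exact le_rfl

theorem isLpPiece_lpNorm {D : 𝓓'(Ω, ℝ) →ₗ[ℝ] 𝓓'(Ω, ℝ)} {P A : 𝓓(Ω, ℝ) →L[ℝ] 𝓓(Ω, ℝ)}
    {a : (EuclideanSpace ℝ (Fin n) → ℝ) → EuclideanSpace ℝ (Fin n) → ℝ} (h : IsDiffOp D P A a) :
    IsLpPiece ((lpNorm Ω p).comp D) p volume Ω
      { toFun := fun φ => A φ
        map_add' := fun φ ψ => by rw [map_add]; rfl
        map_smul' := fun c φ => by rw [map_smul]; rfl } P.toLinearMap where
  memLp φ := (A φ).continuous.memLp_of_hasCompactSupport (A φ).hasCompactSupport |>.restrict _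
  eq φ := by
    rw [ExtSeminorm.comp_toFun, h.testDist]
    exact lpNorm_eq (isRepr_testDist _)
  adj g φ := by
    change testDist (P g) φ = ∫ x in Ω, g x * A φ x
    rw [testDist_comm, ← h.apply, h.testDist, testDist_comm, testDist_apply]

/-- The `L^p` function produced by `IsLpPiece.exists_memLp` satisfies `v (P φ) = ∫ G φ`, which says
that it represents `D v`. -/
theorem lpNorm_lt_top_of_dualNorm {D : 𝓓'(Ω, ℝ) →ₗ[ℝ] 𝓓'(Ω, ℝ)} {P A : 𝓓(Ω, ℝ) →L[ℝ] 𝓓(Ω, ℝ)}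
    {a : (EuclideanSpace ℝ (Fin n) → ℝ) → EuclideanSpace ℝ (Fin n) → ℝ} (h : IsDiffOp D P A a)
    (hpq : p.HolderConjugate q) {N : ExtSeminorm 𝓓'(Ω, ℝ)} (hN : FiniteOnTest N)
    (hle : ∀ u, (lpNorm Ω p).toFun (D u) ≤ N.toFun u) {v : 𝓓'(Ω, ℝ)} {C : ℝ≥0}
    (hv : ∀ φ, ‖v φ‖ₑ ≤ C * (dualNorm N).toFun (testDist φ)) : (lpNorm Ω p).toFun (D v) < ∞ := by
  obtain ⟨G, hG, hvG⟩ := (isLpPiece_lpNorm h).exists_memLp hpq hN hle hv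
  have hp : 1 ≤ ENNReal.ofReal p := by simpa using hpq.lt.le
  have hr : IsRepr (D v) G :=
    ⟨locallyIntegrableOn_of_locallyIntegrable_restrict (hG.locallyIntegrable hp), fun φ => by
      rw [h.apply]
      exact hvG φ⟩
  rw [lpNorm_eq hr]
  exact hG.2

end lpNorm

end SobolevDuality

set_option linter.unusedSectionVars false

/-! ### The difference quotient off the diagonal and its transpose. -/

namespace SobolevDuality

section Kernel

variable {E : Type*} [NormedAddCommGroup E] [InnerProductSpace ℝ E] [FiniteDimensional ℝ E]
  [MeasurableSpace E] [BorelSpace E]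

/-- The integral is the value at `0` of the convolution of the constant `1` with `t ↦ κ (x, -t)`, so
smoothness in `x` is that of a convolution with a parameter. -/
theorem contDiff_integral_right {κ : E × E → ℝ} (hκ : ContDiff ℝ (⊤ : ℕ∞) κ)
    (hc : HasCompactSupport κ) : ContDiff ℝ (⊤ : ℕ∞) fun x => ∫ y, κ (x, y) := by
  have h := contDiffOn_convolution_right_with_param_comp (ContinuousLinearMap.mul ℝ ℝ)
    (μ := (volume : Measure E)) (n := ⊤) (v := fun _ : E => (0 : E)) (s := univ)
    contDiffOn_const (f := fun _ => (1 : ℝ)) (g := fun x t => κ (x, -t))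
    (k := (fun z : E × E => -z.2) '' tsupport κ) isOpen_univ
    (hc.isCompact.image (by fun_prop)) (fun x t _ ht => ?_) (locallyIntegrable_const 1) ?_
  · rw [contDiffOn_univ] at h
    convert h using 2
    simp [convolution_def]
  · exact image_eq_zero_of_notMem_tsupport fun h => ht ⟨_, h, neg_neg t⟩
  · exact (hκ.comp (by fun_prop : ContDiff ℝ (⊤ : ℕ∞) fun z : E × E => (z.1, -z.2))).contDiffOn

theorem tsupport_integral_right_subset {κ : E × E → ℝ} (hc : HasCompactSupport κ) :
    tsupport (fun x => ∫ y, κ (x, y)) ⊆ Prod.fst '' tsupport κ := by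
  refine closure_minimal (fun x hx => ?_) (hc.isCompact.image continuous_fst).isClosed
  by_contra h
  refine hx (integral_eq_zero_of_ae (.of_forall fun y => ?_))
  exact image_eq_zero_of_notMem_tsupport fun hy => h ⟨_, hy, rfl⟩

/-- The set of the pairs of distinct points of `Ω`. -/
def offDiag (Ω : Opens E) : Opens (E × E) :=
  ⟨{z | z.1 ∈ Ω ∧ z.2 ∈ Ω ∧ z.1 ≠ z.2}, (Ω.isOpen.preimage continuous_fst).inter
    ((Ω.isOpen.preimage continuous_snd).inter (isOpen_ne_fun continuous_fst continuous_snd))⟩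

/-- The difference quotient `(f(x) - f(y)) / |x - y|^a`. -/
noncomputable def diffQuot (a : ℝ) : (E → ℝ) →ₗ[ℝ] E × E → ℝ where
  toFun f z := (f z.1 - f z.2) / ‖z.1 - z.2‖ ^ a
  map_add' f g := by
    ext z
    simp only [Pi.add_apply]
    ring
  map_smul' c f := by
    ext z
    simp only [Pi.smul_apply, smul_eq_mul, RingHom.id_apply]
    ring

theorem diffQuot_apply (a : ℝ) (f : E → ℝ) (z : E × E) :
    diffQuot a f z = (f z.1 - f z.2) / ‖z.1 - z.2‖ ^ a := rfl

variable {Ω : Opens E}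

theorem tsupport_div_subset {E : Type*} [TopologicalSpace E] (f g : E → ℝ) :
    tsupport (fun z => f z / g z) ⊆ tsupport f :=
  closure_mono fun y hy h => hy (by simp only [h, zero_div])

/-- Division by `|x - y|^a` on the test functions off the diagonal. -/
noncomputable def divNormRpow (a : ℝ) : 𝓓(offDiag Ω, ℝ) →ₗ[ℝ] 𝓓(offDiag Ω, ℝ) where
  toFun g := ⟨fun z => g z / ‖z.1 - z.2‖ ^ a, contDiff_iff_contDiffAt.2 fun z => by
      by_cases hz : z ∈ tsupport g
      -- On the support of `g` the two points are distinct, where `|x - y|^a` is smooth and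
      -- positive. This is why test functions off the diagonal are used.
      · have hne : z.1 - z.2 ≠ 0 := sub_ne_zero.2 (g.tsupport_subset hz).2.2
        have h1 : ContDiffAt ℝ (⊤ : ℕ∞) (fun z : E × E => ‖z.1 - z.2‖ ^ a) z :=
          ((contDiffAt_fst.sub contDiffAt_snd).norm ℝ hne).rpow_const_of_ne (norm_ne_zero_iff.2 hne)
        exact g.contDiff.contDiffAt.div h1 (Real.rpow_pos_of_pos (norm_pos_iff.2 hne) a).ne'
      · refine (contDiffAt_const (c := (0 : ℝ))).congr_of_eventuallyEq ?_
        filter_upwards [notMem_tsupport_iff_eventuallyEq.1 hz] with y hy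
        rw [hy, Pi.zero_apply, zero_div],
    g.hasCompactSupport.isCompact.of_isClosed_subset (isClosed_tsupport _)
      (tsupport_div_subset _ _), (tsupport_div_subset _ _).trans g.tsupport_subset⟩
  map_add' f g := by
    ext z
    exact add_div _ _ _
  map_smul' c f := by
    ext z
    exact mul_div_assoc _ _ _

/-- The test function `(y, x) ↦ κ(x, y)`. -/
noncomputable def swapTest : 𝓓(offDiag Ω, ℝ) →ₗ[ℝ] 𝓓(offDiag Ω, ℝ) where
  toFun κ := ⟨κ ∘ Homeomorph.prodComm E E, κ.contDiff.comp (by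
      change ContDiff ℝ (⊤ : ℕ∞) fun z : E × E => (z.2, z.1)
      fun_prop),
    κ.hasCompactSupport.comp_homeomorph _, by
      rw [tsupport_comp_eq_preimage]
      exact fun z hz => ⟨(κ.tsupport_subset hz).2.1, (κ.tsupport_subset hz).1,
        (κ.tsupport_subset hz).2.2.symm⟩⟩
  map_add' f g := rfl
  map_smul' c f := rfl

theorem integrable_right (κ : 𝓓(offDiag Ω, ℝ)) (x : E) : Integrable fun y => κ (x, y) := by
  refine (κ.continuous.comp (by fun_prop)).integrable_of_hasCompactSupport ?_
  refine HasCompactSupport.intro (κ.hasCompactSupport.isCompact.image continuous_snd) fun y hy => ?_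
  exact image_eq_zero_of_notMem_tsupport (f := κ) (x := (x, y)) fun h => hy ⟨(x, y), h, rfl⟩

/-- The test function `x ↦ ∫ κ(x, y) dy`. -/
noncomputable def integralTest : 𝓓(offDiag Ω, ℝ) →ₗ[ℝ] 𝓓(Ω, ℝ) where
  toFun κ := ⟨fun x => ∫ y, κ (x, y), contDiff_integral_right κ.contDiff κ.hasCompactSupport,
    (κ.hasCompactSupport.isCompact.image continuous_fst).of_isClosed_subset (isClosed_tsupport _)
      (tsupport_integral_right_subset κ.hasCompactSupport),
    (tsupport_integral_right_subset κ.hasCompactSupport).trans (image_subset_iff.2 fun z hz =>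
      (κ.tsupport_subset hz).1)⟩
  map_add' f g := by
    ext x
    exact integral_add (integrable_right f x) (integrable_right g x)
  map_smul' c f := by
    ext x
    exact integral_const_mul _ _

/-- As `f` is only locally integrable on `Ω`, it is first cut off to the projection of the support
of `κ`, a compact subset of `Ω`; the second variable is cut off in the same way. -/
theorem integrable_fst_mul {f : E → ℝ} (hf : LocallyIntegrableOn f Ω) (κ : 𝓓(offDiag Ω, ℝ)) :
    Integrable fun z : E × E => f z.1 * κ z := by
  have h1 : IsCompact (Prod.fst '' tsupport κ) := κ.hasCompactSupport.isCompact.image continuous_fst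
  have h2 : IsCompact (Prod.snd '' tsupport κ) := κ.hasCompactSupport.isCompact.image continuous_snd
  have hf1 : Integrable (indicator (Prod.fst '' tsupport κ) f) :=
    (hf.integrableOn_compact_subset (image_subset_iff.2 fun z hz =>
      (κ.tsupport_subset hz).1) h1).integrable_indicator h1.measurableSet
  have hf2 : Integrable (indicator (Prod.snd '' tsupport κ) fun _ : E => (1 : ℝ)) :=
    (integrableOn_const h2.measure_lt_top.ne).integrable_indicator h2.measurableSet
  obtain ⟨C, hC⟩ := κ.continuous.bounded_above_of_compact_support κ.hasCompactSupport
  refine ((hf1.mul_prod hf2).mul_bdd (c := C) κ.continuous.aestronglyMeasurable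
    (.of_forall hC)).congr (.of_forall fun z => ?_)
  by_cases hz : z ∈ tsupport κ
  · simp only [indicator_of_mem (mem_image_of_mem Prod.fst hz),
      indicator_of_mem (mem_image_of_mem Prod.snd hz), mul_one]
  · simp only [image_eq_zero_of_notMem_tsupport hz, mul_zero]

theorem integral_fst_mul {f : E → ℝ} (hf : LocallyIntegrableOn f Ω) (κ : 𝓓(offDiag Ω, ℝ)) :
    ∫ z : E × E, f z.1 * κ z = ∫ x, f x * integralTest κ x := by
  rw [Measure.volume_eq_prod, integral_prod _ (integrable_fst_mul hf κ)]
  exact integral_congr_ae (.of_forall fun x => integral_const_mul (f x) fun y => κ (x, y))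

theorem integrable_snd_mul {f : E → ℝ} (hf : LocallyIntegrableOn f Ω) (κ : 𝓓(offDiag Ω, ℝ)) :
    Integrable fun z : E × E => f z.2 * κ z :=
  (integrable_fst_mul hf (swapTest κ)).swap

theorem integral_snd_mul {f : E → ℝ} (hf : LocallyIntegrableOn f Ω) (κ : 𝓓(offDiag Ω, ℝ)) :
    ∫ z : E × E, f z.2 * κ z = ∫ x, f x * integralTest (swapTest κ) x := by
  rw [← integral_fst_mul hf]
  exact (integral_prod_swap fun z : E × E => f z.1 * swapTest κ z)

/-- The transpose of the difference quotient. -/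
noncomputable def diffQuotTranspose (a : ℝ) : 𝓓(offDiag Ω, ℝ) →ₗ[ℝ] 𝓓(Ω, ℝ) :=
  (integralTest - integralTest ∘ₗ swapTest) ∘ₗ divNormRpow a

/-- The terms with `f(x)` and `f(y)` are integrated separately by Fubini. Each is integrable,
because `g / |x - y|^a` is still a test function off the diagonal. -/
theorem integral_mul_diffQuot {f : E → ℝ} (hf : LocallyIntegrableOn f Ω) (a : ℝ)
    (g : 𝓓(offDiag Ω, ℝ)) :
    ∫ z in offDiag Ω, g z * diffQuot a f z = ∫ x, f x * diffQuotTranspose a g x := by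
  rw [setIntegral_eq_integral_of_forall_compl_eq_zero fun z hz => by
    rw [image_eq_zero_of_notMem_tsupport fun h => hz (g.tsupport_subset h), zero_mul]]
  have h : ∀ z : E × E, g z * diffQuot a f z =
      f z.1 * divNormRpow a g z - f z.2 * divNormRpow a g z := fun z => by
    change g z * ((f z.1 - f z.2) / ‖z.1 - z.2‖ ^ a) =
      f z.1 * (g z / ‖z.1 - z.2‖ ^ a) - f z.2 * (g z / ‖z.1 - z.2‖ ^ a)
    ring
  simp only [h]
  have hi : ∀ η : 𝓓(Ω, ℝ), Integrable fun x => f x * η x := fun η =>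
    (TestFunction.integrable_bilin (ContinuousLinearMap.mul ℝ ℝ) hf η).congr
      (.of_forall fun x => mul_comm _ _)
  rw [integral_sub (integrable_fst_mul hf _) (integrable_snd_mul hf _), integral_fst_mul hf,
    integral_snd_mul hf, ← integral_sub (hi _) (hi _)]
  refine integral_congr_ae (.of_forall fun x => ?_)
  exact (mul_sub _ _ _).symm

end Kernel

end SobolevDuality

/-! ### `L^p` bounds for difference quotients. -/

namespace SobolevDuality

section Kernel

variable {E : Type*} [NormedAddCommGroup E] [InnerProductSpace ℝ E] [FiniteDimensional ℝ E]
  [MeasurableSpace E] [BorelSpace E]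

/-- In polar coordinates the `p`-th power becomes `r^(p(1-θ)-1)` on `(0, 1]` and `r^(-1-pθ)` on `(1,
∞)`. The first is integrable because `θ < 1`, the second because `θ > 0`. -/
theorem memLp_min_one_div_rpow [Nontrivial E] {p θ : ℝ} (hp : 1 < p) (h0 : 0 < θ) (h1 : θ < 1) :
    MemLp (fun z : E => min 1 ‖z‖ / ‖z‖ ^ ((Module.finrank ℝ E : ℝ) / p + θ)) (ENNReal.ofReal p)
      volume := by
  have hp0 : 0 < p := zero_lt_one.trans hp
  set d := Module.finrank ℝ E with hd
  have hd0 : 0 < d := Module.finrank_pos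
  have hd1 : ((d - 1 : ℕ) : ℝ) = d - 1 := by
    rw [Nat.cast_sub hd0, Nat.cast_one]
  have hm : AEStronglyMeasurable (fun z : E => min 1 ‖z‖ / ‖z‖ ^ ((d : ℝ) / p + θ)) volume :=
    (by fun_prop : Measurable fun z : E => min 1 ‖z‖ / ‖z‖ ^ ((d : ℝ) / p + θ)).aestronglyMeasurable
  rw [← integrable_norm_rpow_iff hm (by simpa using hp0) ENNReal.ofReal_ne_top,
    ENNReal.toReal_ofReal hp0.le]
  have h2 : IntegrableOn (fun y : ℝ => y ^ (d - 1) • ‖min 1 y / y ^ ((d : ℝ) / p + θ)‖ ^ p)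
      (Ioi 0) := by
    rw [← Ioc_union_Ioi_eq_Ioi zero_le_one, integrableOn_union]
    constructor
    · have h3 : IntegrableOn (fun y : ℝ => y ^ (p * (1 - θ) - 1)) (Ioc 0 1) := by
        rw [← intervalIntegrable_iff_integrableOn_Ioc_of_le zero_le_one]
        exact intervalIntegral.intervalIntegrable_rpow' (by nlinarith)
      refine h3.congr_fun (fun y hy => ?_) measurableSet_Ioc
      have hy0 : 0 < y := hy.1
      rw [min_eq_right hy.2, Real.norm_of_nonneg (by positivity), smul_eq_mul, ← Real.rpow_natCast,
        hd1]
      nth_rw 3 [← Real.rpow_one y]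
      rw [← Real.rpow_sub hy0, ← Real.rpow_mul hy0.le, ← Real.rpow_add hy0]
      change y ^ _ = y ^ _
      congr 1
      field_simp
      ring
    · have h3 : IntegrableOn (fun y : ℝ => y ^ (-1 - p * θ)) (Ioi 1) :=
        integrableOn_Ioi_rpow_of_lt (by nlinarith) one_pos
      refine h3.congr_fun (fun y hy => ?_) measurableSet_Ioi
      have hy0 : 0 < y := one_pos.trans hy
      rw [min_eq_left (le_of_lt hy), Real.norm_of_nonneg (by positivity), smul_eq_mul,
        ← Real.rpow_natCast, hd1, ← Real.rpow_zero y, ← Real.rpow_sub hy0, ← Real.rpow_mul hy0.le,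
        ← Real.rpow_add hy0]
      change y ^ _ = y ^ _
      congr 1
      field_simp
      ring
  exact (integrable_fun_norm_addHaar volume).2 h2

theorem MemLp.mul_prod {p : ℝ} (hp : 0 < p) {f k : E → ℝ}
    (hf : MemLp f (ENNReal.ofReal p) volume) (hk : MemLp k (ENNReal.ofReal p) volume) :
    MemLp (fun z : E × E => f z.1 * k z.2) (ENNReal.ofReal p) volume := by
  have h0 : ENNReal.ofReal p ≠ 0 := by simpa using hp
  have hm : AEStronglyMeasurable (fun z : E × E => f z.1 * k z.2) volume :=
    hf.1.comp_fst.mul hk.1.comp_snd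
  rw [← integrable_norm_rpow_iff hm h0 ENNReal.ofReal_ne_top]
  refine (((integrable_norm_rpow_iff hf.1 h0 ENNReal.ofReal_ne_top).2 hf).mul_prod
    ((integrable_norm_rpow_iff hk.1 h0 ENNReal.ofReal_ne_top).2 hk)).congr (.of_forall fun z => ?_)
  simp only [norm_mul]
  exact (Real.mul_rpow (norm_nonneg _) (norm_nonneg _)).symm

/-- If `f` and `k` are in `L^p` and `k` is even, then `(|f(x)| + |f(y)|) k(x - y)` is in `L^p`. -/
theorem MemLp.add_mul_sub {p : ℝ} (hp : 0 < p) {f k : E → ℝ}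
    (hf : MemLp f (ENNReal.ofReal p) volume) (hk : MemLp k (ENNReal.ofReal p) volume)
    (hk' : ∀ z, k (-z) = k z) :
    MemLp (fun z : E × E => (‖f z.1‖ + ‖f z.2‖) * k (z.1 - z.2)) (ENNReal.ofReal p) volume := by
  have h := MemLp.mul_prod hp hf.norm hk
  -- The measure preserving shears `(x, y) ↦ (x, y - x)` and `(x, y) ↦ (y, x - y)` turn the product
  -- into the two summands, up to the evenness of `k`.
  have h1 := h.comp_measurePreserving
    (measurePreserving_prod_sub (volume : Measure E) (volume : Measure E))
  have h2 := h.comp_measurePreserving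
    (measurePreserving_prod_sub_swap (volume : Measure E) (volume : Measure E))
  refine (h1.add h2).ae_eq (.of_forall fun z => ?_)
  simp only [Pi.add_apply, Function.comp_apply]
  rw [← hk' (z.2 - z.1), neg_sub, add_mul]

/-- If both points lie off `K` the quotient is zero; otherwise the sum of the indicators is at least
`1`. The majorant depends on `f` only through the factor `A`. -/
theorem norm_diffQuot_le {f : E → ℝ} {A a : ℝ} {K : Set E} (hA : 0 ≤ A)
    (hf : ∀ x y, ‖f x - f y‖ ≤ A * min 1 ‖x - y‖) (hK : ∀ x, x ∉ K → f x = 0) (z : E × E) :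
    ‖diffQuot a f z‖ ≤ A * ‖(‖K.indicator (fun _ => (1 : ℝ)) z.1‖ +
      ‖K.indicator (fun _ => (1 : ℝ)) z.2‖) * (min 1 ‖z.1 - z.2‖ / ‖z.1 - z.2‖ ^ a)‖ := by
  have hk : 0 ≤ min 1 ‖z.1 - z.2‖ / ‖z.1 - z.2‖ ^ a := by positivity
  have hI : 0 ≤ ‖K.indicator (fun _ => (1 : ℝ)) z.1‖ + ‖K.indicator (fun _ => (1 : ℝ)) z.2‖ := by
    positivity
  rw [norm_mul, Real.norm_of_nonneg hk, Real.norm_of_nonneg hI]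
  by_cases hz : z.1 ∉ K ∧ z.2 ∉ K
  · rw [diffQuot_apply, hK _ hz.1, hK _ hz.2]
    simp [hz.1, hz.2]
  · have h1 : 1 ≤ ‖K.indicator (fun _ => (1 : ℝ)) z.1‖ + ‖K.indicator (fun _ => (1 : ℝ)) z.2‖ := by
      rw [not_and_or, not_not, not_not] at hz
      rcases hz with hz | hz <;> simp [indicator_of_mem hz]
    rw [diffQuot_apply, norm_div, Real.norm_of_nonneg (Real.rpow_nonneg (norm_nonneg _) _)]
    calc _ ≤ (A * min 1 ‖z.1 - z.2‖) / ‖z.1 - z.2‖ ^ a := by gcongr; exact hf _ _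
      _ = 1 * ((A * min 1 ‖z.1 - z.2‖) / ‖z.1 - z.2‖ ^ a) := (one_mul _).symm
      _ ≤ (‖K.indicator (fun _ => (1 : ℝ)) z.1‖ + ‖K.indicator (fun _ => (1 : ℝ)) z.2‖) *
          ((A * min 1 ‖z.1 - z.2‖) / ‖z.1 - z.2‖ ^ a) := by gcongr
      _ = _ := by ring

end Kernel

section Slobodeckij

variable {n : ℕ} {Ω : Opens (EuclideanSpace ℝ (Fin n))} {p q θ : ℝ} [hp : Fact (1 < p)]

/-- The quotient is `0` on the diagonal, so removing the diagonal from `Ω × Ω` does not change the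
norm. -/
theorem slobodeckijSeminorm_eq {u : 𝓓'(Ω, ℝ)} {f : EuclideanSpace ℝ (Fin n) → ℝ}
    (hf : IsRepr u f) : (slobodeckijSeminorm Ω θ p).toFun u =
      eLpNorm (diffQuot ((n : ℝ) / p + θ) f) (ENNReal.ofReal p) (volume.restrict (offDiag Ω)) := by
  refine (ofRepr_eq (fun f g h => eLpNorm_congr_ae ?_) hf).trans ?_
  · have h1 := (Measure.quasiMeasurePreserving_fst
      (μ := volume.restrict (Ω : Set (EuclideanSpace ℝ (Fin n))))
      (ν := volume.restrict (Ω : Set (EuclideanSpace ℝ (Fin n))))).ae_eq h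
    have h2 := (Measure.quasiMeasurePreserving_snd
      (μ := volume.restrict (Ω : Set (EuclideanSpace ℝ (Fin n))))
      (ν := volume.restrict (Ω : Set (EuclideanSpace ℝ (Fin n))))).ae_eq h
    filter_upwards [h1, h2] with z h1 h2
    simp only [Function.comp_apply] at h1 h2
    rw [h1, h2]
  · change eLpNorm (diffQuot ((n : ℝ) / p + θ) f) _ _ = _
    rw [Measure.prod_restrict, ← Measure.volume_eq_prod,
      ← eLpNorm_indicator_eq_eLpNorm_restrict (Ω.isOpen.prod Ω.isOpen).measurableSet,
      ← eLpNorm_indicator_eq_eLpNorm_restrict (offDiag Ω).isOpen.measurableSet]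
    congr 1
    ext z
    by_cases hz : z.1 = z.2
    · have : diffQuot ((n : ℝ) / p + θ) f z = 0 := by rw [diffQuot_apply, hz, sub_self, zero_div]
      simp only [indicator, this, ite_self]
    · have : z ∈ (Ω : Set _) ×ˢ (Ω : Set _) ↔ z ∈ (offDiag Ω : Set _) :=
        ⟨fun h => ⟨h.1, h.2, hz⟩, fun h => ⟨h.1, h.2.1⟩⟩
      by_cases h : z ∈ (offDiag Ω : Set _)
      · rw [indicator_of_mem h, indicator_of_mem (this.2 h)]
      · rw [indicator_of_notMem h, indicator_of_notMem fun h' => h (this.1 h')]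

/-- The mean value inequality and the trivial bound give `|φ(x) - φ(y)| ≤ (2 sup |φ| + sup |φ'|)
min(1, |x - y|)`. What remains is the norm of a fixed `L^p` function depending on `K`. Polar
coordinates require `n > 0`. -/
theorem boundedOnTest_slobodeckijSeminorm (hn : 0 < n) (h0 : 0 < θ) (h1 : θ < 1) :
    BoundedOnTest (slobodeckijSeminorm Ω θ p) := fun K hK => by
  have : Nontrivial (EuclideanSpace ℝ (Fin n)) := by
    have : Nonempty (Fin n) := ⟨⟨0, hn⟩⟩
    infer_instance
  have hp0 : 0 < p := zero_lt_one.trans hp.out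
  let S := (ContDiffMapSupportedIn.toBoundedContinuousFunctionCLM ℝ :
    𝓓_{K}(EuclideanSpace ℝ (Fin n), ℝ) →L[ℝ] _)
  let S' := (ContDiffMapSupportedIn.toBoundedContinuousFunctionCLM ℝ :
    𝓓_{K}(EuclideanSpace ℝ (Fin n), EuclideanSpace ℝ (Fin n) →L[ℝ] ℝ) →L[ℝ] _).comp
      (ContDiffMapSupportedIn.fderivCLM ℝ ⊤ ⊤ : 𝓓_{K}(EuclideanSpace ℝ (Fin n), ℝ) →L[ℝ] _)
  have hk := memLp_min_one_div_rpow (E := EuclideanSpace ℝ (Fin n)) hp.out h0 h1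
  rw [finrank_euclideanSpace_fin] at hk
  have hK1 : MemLp (indicator (K : Set (EuclideanSpace ℝ (Fin n))) fun _ => (1 : ℝ))
      (ENNReal.ofReal p) volume :=
    memLp_indicator_const _ K.isCompact.measurableSet _ (Or.inr K.isCompact.measure_lt_top.ne)
  have hG := MemLp.add_mul_sub hp0 hK1 hk (fun z => by rw [norm_neg])
  set G : EuclideanSpace ℝ (Fin n) × EuclideanSpace ℝ (Fin n) → ℝ := _ with hGdef
  replace hG : MemLp G (ENNReal.ofReal p) volume := hG
  let c : ℝ≥0 := (eLpNorm G (ENNReal.ofReal p) volume).toNNReal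
  have hc : (c : ℝ≥0∞) = eLpNorm G (ENNReal.ofReal p) volume := ENNReal.coe_toNNReal hG.2.ne
  refine ⟨c • ((normSeminorm ℝ _).comp S.toLinearMap + (normSeminorm ℝ _).comp S.toLinearMap +
    (normSeminorm ℝ _).comp S'.toLinearMap), ?_, fun φ => ?_⟩
  · exact (((continuous_norm.comp S.continuous).add (continuous_norm.comp S.continuous)).add
      (continuous_norm.comp S'.continuous)).const_smul c
  · rw [slobodeckijSeminorm_eq (isRepr_testDist _)]
    refine (eLpNorm_mono_measure _ Measure.restrict_le_self).trans ?_
    have hb : ∀ x, ‖φ x‖ ≤ ‖S φ‖ := fun x => (S φ).norm_coe_le_norm x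
    have hd : ∀ x, ‖fderiv ℝ φ x‖ ≤ ‖S' φ‖ := fun x => by
      have := (S' φ).norm_coe_le_norm x
      have h2 : S' φ x = fderiv ℝ φ x := by
        change (ContDiffMapSupportedIn.fderivCLM ℝ ⊤ ⊤ φ :
          𝓓_{K}(EuclideanSpace ℝ (Fin n), EuclideanSpace ℝ (Fin n) →L[ℝ] ℝ)) x = _
        rw [ContDiffMapSupportedIn.fderivCLM_apply_of_le _ _ le_top]
      rwa [h2] at this
    have hlip : ∀ x y, ‖φ x - φ y‖ ≤ (‖S φ‖ + ‖S φ‖ + ‖S' φ‖) * min 1 ‖x - y‖ := fun x y => by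
      have h3 : ‖φ x - φ y‖ ≤ ‖S' φ‖ * ‖x - y‖ :=
        convex_univ.norm_image_sub_le_of_norm_fderiv_le
          (fun z _ => (φ.contDiff.differentiable (by simp)) z) (fun z _ => hd z) (mem_univ y)
          (mem_univ x)
      have h4 : ‖φ x - φ y‖ ≤ ‖S φ‖ + ‖S φ‖ := (norm_sub_le _ _).trans (add_le_add (hb x) (hb y))
      rcases min_cases 1 ‖x - y‖ with h | h <;> rw [h.1]
      · nlinarith [norm_nonneg (S' φ)]
      · nlinarith [norm_nonneg (S φ), norm_nonneg (x - y)]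
    refine (eLpNorm_le_mul_eLpNorm_of_ae_le_mul (.of_forall fun z =>
      norm_diffQuot_le (by positivity) hlip (fun x hx => φ.zero_on_compl hx) z) _).trans ?_
    rw [← hGdef, ← hc, mul_comm, ← ENNReal.ofReal_coe_nnreal, ← ENNReal.ofReal_mul c.coe_nonneg]
    exact le_rfl

end Slobodeckij

end SobolevDuality

/-! ### Slobodeckij seminorms as `L^p` pieces, and the full norm of nonnegative order. -/

namespace SobolevDuality

theorem locallyIntegrableOn_diffQuot {E : Type*} [NormedAddCommGroup E] [InnerProductSpace ℝ E]
    [FiniteDimensional ℝ E] [MeasurableSpace E] [BorelSpace E] {Ω : Opens E} {f : E → ℝ}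
    (hf : LocallyIntegrableOn f Ω) (a : ℝ) : LocallyIntegrableOn (diffQuot a f) (offDiag Ω) := by
  refine (locallyIntegrableOn_iff (offDiag Ω).isOpen.isLocallyClosed).2 fun K hKU hK => ?_
  obtain ⟨χ, hχ, -⟩ := hK.exists_testFunction_eq_one hKU
  refine (((integrable_fst_mul hf (divNormRpow a χ)).sub
    (integrable_snd_mul hf (divNormRpow a χ))).integrableOn (s := K)).congr_fun (fun z hz => ?_)
    hK.measurableSet
  have hz1 : χ z = 1 := (eventually_nhdsSet_iff_forall.1 hχ z hz).self_of_nhds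
  change f z.1 * (χ z / ‖z.1 - z.2‖ ^ a) - f z.2 * (χ z / ‖z.1 - z.2‖ ^ a) =
    (f z.1 - f z.2) / ‖z.1 - z.2‖ ^ a
  rw [hz1]
  ring

variable {n : ℕ} {Ω : Opens (EuclideanSpace ℝ (Fin n))} {s p q θ : ℝ} [hp : Fact (1 < p)]

section Slobodeckij

variable {D : 𝓓'(Ω, ℝ) →ₗ[ℝ] 𝓓'(Ω, ℝ)} {P A : 𝓓(Ω, ℝ) →L[ℝ] 𝓓(Ω, ℝ)}
    {a : (EuclideanSpace ℝ (Fin n) → ℝ) → EuclideanSpace ℝ (Fin n) → ℝ}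

theorem isLpPiece_slobodeckijSeminorm (hn : 0 < n) (h0 : 0 < θ) (h1 : θ < 1)
    (h : IsDiffOp D P A a) :
    IsLpPiece ((slobodeckijSeminorm Ω θ p).comp D) p volume (offDiag Ω)
      (diffQuot ((n : ℝ) / p + θ) ∘ₗ
        { toFun := fun φ => A φ
          map_add' := fun φ ψ => by rw [map_add]; rfl
          map_smul' := fun c φ => by rw [map_smul]; rfl })
      (P.toLinearMap ∘ₗ diffQuotTranspose ((n : ℝ) / p + θ)) where
  memLp φ := by
    have hc : Measurable (A φ) := (A φ).continuous.measurable
    have hm : Measurable (diffQuot ((n : ℝ) / p + θ) (A φ)) := by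
      unfold diffQuot
      simp only [LinearMap.coe_mk, AddHom.coe_mk]
      fun_prop
    refine ⟨hm.aestronglyMeasurable, ?_⟩
    have := (boundedOnTest_slobodeckijSeminorm (p := p) (Ω := Ω) hn h0 h1).finite (A φ)
    rwa [slobodeckijSeminorm_eq (isRepr_testDist _)] at this
  eq φ := by
    rw [ExtSeminorm.comp_toFun, h.testDist]
    exact slobodeckijSeminorm_eq (isRepr_testDist _)
  adj g φ := by
    change testDist (P (diffQuotTranspose _ g)) φ =
      ∫ z in offDiag Ω, g z * diffQuot ((n : ℝ) / p + θ) (A φ) z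
    rw [testDist_comm, ← h.apply, h.testDist, testDist_apply,
      integral_mul_diffQuot (testFunction_locallyIntegrableOn _), setIntegral_mul_testFunction]

/-- Duality yields a function `G ∈ L^p` off the diagonal. The hypothesis on the `L^p` norm provides
a function `w` representing `D v`; the quotient of `w` and `G` have equal integrals against all test
functions off the diagonal, hence agree almost everywhere there. -/
theorem slobodeckijSeminorm_lt_top_of_dualNorm (hn : 0 < n) (h0 : 0 < θ) (h1 : θ < 1)
    (h : IsDiffOp D P A a) (hpq : p.HolderConjugate q) {N : ExtSeminorm 𝓓'(Ω, ℝ)}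
    (hN : FiniteOnTest N) (hle : ∀ u, (slobodeckijSeminorm Ω θ p).toFun (D u) ≤ N.toFun u)
    {v : 𝓓'(Ω, ℝ)} (hvp : (lpNorm Ω p).toFun (D v) < ∞) {C : ℝ≥0}
    (hv : ∀ φ, ‖v φ‖ₑ ≤ C * (dualNorm N).toFun (testDist φ)) :
    (slobodeckijSeminorm Ω θ p).toFun (D v) < ∞ := by
  obtain ⟨w, hw, -⟩ := exists_isRepr_memLp hvp
  obtain ⟨G, hG, hvG⟩ := (isLpPiece_slobodeckijSeminorm hn h0 h1 h).exists_memLp hpq hN hle hv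
  have h1p : 1 ≤ ENNReal.ofReal p := by simpa using hpq.lt.le
  have hGi : LocallyIntegrableOn G (offDiag Ω) :=
    locallyIntegrableOn_of_locallyIntegrable_restrict (hG.locallyIntegrable h1p)
  have hwi := locallyIntegrableOn_diffQuot hw.1 ((n : ℝ) / p + θ)
  have hi : ∀ {F : EuclideanSpace ℝ (Fin n) × EuclideanSpace ℝ (Fin n) → ℝ},
      LocallyIntegrableOn F (offDiag Ω) → ∀ g : 𝓓(offDiag Ω, ℝ), Integrable fun z => F z * g z :=
    fun hF g => (TestFunction.integrable_bilin (ContinuousLinearMap.mul ℝ ℝ) hF g).congr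
      (.of_forall fun x => mul_comm _ _)
  have hae := (offDiag Ω).isOpen.ae_eq_zero_of_integral_contDiff_smul_eq_zero (μ := volume)
    (hwi.sub hGi) (by
      intro g hg hgc hgs
      let g' : 𝓓(offDiag Ω, ℝ) := ⟨g, hg, hgc, hgs⟩
      have h2 : v (P (diffQuotTranspose ((n : ℝ) / p + θ) g')) = ∫ z in offDiag Ω, G z * g' z :=
        hvG g'
      rw [← h.apply, hw.2, setIntegral_mul_testFunction, ← integral_mul_diffQuot hw.1,
        setIntegral_eq_integral_of_forall_compl_eq_zero,
          setIntegral_eq_integral_of_forall_compl_eq_zero] at h2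
      · have h3 : ∀ z, g z • (diffQuot ((n : ℝ) / p + θ) w - G) z =
          diffQuot ((n : ℝ) / p + θ) w z * g' z - G z * g' z := fun z => by
          change g z * (_ - _) = _ * g z - _ * g z
          ring
        simp only [h3]
        rw [integral_sub (hi hwi g') (hi hGi g'), ← h2, sub_eq_zero]
        simp only [mul_comm]
      all_goals
        intro z hz
        simp only [image_eq_zero_of_notMem_tsupport fun h => hz (g'.tsupport_subset h), zero_mul,
          mul_zero])
  rw [slobodeckijSeminorm_eq hw, eLpNorm_congr_ae (g := G)]
  · exact hG.2
  · filter_upwards [ae_restrict_of_ae hae, ae_restrict_mem (offDiag Ω).isOpen.measurableSet]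
      with z hz hzU
    exact sub_eq_zero.1 (hz hzU)

end Slobodeckij

/-! ### The norms of nonnegative order -/

/-- Reduces a property that is stable under sums to the single `L^p` and Slobodeckij terms. -/
theorem nonnegSobolevNorm_induction (P : ExtSeminorm 𝓓'(Ω, ℝ) → Prop)
    (h0 : ∀ N : ExtSeminorm 𝓓'(Ω, ℝ), (∀ u, N.toFun u = 0) → P N)
    (hadd : ∀ N M, P N → P M → P (N + M))
    (hlp : ∀ ν : Fin n → ℕ, ∑ i, ν i ≤ ⌊s⌋₊ → P ((lpNorm Ω p).comp (partialDeriv ν)))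
    (hsl : Int.fract s ≠ 0 → ∀ ν : Fin n → ℕ, ∑ i, ν i = ⌊s⌋₊ →
      P ((slobodeckijSeminorm Ω (Int.fract s) p).comp (partialDeriv ν))) :
    P (nonnegSobolevNorm Ω s p) := by
  have hl : P (.sum (Finset.range (⌊s⌋₊ + 1)) fun j =>
      .sum (Finset.piAntidiag Finset.univ j) fun ν => (lpNorm Ω p).comp (partialDeriv ν)) := by
    refine ExtSeminorm.sum_induction P h0 hadd _ _ fun j hj => ?_
    refine ExtSeminorm.sum_induction P h0 hadd _ _ fun ν hν => hlp ν ?_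
    rw [(Finset.mem_piAntidiag.1 hν).1]
    exact Nat.lt_succ_iff.1 (Finset.mem_range.1 hj)
  rw [nonnegSobolevNorm]
  split_ifs with hs
  · exact hl
  · refine hadd _ _ hl (ExtSeminorm.sum_induction P h0 hadd _ _ fun ν hν => hsl hs ν ?_)
    exact (Finset.mem_piAntidiag.1 hν).1

theorem lpNorm_le_nonnegSobolevNorm {ν : Fin n → ℕ} (hν : ∑ i, ν i ≤ ⌊s⌋₊) (u : 𝓓'(Ω, ℝ)) :
    (lpNorm Ω p).toFun (partialDeriv ν u) ≤ (nonnegSobolevNorm Ω s p).toFun u := by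
  have hl : (lpNorm Ω p).toFun (partialDeriv ν u) ≤ ∑ j ∈ Finset.range (⌊s⌋₊ + 1),
      ∑ ν ∈ Finset.piAntidiag Finset.univ j, (lpNorm Ω p).toFun (partialDeriv ν u) := by
    refine le_trans ?_ (Finset.single_le_sum (fun _ _ => zero_le)
      (Finset.mem_range.2 (Nat.lt_succ_iff.2 hν)))
    exact Finset.single_le_sum (f := fun ν => (lpNorm Ω p).toFun (partialDeriv ν u))
      (fun _ _ => zero_le) (Finset.mem_piAntidiag.2 ⟨rfl, fun _ _ => Finset.mem_univ _⟩)
  rw [nonnegSobolevNorm]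
  split_ifs
  · exact hl
  · exact hl.trans le_self_add

theorem slobodeckijSeminorm_le_nonnegSobolevNorm {ν : Fin n → ℕ} (hs : Int.fract s ≠ 0)
    (hν : ∑ i, ν i = ⌊s⌋₊) (u : 𝓓'(Ω, ℝ)) :
    (slobodeckijSeminorm Ω (Int.fract s) p).toFun (partialDeriv ν u) ≤
      (nonnegSobolevNorm Ω s p).toFun u := by
  rw [nonnegSobolevNorm, if_neg hs]
  refine le_trans ?_ le_add_self
  exact Finset.single_le_sum (f := fun ν =>
    (slobodeckijSeminorm Ω (Int.fract s) p).toFun (partialDeriv ν u))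
    (fun _ _ => zero_le) (Finset.mem_piAntidiag.2 ⟨hν, fun _ _ => Finset.mem_univ _⟩)

theorem partialDeriv_zero : (partialDeriv 0 : 𝓓'(Ω, ℝ) →ₗ[ℝ] 𝓓'(Ω, ℝ)) = LinearMap.id := by
  rw [partialDeriv]
  exact List.prod_eq_one (by simp)

theorem lpNorm_le (u : 𝓓'(Ω, ℝ)) : (lpNorm Ω p).toFun u ≤ (nonnegSobolevNorm Ω s p).toFun u := by
  have := lpNorm_le_nonnegSobolevNorm (Ω := Ω) (s := s) (p := p) (ν := 0) (by simp) u
  rwa [partialDeriv_zero] at this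

theorem fract_pos (hs : Int.fract s ≠ 0) : 0 < Int.fract s :=
  (Int.fract_nonneg s).lt_of_ne' hs

theorem boundedOnTest_nonnegSobolevNorm (hn : 0 < n) : BoundedOnTest (nonnegSobolevNorm Ω s p) :=
  nonnegSobolevNorm_induction _ (fun _ h => .of_eq_zero h) (fun _ _ h h' => h.add h')
    (fun ν _ => by
      obtain ⟨P, A, a, h⟩ := IsDiffOp.exists_partialDeriv (Ω := Ω) ν
      exact h.boundedOnTest boundedOnTest_lpNorm)
    (fun hs ν _ => by
      obtain ⟨P, A, a, h⟩ := IsDiffOp.exists_partialDeriv (Ω := Ω) ν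
      exact h.boundedOnTest (boundedOnTest_slobodeckijSeminorm hn (fract_pos hs)
        (Int.fract_lt_one s)))

theorem approximable_nonnegSobolevNorm (hn : 0 < n) : Approximable (nonnegSobolevNorm Ω s p) := by
  have hpq := Real.HolderConjugate.conjExponent hp.out
  -- `Approximable.add` needs finite norms of test functions, so boundedness is carried through the
  -- induction.
  suffices h : BoundedOnTest (nonnegSobolevNorm Ω s p) ∧ Approximable (nonnegSobolevNorm Ω s p) from
    h.2
  refine nonnegSobolevNorm_induction (fun N => BoundedOnTest N ∧ Approximable N)
    (fun _ h => ⟨.of_eq_zero h, .of_eq_zero h⟩)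
    (fun _ _ h h' => ⟨h.1.add h'.1, h.2.add h.1.finite h'.1.finite h'.2⟩) (fun ν _ => ?_)
    (fun hs ν _ => ?_)
  all_goals obtain ⟨P, A, a, h⟩ := IsDiffOp.exists_partialDeriv (Ω := Ω) ν
  · exact ⟨h.boundedOnTest boundedOnTest_lpNorm, (isLpPiece_lpNorm h).approximable hpq⟩
  · exact ⟨h.boundedOnTest (boundedOnTest_slobodeckijSeminorm hn (fract_pos hs)
      (Int.fract_lt_one s)), (isLpPiece_slobodeckijSeminorm hn (fract_pos hs)
      (Int.fract_lt_one s) h).approximable hpq⟩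

/-- A distribution which is bounded by the dual norm has finite norm. -/
theorem nonnegSobolevNorm_lt_top_of_dualNorm (hn : 0 < n) {v : 𝓓'(Ω, ℝ)} {C : ℝ≥0}
    (hv : ∀ φ, ‖v φ‖ₑ ≤ C * (dualNorm (nonnegSobolevNorm Ω s p)).toFun (testDist φ)) :
    (nonnegSobolevNorm Ω s p).toFun v < ∞ := by
  have hpq := Real.HolderConjugate.conjExponent hp.out
  have hfin := (boundedOnTest_nonnegSobolevNorm (Ω := Ω) (s := s) (p := p) hn).finite
  -- The `L^p` terms come first: the Slobodeckij terms need a function that represents `∂^ν v`.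
  have hlp : ∀ ν : Fin n → ℕ, ∑ i, ν i ≤ ⌊s⌋₊ → (lpNorm Ω p).toFun (partialDeriv ν v) < ∞ := by
    intro ν hν
    obtain ⟨P, A, a, h⟩ := IsDiffOp.exists_partialDeriv (Ω := Ω) ν
    exact lpNorm_lt_top_of_dualNorm h hpq hfin (lpNorm_le_nonnegSobolevNorm hν) hv
  refine nonnegSobolevNorm_induction (fun N => N.toFun v < ∞) (fun _ h => by simp [h])
    (fun _ _ h h' => ENNReal.add_lt_top.2 ⟨h, h'⟩) hlp fun hs ν hν => ?_
  obtain ⟨P, A, a, h⟩ := IsDiffOp.exists_partialDeriv (Ω := Ω) ν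
  exact slobodeckijSeminorm_lt_top_of_dualNorm hn (fract_pos hs) (Int.fract_lt_one s) h hpq hfin
    (slobodeckijSeminorm_le_nonnegSobolevNorm hs hν) (hlp ν hν.le) hv

end SobolevDuality

/-! ### Density in the dual norm, and the dual pairs of all orders. -/

namespace SobolevDuality

variable {n : ℕ} {Ω : Opens (EuclideanSpace ℝ (Fin n))} {N M : ExtSeminorm 𝓓'(Ω, ℝ)} {s p q : ℝ}

theorem mem_topologicalClosure_testFunctions (hM : FiniteOnTest M) {u : M.Space}
    (h : ∀ ε : ℝ≥0∞, 0 < ε → ∃ ψ : 𝓓(Ω, ℝ), M.toFun (M.incl u - testDist ψ) ≤ ε) :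
    u ∈ (testFunctions M).topologicalClosure := by
  change u ∈ closure (testFunctions M : Set M.Space)
  rw [EMetric.mem_closure_iff]
  intro ε hε
  obtain ⟨δ, hδ0, hδ⟩ := exists_between hε
  obtain ⟨ψ, hψ⟩ := h δ hδ0
  let w : M.Space := ⟨testDist ψ, hM ψ⟩
  refine ⟨w, ⟨ψ, isRepr_testDist ψ⟩, ?_⟩
  rw [edist_eq_enorm_sub, ExtSeminorm.enorm_eq, map_sub]
  exact hψ.trans_lt hδ

/-! ### The dual norm -/

theorem dualNorm_le (hN : FiniteOnTest N) {u : 𝓓'(Ω, ℝ)} {C : ℝ≥0∞}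
    (h : ∀ φ, ‖u φ‖ₑ ≤ C * N.toFun (testDist φ)) : (dualNorm N).toFun u ≤ C := by
  induction C with
  | top => exact le_top
  | coe C =>
    obtain ⟨F, hF, hFC⟩ := exists_restrictsTo hN h
    refine (iInf₂_le F hF).trans ?_
    exact_mod_cast (show ‖F‖₊ ≤ C from hFC)

theorem enorm_apply_le_dualNorm (hN : FiniteOnTest N) {u : 𝓓'(Ω, ℝ)}
    (hu : (dualNorm N).toFun u < ∞) (φ : 𝓓(Ω, ℝ)) :
    ‖u φ‖ₑ ≤ (dualNorm N).toFun u * N.toFun (testDist φ) := by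
  obtain ⟨F, hF⟩ : ∃ F : StrongDual ℝ (TestClosure N), RestrictsTo F u := by
    by_contra! hF
    exact hu.ne (iInf₂_eq_top.2 fun F h => (hF F h).elim)
  refine (hF.enorm_le hN φ).trans (mul_le_mul_left (le_iInf₂ fun G hG => ?_) _)
  rw [hF.unique hN hG]

/-- An element of the dual is a bounded functional on the test functions, and approximability is
exactly approximation in the dual norm. No condition on the support is needed at negative order. -/
theorem Approximable.mem_topologicalClosure (ha : Approximable N) (hN : FiniteOnTest N)
    (hD : FiniteOnTest (dualNorm N)) (u : (dualNorm N).Space) :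
    u ∈ (testFunctions (dualNorm N)).topologicalClosure := by
  refine mem_topologicalClosure_testFunctions hD fun ε hε => ?_
  have hu := (dualNorm N).toFun_incl_lt_top u
  obtain ⟨ψ, hψ⟩ := ha ((dualNorm N).incl u).toLinearMap ((dualNorm N).toFun _).toNNReal
    (fun φ => by
      rw [ENNReal.coe_toNNReal hu.ne]
      exact enorm_apply_le_dualNorm hN hu φ) ε hε
  exact ⟨ψ, dualNorm_le hN hψ⟩

theorem BoundedOnTest.mono (hM : BoundedOnTest M) (h : ∀ φ, N.toFun (testDist φ) ≤ M.toFun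
    (testDist φ)) :
    BoundedOnTest N := fun K hK => by
  obtain ⟨r, hr, hrM⟩ := hM K hK
  exact ⟨r, hr, fun φ => (h _).trans (hrM φ)⟩

/-- Bounds for the action of a distribution on the test functions. -/
theorem exists_enorm_apply_le_dualNorm (hN : FiniteOnTest N) (φ : 𝓓(Ω, ℝ)) :
    ∃ C : ℝ≥0, ∀ u, ‖u φ‖ₑ ≤ C * (dualNorm N).toFun u := by
  -- The summand `1` keeps the constant nonzero, so that the bound is `∞` when the dual norm is.
  refine ⟨(N.toFun (testDist φ)).toNNReal + 1, fun u => ?_⟩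
  rcases eq_or_ne ((dualNorm N).toFun u) ∞ with hu | hu
  · rw [hu, ENNReal.mul_top (by positivity)]
    exact le_top
  · refine (enorm_apply_le_dualNorm hN hu.lt_top φ).trans ?_
    rw [mul_comm, ENNReal.coe_add, ENNReal.coe_toNNReal (hN φ).ne]
    gcongr
    exact le_self_add

section Holder

variable [hp : Fact (1 < p)] [hq : Fact (1 < q)]

theorem enorm_apply_le_lpNorm (hpq : p.HolderConjugate q) {u : 𝓓'(Ω, ℝ)}
    (hu : (lpNorm Ω p).toFun u < ∞) (φ : 𝓓(Ω, ℝ)) :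
    ‖u φ‖ₑ ≤ (lpNorm Ω p).toFun u * (lpNorm Ω q).toFun (testDist φ) := by
  obtain ⟨f, hf, hfp⟩ := exists_isRepr_memLp hu
  rw [hf.2, lpNorm_eq hf, lpNorm_eq (isRepr_testDist φ)]
  exact enorm_integral_mul_le hpq hfp.1 φ.continuous.aestronglyMeasurable

theorem exists_enorm_apply_le_lpNorm (hpq : p.HolderConjugate q) (φ : 𝓓(Ω, ℝ)) :
    ∃ C : ℝ≥0, ∀ u, ‖u φ‖ₑ ≤ C * (lpNorm Ω p).toFun u := by
  have hfin := boundedOnTest_lpNorm (Ω := Ω) (p := q).finite φ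
  refine ⟨((lpNorm Ω q).toFun (testDist φ)).toNNReal + 1, fun u => ?_⟩
  rcases eq_or_ne ((lpNorm Ω p).toFun u) ∞ with hu | hu
  · rw [hu, ENNReal.mul_top (by positivity)]
    exact le_top
  · refine (enorm_apply_le_lpNorm hpq hu.lt_top φ).trans ?_
    rw [mul_comm, ENNReal.coe_add, ENNReal.coe_toNNReal hfin.ne]
    gcongr
    exact le_self_add

theorem enorm_testDist_le_lpNorm (hpq : p.HolderConjugate q) (φ η : 𝓓(Ω, ℝ)) :
    ‖testDist φ η‖ₑ ≤ (lpNorm Ω p).toFun (testDist φ) * (lpNorm Ω q).toFun (testDist η) :=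
  enorm_apply_le_lpNorm hpq (boundedOnTest_lpNorm.finite φ) η

theorem lpNorm_lt_top_of_lpNorm (hpq : p.HolderConjugate q) {v : 𝓓'(Ω, ℝ)} {C : ℝ≥0}
    (hv : ∀ φ, ‖v φ‖ₑ ≤ C * (lpNorm Ω p).toFun (testDist φ)) : (lpNorm Ω q).toFun v < ∞ := by
  let J : 𝓓(Ω, ℝ) →ₗ[ℝ] EuclideanSpace ℝ (Fin n) → ℝ :=
    { toFun := fun g => g
      map_add' := fun _ _ => rfl
      map_smul' := fun _ _ => rfl }
  obtain ⟨G, hG, hvG⟩ := exists_memLp_forall_eq_integral (μ := volume.restrict Ω) hpq J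
    (fun g => IsLpPiece.memLp_testFunction g _) v.toLinearMap C fun φ => by
      have := hv φ
      rwa [lpNorm_eq (isRepr_testDist φ)] at this
  have hr : IsRepr v G := ⟨locallyIntegrableOn_of_locallyIntegrable_restrict
    (hG.locallyIntegrable (by simpa using hpq.symm.lt.le)), hvG⟩
  rw [lpNorm_eq hr]
  exact hG.2

/-- Compactly supported elements of the space can be approximated by test functions. -/
def HasCompactApprox (N : ExtSeminorm 𝓓'(Ω, ℝ)) : Prop :=
  ∀ (u : N.Space) (K : Compacts (EuclideanSpace ℝ (Fin n))),
    (K : Set (EuclideanSpace ℝ (Fin n))) ⊆ Ω → dsupport (N.incl u) ⊆ K →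
      u ∈ (testFunctions N).topologicalClosure

/-- Hölder's inequality, as the Sobolev norm dominates the `L^p` norm. This reduces bounds on test
functions at negative order to those for `L^q`. -/
theorem dualNorm_testDist_le (hn : 0 < n) (hpq : p.HolderConjugate q) (φ : 𝓓(Ω, ℝ)) :
    (dualNorm (nonnegSobolevNorm Ω s p)).toFun (testDist φ) ≤ (lpNorm Ω q).toFun (testDist φ) :=
  dualNorm_le (boundedOnTest_nonnegSobolevNorm hn).finite fun η =>
    (enorm_testDist_le_lpNorm hpq.symm φ η).trans (mul_le_mul_right (lpNorm_le _) _)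

theorem boundedOnTest_dualNorm (hn : 0 < n) (hpq : p.HolderConjugate q) :
    BoundedOnTest (dualNorm (nonnegSobolevNorm Ω s p)) :=
  (boundedOnTest_lpNorm (p := q)).mono (dualNorm_testDist_le hn hpq)

theorem isDualPair_dualNorm (hn : 0 < n) (hpq : p.HolderConjugate q)
    (hc : HasCompactApprox (nonnegSobolevNorm Ω s p)) :
    IsDualPair (nonnegSobolevNorm Ω s p) (dualNorm (nonnegSobolevNorm Ω s p)) where
  bounded_left := boundedOnTest_nonnegSobolevNorm hn
  bounded_right := boundedOnTest_dualNorm hn hpq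
  apply_le := exists_enorm_apply_le_dualNorm (boundedOnTest_nonnegSobolevNorm hn).finite
  testDist_le φ := enorm_apply_le_dualNorm (boundedOnTest_nonnegSobolevNorm hn).finite
    ((boundedOnTest_dualNorm hn hpq).finite φ)
  right_finite _ _ h :=
    (dualNorm_le (boundedOnTest_nonnegSobolevNorm hn).finite h).trans_lt ENNReal.coe_lt_top
  closure_left := hc
  closure_right u _ _ _ := (approximable_nonnegSobolevNorm hn).mem_topologicalClosure
    (boundedOnTest_nonnegSobolevNorm hn).finite (boundedOnTest_dualNorm hn hpq).finite u

/-- The case of negative `s`. Here `right_finite` is the substantial field: it goes from the dual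
norm back to the Sobolev norm. -/
theorem isDualPair_dualNorm_left (hn : 0 < n) (hpq : p.HolderConjugate q)
    (hc : HasCompactApprox (nonnegSobolevNorm Ω s p)) :
    IsDualPair (dualNorm (nonnegSobolevNorm Ω s p)) (nonnegSobolevNorm Ω s p) where
  bounded_left := boundedOnTest_dualNorm hn hpq
  bounded_right := boundedOnTest_nonnegSobolevNorm hn
  apply_le φ := (exists_enorm_apply_le_lpNorm hpq φ).imp fun C hC u =>
    (hC u).trans (mul_le_mul_right (lpNorm_le u) _)
  testDist_le φ η := by
    rw [testDist_comm, mul_comm]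
    exact (isDualPair_dualNorm hn hpq hc).testDist_le η φ
  right_finite _ _ h := nonnegSobolevNorm_lt_top_of_dualNorm hn h
  closure_left := (isDualPair_dualNorm hn hpq hc).closure_right
  closure_right := hc

theorem nonnegSobolevNorm_zero : nonnegSobolevNorm Ω 0 p = lpNorm Ω p := by
  refine ExtSeminorm.ext fun u => ?_
  rw [nonnegSobolevNorm, if_pos Int.fract_zero]
  simp [ExtSeminorm.sum_toFun, ExtSeminorm.comp_toFun, partialDeriv_zero]

/-- For `s = 0` neither norm is defined as a dual norm, so the duality is the Riesz theorem itself.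
-/
theorem isDualPair_lpNorm (hpq : p.HolderConjugate q) (hcp : HasCompactApprox (lpNorm Ω p))
    (hcq : HasCompactApprox (lpNorm Ω q)) : IsDualPair (lpNorm Ω p) (lpNorm Ω q) where
  bounded_left := boundedOnTest_lpNorm
  bounded_right := boundedOnTest_lpNorm
  apply_le := exists_enorm_apply_le_lpNorm hpq.symm
  testDist_le := enorm_testDist_le_lpNorm hpq.symm
  right_finite _ _ h := lpNorm_lt_top_of_lpNorm hpq h
  closure_left := hcp
  closure_right := hcq

theorem sobolevNorm_of_nonneg (hs : 0 ≤ s) : sobolevNorm Ω s p = nonnegSobolevNorm Ω s p :=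
  if_pos hs

theorem sobolevNorm_neg (hs : 0 < s) (hpq : p.HolderConjugate q) :
    sobolevNorm Ω (-s) q = dualNorm (nonnegSobolevNorm Ω s p) := by
  obtain rfl : q.conjExponent = p := hpq.symm.conjExponent_eq
  rw [sobolevNorm, if_neg (by simpa using hs)]
  simp only [neg_neg]

theorem isDualPair_sobolevNorm (hn : 0 < n) (hpq : p.HolderConjugate q)
    (hcp : ∀ s, 0 ≤ s → HasCompactApprox (nonnegSobolevNorm Ω s p))
    (hcq : ∀ s, 0 ≤ s → HasCompactApprox (nonnegSobolevNorm Ω s q)) :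
    IsDualPair (sobolevNorm Ω s p) (sobolevNorm Ω (-s) q) := by
  rcases lt_trichotomy s 0 with hs | rfl | hs
  · obtain ⟨t, rfl⟩ : ∃ t, s = -t := ⟨-s, (neg_neg s).symm⟩
    have ht : 0 < t := by simpa using hs
    rw [neg_neg, sobolevNorm_of_nonneg ht.le, sobolevNorm_neg ht hpq.symm]
    exact isDualPair_dualNorm_left hn hpq.symm (hcq t ht.le)
  · have h1 := hcp 0 le_rfl
    have h2 := hcq 0 le_rfl
    rw [nonnegSobolevNorm_zero] at h1 h2
    rw [neg_zero, sobolevNorm_of_nonneg le_rfl, sobolevNorm_of_nonneg le_rfl,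
      nonnegSobolevNorm_zero, nonnegSobolevNorm_zero]
    exact isDualPair_lpNorm hpq h1 h2
  · rw [sobolevNorm_of_nonneg hs.le, sobolevNorm_neg hs hpq]
    exact isDualPair_dualNorm hn hpq (hcp s hs.le)

end Holder

end SobolevDuality

/-! ### Mollification in `L^p`. -/

namespace MeasureTheory

/-- **Minkowski's integral inequality** for a probability measure. -/
theorem eLpNorm_integral_le_of_forall_le {α β : Type*} [MeasurableSpace α] [MeasurableSpace β]
    {μ : Measure α} {π : Measure β} [SFinite μ] [IsProbabilityMeasure π] {p : ℝ} (hp : 1 ≤ p)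
    {G : α × β → ℝ} (hG : Measurable G) {ε : ℝ≥0∞}
    (h : ∀ᵐ z ∂π, eLpNorm (fun y => G (y, z)) (ENNReal.ofReal p) μ ≤ ε) :
    eLpNorm (fun y => ∫ z, G (y, z) ∂π) (ENNReal.ofReal p) μ ≤ ε := by
  have hp0 : 0 < p := zero_lt_one.trans_le hp
  have h0 : ENNReal.ofReal p ≠ 0 := by simpa using hp0
  have hpow : ∀ {γ : Type _} [MeasurableSpace γ] (ν : Measure γ) (f : γ → ℝ) (C : ℝ≥0∞),
      eLpNorm f (ENNReal.ofReal p) ν ≤ C ↔ ∫⁻ x, ‖f x‖ₑ ^ p ∂ν ≤ C ^ p := by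
    intro γ _ ν f C
    rw [eLpNorm_eq_lintegral_rpow_enorm_toReal h0 ENNReal.ofReal_ne_top,
      ENNReal.toReal_ofReal hp0.le, one_div, ENNReal.rpow_inv_le_iff hp0]
  -- On a probability space the `L^1` norm is at most the `L^p` norm; after taking `p`-th powers
  -- only Tonelli's theorem is left.
  have h1 : ∀ y, ‖∫ z, G (y, z) ∂π‖ₑ ^ p ≤ ∫⁻ z, ‖G (y, z)‖ₑ ^ p ∂π := fun y => by
    have h2 : ‖∫ z, G (y, z) ∂π‖ₑ ≤ eLpNorm (fun z => G (y, z)) (ENNReal.ofReal p) π := by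
      refine (enorm_integral_le_lintegral_enorm _).trans ?_
      rw [← eLpNorm_one_eq_lintegral_enorm]
      exact eLpNorm_le_eLpNorm_of_exponent_le (by simpa using hp)
        (hG.comp measurable_prodMk_left).aestronglyMeasurable
    refine (ENNReal.rpow_le_rpow h2 hp0.le).trans ?_
    rw [eLpNorm_eq_lintegral_rpow_enorm_toReal h0 ENNReal.ofReal_ne_top,
      ENNReal.toReal_ofReal hp0.le, one_div, ENNReal.rpow_inv_rpow hp0.ne']
  rw [hpow]
  calc ∫⁻ y, ‖∫ z, G (y, z) ∂π‖ₑ ^ p ∂μ ≤ ∫⁻ y, ∫⁻ z, ‖G (y, z)‖ₑ ^ p ∂π ∂μ := lintegral_mono h1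
    _ = ∫⁻ z, ∫⁻ y, ‖G (y, z)‖ₑ ^ p ∂μ ∂π :=
      lintegral_lintegral_swap (hG.enorm.pow_const p).aemeasurable
    _ ≤ ∫⁻ _, ε ^ p ∂π := lintegral_mono_ae (h.mono fun z hz => (hpow _ _ _).1 hz)
    _ = ε ^ p := by simp

/-- Continuity of translations in `L^p`. -/
theorem MemLp.tendsto_eLpNorm_translate_sub {Y : Type*} [NormedAddCommGroup Y] [NormedSpace ℝ Y]
    [FiniteDimensional ℝ Y] [MeasurableSpace Y] [BorelSpace Y] {μ : Measure Y} [μ.IsAddHaarMeasure]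
    {p : ℝ≥0∞} (hp1 : 1 ≤ p) (hp : p ≠ ∞) {h : Y → ℝ} (hh : MemLp h p μ) :
    Tendsto (fun w => eLpNorm (fun y => h (w + y) - h y) p μ) (𝓝 0) (𝓝 0) := by
  have : Fact (1 ≤ p) := ⟨hp1⟩
  have : Fact (p ≠ ∞) := ⟨hp⟩
  have hc : Continuous fun w : Y => DomAddAct.mk w +ᵥ hh.toLp h :=
    continuous_vadd.comp (DomAddAct.continuous_mk.prodMk continuous_const)
  have h1 := (hc.tendsto 0).edist (tendsto_const_nhds (x := hh.toLp h))
  have h2 : ∀ w : Y, edist (DomAddAct.mk w +ᵥ hh.toLp h) (hh.toLp h) =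
      eLpNorm (fun y => h (w + y) - h y) p μ := fun w => by
    rw [DomAddAct.mk_vadd_toLp, Lp.edist_toLp_toLp]
    rfl
  have h3 : edist (DomAddAct.mk (0 : Y) +ᵥ hh.toLp h) (hh.toLp h) = 0 := by
    rw [h2]
    simp
  rw [h3] at h1
  simpa only [h2] using h1

end MeasureTheory

namespace ContDiffBump

variable {E : Type*} [NormedAddCommGroup E] [NormedSpace ℝ E] [HasContDiffBump E]
  [FiniteDimensional ℝ E] [MeasurableSpace E] [BorelSpace E] {μ : Measure E} [μ.IsAddHaarMeasure]

/-- The probability measure with the density of the mollifier. -/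
theorem exists_measure (ρ : ContDiffBump (0 : E)) : ∃ π : Measure E, IsProbabilityMeasure π ∧
    (∀ᵐ z ∂π, z ∈ Metric.ball 0 ρ.rOut) ∧ ∀ f : E → ℝ,
      (Integrable f π ↔ Integrable (fun z => ρ.normed μ z * f z) μ) ∧
      ∫ z, f z ∂π = ∫ z, ρ.normed μ z * f z ∂μ := by
  have hgm : Measurable fun z => (ρ.normed μ z).toNNReal :=
    ρ.continuous_normed.measurable.real_toNNReal
  have hg : ∀ z, ((ρ.normed μ z).toNNReal : ℝ) = ρ.normed μ z := fun z =>
    Real.coe_toNNReal _ (ρ.nonneg_normed z)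
  have hs : ∀ f : E → ℝ, (fun z => (ρ.normed μ z).toNNReal • f z) = fun z => ρ.normed μ z * f z :=
    fun f => by
      ext z
      rw [NNReal.smul_def, hg, smul_eq_mul]
  refine ⟨μ.withDensity fun z => (ρ.normed μ z).toNNReal, ⟨?_⟩, ?_, fun f => ⟨?_, ?_⟩⟩
  · rw [withDensity_apply _ MeasurableSet.univ, setLIntegral_univ]
    have := ofReal_integral_eq_lintegral_ofReal ρ.integrable_normed
      (.of_forall ρ.nonneg_normed) (μ := μ)
    rw [ρ.integral_normed, ENNReal.ofReal_one] at this
    exact this.symm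
  · refine (ae_withDensity_iff hgm.coe_nnreal_ennreal).2 (.of_forall fun z hz => ?_)
    rw [← ρ.support_normed_eq (μ := μ)]
    intro h0
    rw [h0] at hz
    simp at hz
  · rw [integrable_withDensity_iff_integrable_smul hgm, hs]
  · rw [integral_withDensity_eq_integral_smul hgm, hs]

/-- The mollifications of a function `h` in `L^p` along a linear map `D` converge to `h`. -/
theorem tendsto_eLpNorm_mollify_sub {Y : Type*} [NormedAddCommGroup Y] [NormedSpace ℝ Y]
    [FiniteDimensional ℝ Y] [MeasurableSpace Y] [BorelSpace Y] {ν : Measure Y} [ν.IsAddHaarMeasure]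
    {p : ℝ} (hp : 1 ≤ p) {h : Y → ℝ} (hm : Measurable h) (hh : MemLp h (ENNReal.ofReal p) ν)
    (D : E →L[ℝ] Y) {ρ : ℕ → ContDiffBump (0 : E)}
    (hρ : Tendsto (fun i => (ρ i).rOut) atTop (𝓝 0))
    (hi : ∀ i y, Integrable (fun z => (ρ i).normed μ z * h (y - D z)) μ) :
    Tendsto (fun i => eLpNorm (fun y => h y - ∫ z, (ρ i).normed μ z * h (y - D z) ∂μ)
      (ENNReal.ofReal p) ν) atTop (𝓝 0) := by
  have ht : Tendsto (fun z => eLpNorm (fun y => h (-D z + y) - h y) (ENNReal.ofReal p) ν) (𝓝 0)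
      (𝓝 0) := by
    refine (hh.tendsto_eLpNorm_translate_sub (by simpa using hp) ENNReal.ofReal_ne_top).comp ?_
    have := (D.continuous.neg).tendsto 0
    rw [Pi.neg_apply, map_zero, neg_zero] at this
    exact this
  rw [ENNReal.tendsto_nhds_zero] at ht ⊢
  intro ε hε
  obtain ⟨δ, hδ0, hδ⟩ := Metric.eventually_nhds_iff_ball.1 (ht ε hε)
  filter_upwards [hρ.eventually (gt_mem_nhds hδ0)] with i hiδ
  obtain ⟨π, hπ, hball, hint⟩ := (ρ i).exists_measure (μ := μ)
  let G : Y × E → ℝ := fun q => h (-D q.2 + q.1) - h q.1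
  have hG : Measurable G := (hm.comp (by fun_prop)).sub (hm.comp measurable_fst)
  -- As `π` has mass `1`, the error of mollification is an average of translation differences, each
  -- small in `L^p` since `π` lives on a small ball.
  have heq : (fun y => h y - ∫ z, (ρ i).normed μ z * h (y - D z) ∂μ) =
      -fun y => ∫ z, G (y, z) ∂π := by
    ext y
    have h1 : ∀ z, G (y, z) = h (y - D z) - h y := fun z => by
      change h (-D z + y) - h y = _
      rw [neg_add_eq_sub]
    simp only [Pi.neg_apply, h1]
    rw [integral_sub ((hint _).1.2 (hi i y)) (integrable_const _), integral_const,
      probReal_univ, one_smul, (hint _).2, neg_sub]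
  have hle : ∀ᵐ z ∂π, eLpNorm (fun y => G (y, z)) (ENNReal.ofReal p) ν ≤ ε := by
    filter_upwards [hball] with z hz
    exact hδ z (Metric.ball_subset_ball hiδ.le hz)
  rw [heq, eLpNorm_neg]
  exact eLpNorm_integral_le_of_forall_le hp hG hle

end ContDiffBump

/-! ### Approximation of compactly supported elements by mollification. -/

namespace SobolevDuality

variable {n : ℕ} {Ω : Opens (EuclideanSpace ℝ (Fin n))} {s p q θ : ℝ}
  {K : Set (EuclideanSpace ℝ (Fin n))}

/-- A compactly supported distribution which is represented by a function is represented by a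
measurable and integrable one which vanishes off the support. -/
theorem IsRepr.exists_integrable {u : 𝓓'(Ω, ℝ)} {f : EuclideanSpace ℝ (Fin n) → ℝ}
    (hf : IsRepr u f) (hK : IsCompact K) (hKΩ : K ⊆ Ω) (hu : dsupport u ⊆ K) :
    ∃ w, IsRepr u w ∧ Measurable w ∧ Integrable w ∧ ∀ x, x ∉ K → w x = 0 := by
  have hm := hf.1.aestronglyMeasurable
  let w := K.indicator (hm.mk f)
  have hw : f =ᵐ[volume.restrict Ω] w := by
    filter_upwards [hm.ae_eq_mk, hf.ae_eq_zero_of_dsupport_subset hK.isClosed hu] with x h1 h2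
    by_cases hx : x ∈ K
    · rw [h1]
      exact (indicator_of_mem hx _).symm
    · rw [h2 hx]
      exact (indicator_of_notMem hx _).symm
  have hwr := hf.congr hw
  have hwm : Measurable w := hm.stronglyMeasurable_mk.measurable.indicator hK.measurableSet
  refine ⟨w, hwr, hwm, ?_, fun x hx => indicator_of_notMem hx _⟩
  have h1 := hwr.1.integrableOn_compact_subset hKΩ hK
  rw [← integrable_indicator_iff hK.measurableSet] at h1
  refine h1.congr (.of_forall fun x => ?_)
  simp only [w, indicator_indicator, inter_self]

theorem setIntegral_mul_of_support {w : EuclideanSpace ℝ (Fin n) → ℝ} (hKΩ : K ⊆ Ω)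
    (hw : ∀ x, x ∉ K → w x = 0) (f : EuclideanSpace ℝ (Fin n) → ℝ) :
    ∫ x in Ω, w x * f x = ∫ x, w x * f x :=
  setIntegral_eq_integral_of_forall_compl_eq_zero fun x hx => by
    rw [hw x fun h => hx (hKΩ h), zero_mul]

section DiffOp

variable {D : 𝓓'(Ω, ℝ) →ₗ[ℝ] 𝓓'(Ω, ℝ)} {P A : 𝓓(Ω, ℝ) →L[ℝ] 𝓓(Ω, ℝ)}
    {a : (EuclideanSpace ℝ (Fin n) → ℝ) → EuclideanSpace ℝ (Fin n) → ℝ}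
    {u : 𝓓'(Ω, ℝ)} {v w : EuclideanSpace ℝ (Fin n) → ℝ}

/-- The weak derivative of a compactly supported function can be tested against all smooth
functions. -/
theorem IsDiffOp.integral_mul_eq (h : IsDiffOp D P A a) (hK : IsCompact K) (hKΩ : K ⊆ Ω)
    (hv : IsRepr u v) (hw : IsRepr (D u) w) (hvK : ∀ x, x ∉ K → v x = 0)
    (hwK : ∀ x, x ∉ K → w x = 0) {f : EuclideanSpace ℝ (Fin n) → ℝ}
    (hf : ContDiff ℝ (⊤ : ℕ∞) f) : ∫ x, w x * f x = ∫ x, v x * a f x := by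
  obtain ⟨χ, hχ, -⟩ := hK.exists_testFunction_eq_one hKΩ
  let g : 𝓓(Ω, ℝ) := ⟨fun x => f x * χ x, hf.mul χ.contDiff, χ.hasCompactSupport.mul_left,
    (tsupport_mul_subset_right).trans χ.tsupport_subset⟩
  -- Because `χ = 1` near `K` and `a` is local, `a` takes the same values on `K` for `f χ` as for
  -- `f`.
  have hg : ∀ x ∈ K, g =ᶠ[𝓝 x] f := fun x hx => by
    filter_upwards [eventually_nhdsSet_iff_forall.1 hχ x hx] with y hy
    change f y * χ y = f y
    rw [hy, mul_one]
  have h1 : D u g = ∫ x, w x * f x := by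
    rw [hw.2, setIntegral_mul_of_support hKΩ hwK]
    refine integral_congr_ae (.of_forall fun x => ?_)
    by_cases hx : x ∈ K
    · simp only [(hg x hx).self_of_nhds]
    · simp only [hwK x hx, zero_mul]
  have h2 : u (P g) = ∫ x, v x * a f x := by
    rw [hv.2, setIntegral_mul_of_support hKΩ hvK]
    refine integral_congr_ae (.of_forall fun x => ?_)
    by_cases hx : x ∈ K
    · simp only [h.coe, (h.congr _ _ x (hg x hx)).self_of_nhds]
    · simp only [hvK x hx, zero_mul]
  rw [← h1, ← h2, h.apply]

/-- Fubini and the substitution `x = y + z` move the mollification onto translates of `g`. -/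
theorem integral_mollify_mul (ρ : ContDiffBump (0 : EuclideanSpace ℝ (Fin n))) (hv : Integrable v)
    (g : 𝓓(Ω, ℝ)) : ∫ x, (∫ z, ρ.normed volume z * v (x - z)) * g x =
      ∫ z, ρ.normed volume z * ∫ y, v y * g (y + z) := by
  obtain ⟨C, hC⟩ := g.continuous.bounded_above_of_compact_support g.hasCompactSupport
  have hi : Integrable (fun q : EuclideanSpace ℝ (Fin n) × EuclideanSpace ℝ (Fin n) =>
      ρ.normed volume q.2 * v (q.1 - q.2) * g q.1) (volume.prod volume) :=
    (ρ.integrable_normed.convolution_integrand (ContinuousLinearMap.mul ℝ ℝ) hv).mul_bdd (c := C)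
      (g.continuous.comp continuous_fst).aestronglyMeasurable (.of_forall fun q => hC q.1)
  simp only [← integral_mul_const]
  rw [integral_integral_swap hi]
  refine integral_congr_ae (.of_forall fun z => ?_)
  simp only [mul_assoc]
  rw [integral_const_mul, ← integral_add_right_eq_self (fun x => v (x - z) * g x) z]
  simp only [add_sub_cancel_right]

/-- Mollification commutes with differential operators. -/
theorem IsDiffOp.isRepr_mollify (h : IsDiffOp D P A a) (hK : IsCompact K) (hKΩ : K ⊆ Ω)
    (hv : IsRepr u v) (hw : IsRepr (D u) w) (hvK : ∀ x, x ∉ K → v x = 0)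
    (hwK : ∀ x, x ∉ K → w x = 0) (hvi : Integrable v) (hwi : Integrable w)
    (ρ : ContDiffBump (0 : EuclideanSpace ℝ (Fin n))) {φ : 𝓓(Ω, ℝ)}
    (hφ : ∀ x, φ x = ∫ z, ρ.normed volume z * v (x - z)) :
    IsRepr (D (SobolevDuality.testDist φ)) fun x => ∫ z, ρ.normed volume z * w (x - z) := by
  have hc : Continuous fun x => ∫ z, ρ.normed volume z * w (x - z) :=
    (ρ.hasCompactSupport_normed.contDiff_convolution_left (n := 0) (ContinuousLinearMap.mul ℝ ℝ)
      ρ.contDiff_normed hwi.locallyIntegrable).continuous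
  refine ⟨(hc.locallyIntegrable (μ := volume)).locallyIntegrableOn _, fun ζ => ?_⟩
  rw [h.apply, testDist_apply, setIntegral_mul_testFunction, setIntegral_mul_testFunction]
  simp only [hφ]
  rw [integral_mollify_mul ρ hvi, integral_mollify_mul ρ hwi]
  refine integral_congr_ae (.of_forall fun z => ?_)
  -- The translate of `ζ` need not be supported in `Ω`; compact support of `v` and `w` allows
  -- testing against any smooth function.
  have hz : ContDiff ℝ (⊤ : ℕ∞) fun x => ζ (x + z) := ζ.contDiff.comp (by fun_prop)
  simp only [h.integral_mul_eq hK hKΩ hv hw hvK hwK hz, h.translate, h.coe]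

end DiffOp

/-- The mollification of a compactly supported function is a test function. -/
theorem exists_testFunction_eq_mollify {v : EuclideanSpace ℝ (Fin n) → ℝ} (hK : IsCompact K)
    (hvi : Integrable v) (hvK : ∀ x, x ∉ K → v x = 0)
    (ρ : ContDiffBump (0 : EuclideanSpace ℝ (Fin n)))
    (hρ : Metric.cthickening ρ.rOut K ⊆ Ω) :
    ∃ φ : 𝓓(Ω, ℝ), ∀ x, φ x = ∫ z, ρ.normed volume z * v (x - z) := by
  have hs : tsupport (fun x => ∫ z, ρ.normed volume z * v (x - z)) ⊆
      Metric.cthickening ρ.rOut K := by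
    refine closure_minimal (fun x hx => ?_) Metric.isClosed_cthickening
    obtain ⟨z, hz, y, hy, rfl⟩ := support_convolution_subset (ContinuousLinearMap.mul ℝ ℝ) hx
    rw [ρ.support_normed_eq] at hz
    have hyK : y ∈ K := by_contra fun h => hy (hvK y h)
    refine Metric.mem_cthickening_of_dist_le _ y _ _ hyK ?_
    simpa [dist_eq_norm] using (mem_ball_zero_iff.1 hz).le
  exact ⟨⟨_, ρ.hasCompactSupport_normed.contDiff_convolution_left (ContinuousLinearMap.mul ℝ ℝ)
    ρ.contDiff_normed hvi.locallyIntegrable, hK.cthickening.of_isClosed_subset (isClosed_tsupport _)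
      hs,
    hs.trans hρ⟩, fun x => rfl⟩

section Slobodeckij

variable {w : EuclideanSpace ℝ (Fin n) → ℝ}

theorem integrable_mollify (hwi : Integrable w)
    (ρ : ContDiffBump (0 : EuclideanSpace ℝ (Fin n))) (x : EuclideanSpace ℝ (Fin n)) :
    Integrable fun z => ρ.normed volume z * w (x - z) := by
  obtain ⟨C, hC⟩ := ρ.continuous_normed.bounded_above_of_compact_support
    (ρ.hasCompactSupport_normed (μ := volume))
  exact (hwi.comp_sub_left x).bdd_mul (c := C) ρ.continuous_normed.aestronglyMeasurable
    (.of_forall hC)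

theorem measurable_diffQuot {E : Type*} [NormedAddCommGroup E] [InnerProductSpace ℝ E]
    [FiniteDimensional ℝ E] [MeasurableSpace E] [BorelSpace E] {w : E → ℝ} (hm : Measurable w)
    (a : ℝ) : Measurable (diffQuot a w) := by
  unfold diffQuot
  simp only [LinearMap.coe_mk, AddHom.coe_mk]
  fun_prop

/-- A pair of distinct points with one in `K` but not both in `Ω` has distance at least `r`. There
`min 1 r ≤ min 1 |x - y|`, so the majorant with the `L^p` kernel is available. -/
theorem norm_diffQuot_le_of_notMem {E : Type*} [NormedAddCommGroup E] [InnerProductSpace ℝ E]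
    [FiniteDimensional ℝ E] [MeasurableSpace E] [BorelSpace E] {w : E → ℝ} {K : Set E} {Ω : Opens E}
    {r : ℝ} (hr : 0 < r) (hKr : Metric.cthickening r K ⊆ Ω) (hwK : ∀ x, x ∉ K → w x = 0)
    {z : E × E} (hz : z ∉ offDiag Ω) (a : ℝ) : ‖diffQuot a w z‖ ≤
      (min 1 r)⁻¹ * ((‖w z.1‖ + ‖w z.2‖) * (min 1 ‖z.1 - z.2‖ / ‖z.1 - z.2‖ ^ a)) := by
  have hr1 : 0 < min 1 r := lt_min one_pos hr
  have hR : 0 ≤ (min 1 r)⁻¹ * ((‖w z.1‖ + ‖w z.2‖) * (min 1 ‖z.1 - z.2‖ / ‖z.1 - z.2‖ ^ a)) := by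
    positivity
  by_cases h12 : z.1 = z.2
  · rw [diffQuot_apply, h12, sub_self, zero_div, norm_zero]
    rwa [h12] at hR
  by_cases hKK : z.1 ∉ K ∧ z.2 ∉ K
  · rw [diffQuot_apply, hwK _ hKK.1, hwK _ hKK.2, sub_self, zero_div, norm_zero]
    positivity
  have hKΩ : K ⊆ Ω := (Metric.self_subset_cthickening K).trans hKr
  have hd : r ≤ ‖z.1 - z.2‖ := by
    by_contra! hlt
    have h3 : z.1 ∈ Ω ∧ z.2 ∈ Ω := by
      rw [not_and_or, not_not, not_not] at hKK
      rcases hKK with h | h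
      · refine ⟨hKΩ h, hKr (Metric.mem_cthickening_of_dist_le _ _ _ _ h ?_)⟩
        rw [dist_comm, dist_eq_norm]
        exact hlt.le
      · refine ⟨hKr (Metric.mem_cthickening_of_dist_le _ _ _ _ h ?_), hKΩ h⟩
        rw [dist_eq_norm]
        exact hlt.le
    exact hz ⟨h3.1, h3.2, h12⟩
  rw [diffQuot_apply, norm_div, Real.norm_of_nonneg (Real.rpow_nonneg (norm_nonneg _) _)]
  calc ‖w z.1 - w z.2‖ / ‖z.1 - z.2‖ ^ a ≤ (‖w z.1‖ + ‖w z.2‖) / ‖z.1 - z.2‖ ^ a := by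
        gcongr
        exact norm_sub_le _ _
    _ = (min 1 r)⁻¹ * ((‖w z.1‖ + ‖w z.2‖) * (min 1 r / ‖z.1 - z.2‖ ^ a)) := by
        field_simp
    _ ≤ _ := by gcongr

/-- Extends integrability from pairs in `Ω` to the whole product space, where translations act and
their continuity in `L^p` can be used. -/
theorem memLp_diffQuot (hn : 0 < n) (hp : 1 < p) (h0 : 0 < θ) (h1 : θ < 1) {r : ℝ} (hr : 0 < r)
    (hKr : Metric.cthickening r K ⊆ Ω) (hwK : ∀ x, x ∉ K → w x = 0) (hm : Measurable w)
    (hw : MemLp w (ENNReal.ofReal p) volume)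
    (hD : MemLp (diffQuot ((n : ℝ) / p + θ) w) (ENNReal.ofReal p) (volume.restrict (offDiag Ω))) :
    MemLp (diffQuot ((n : ℝ) / p + θ) w) (ENNReal.ofReal p) volume := by
  have : Nontrivial (EuclideanSpace ℝ (Fin n)) := by
    have : Nonempty (Fin n) := ⟨⟨0, hn⟩⟩
    infer_instance
  have hk := memLp_min_one_div_rpow (E := EuclideanSpace ℝ (Fin n)) hp h0 h1
  rw [finrank_euclideanSpace_fin] at hk
  have hG := MemLp.add_mul_sub (zero_lt_one.trans hp) hw hk (fun z => by rw [norm_neg])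
  have hU := (memLp_indicator_iff_restrict (offDiag Ω).isOpen.measurableSet).2 hD
  refine (hU.norm.add (hG.const_mul (min 1 r)⁻¹)).of_le
    (measurable_diffQuot hm _).aestronglyMeasurable (.of_forall fun z => ?_)
  have hr1 : 0 < min 1 r := lt_min one_pos hr
  have hG0 : 0 ≤ (min 1 r)⁻¹ * ((‖w z.1‖ + ‖w z.2‖) *
      (min 1 ‖z.1 - z.2‖ / ‖z.1 - z.2‖ ^ ((n : ℝ) / p + θ))) := by positivity
  rw [Pi.add_apply, Real.norm_of_nonneg (add_nonneg (norm_nonneg _) hG0)]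
  by_cases hz : z ∈ (offDiag Ω : Set _)
  · rw [indicator_of_mem hz]
    exact le_add_of_nonneg_right hG0
  · exact (norm_diffQuot_le_of_notMem hr hKr hwK hz _).trans (le_add_of_nonneg_left (norm_nonneg _))

/-- Translating both points by `z` leaves `x - y` unchanged, so the difference quotient commutes
with mollification along the diagonal. -/
theorem diffQuot_mollify (hwi : Integrable w)
    (ρ : ContDiffBump (0 : EuclideanSpace ℝ (Fin n))) (a : ℝ)
    (y : EuclideanSpace ℝ (Fin n) × EuclideanSpace ℝ (Fin n)) :
    (Integrable fun z => ρ.normed volume z * diffQuot a w (y - (z, z))) ∧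
    diffQuot a (fun x => ∫ z, ρ.normed volume z * w (x - z)) y =
      ∫ z, ρ.normed volume z * diffQuot a w (y - (z, z)) := by
  have h : ∀ z, ρ.normed volume z * diffQuot a w (y - (z, z)) =
      (ρ.normed volume z * w (y.1 - z) - ρ.normed volume z * w (y.2 - z)) / ‖y.1 - y.2‖ ^ a := by
    intro z
    rw [diffQuot_apply, Prod.fst_sub, Prod.snd_sub, sub_sub_sub_cancel_right]
    ring
  simp only [h]
  refine ⟨((integrable_mollify hwi ρ y.1).sub (integrable_mollify hwi ρ y.2)).div_const _, ?_⟩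
  rw [integral_div, integral_sub (integrable_mollify hwi ρ y.1) (integrable_mollify hwi ρ y.2),
    diffQuot_apply]

end Slobodeckij

section Approx

variable [hp : Fact (1 < p)]

/-- Mollification commutes with derivatives and, along the diagonal, with difference quotients. Each
term of the norm of the error is thus bounded by an `L^p` mollification error and tends to zero. -/
theorem hasCompactApprox_nonnegSobolevNorm (hn : 0 < n) :
    HasCompactApprox (nonnegSobolevNorm Ω s p) := by
  intro u K hKΩ hu
  have hK := K.isCompact
  set U := (nonnegSobolevNorm Ω s p).incl u with hU
  have hfin : (nonnegSobolevNorm Ω s p).toFun U < ∞ := (nonnegSobolevNorm Ω s p).toFun_incl_lt_top u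
  obtain ⟨r, hr, hKr⟩ := hK.exists_cthickening_subset_open Ω.isOpen hKΩ
  obtain ⟨f, hf, -⟩ := exists_isRepr_memLp ((lpNorm_le U).trans_lt hfin)
  obtain ⟨v, hv, -, hvi, hvK⟩ := hf.exists_integrable hK hKΩ hu
  have hpos : ∀ i : ℕ, 0 < r / (i + 1) := fun i => by positivity
  -- The radii `r / (i + 1)` are at most `r`, so every mollification has its support in the closed
  -- `r`-thickening of `K`, inside `Ω`.
  let ρ : ℕ → ContDiffBump (0 : EuclideanSpace ℝ (Fin n)) := fun i =>
    ⟨r / (i + 1) / 2, r / (i + 1), half_pos (hpos i), half_lt_self (hpos i)⟩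
  have hρ : Tendsto (fun i => (ρ i).rOut) atTop (𝓝 0) :=
    (tendsto_const_div_atTop_nhds_zero_nat r).comp (tendsto_add_atTop_nat 1) |>.congr fun i => by
      simp [ρ]
  have hρr : ∀ i, (ρ i).rOut ≤ r := fun i => by
    refine div_le_self hr.le ?_
    linarith [(Nat.cast_nonneg i : (0 : ℝ) ≤ i)]
  choose φ hφ using fun i => exists_testFunction_eq_mollify (Ω := Ω) hK hvi hvK (ρ i)
    ((Metric.cthickening_mono (hρr i) _).trans hKr)
  have hp1 : 1 ≤ ENNReal.ofReal p := by simpa using hp.out.le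
  have hD : ∀ ν : Fin n → ℕ, ∑ i, ν i ≤ ⌊s⌋₊ → ∃ w, IsRepr (partialDeriv ν U) w ∧ Measurable w ∧
      Integrable w ∧ (∀ x, x ∉ K → w x = 0) ∧ MemLp w (ENNReal.ofReal p) volume ∧
      ∀ i, IsRepr (partialDeriv ν (U - testDist (φ i)))
        (w - fun x => ∫ z, (ρ i).normed volume z * w (x - z)) := by
    intro ν hν
    obtain ⟨P, A, a, h⟩ := IsDiffOp.exists_partialDeriv (Ω := Ω) ν
    have hlt := (lpNorm_le_nonnegSobolevNorm hν U).trans_lt hfin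
    obtain ⟨g, hg, -⟩ := exists_isRepr_memLp hlt
    obtain ⟨w, hw, hwm, hwi, hwK⟩ := hg.exists_integrable hK hKΩ ((h.dsupport_subset U).trans hu)
    refine ⟨w, hw, hwm, hwi, hwK, ⟨hwm.aestronglyMeasurable, ?_⟩, fun i => ?_⟩
    · rw [lpNorm_eq hw, ← eLpNorm_indicator_eq_eLpNorm_restrict Ω.isOpen.measurableSet,
        indicator_eq_self.2 fun x hx => hKΩ (by_contra fun h => hx (hwK x h))] at hlt
      exact hlt
    · rw [map_sub]
      exact hw.sub (h.isRepr_mollify hK hKΩ hv hw hvK hwK hvi hwi (ρ i) (hφ i))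
  have hmain : Tendsto (fun i => (nonnegSobolevNorm Ω s p).toFun (U - testDist (φ i))) atTop
      (𝓝 0) := by
    refine nonnegSobolevNorm_induction
      (fun N => Tendsto (fun i => N.toFun (U - testDist (φ i))) atTop (𝓝 0))
      (fun N hN => by simp only [hN]; exact tendsto_const_nhds)
      (fun N M hN hM => by
        have h := hN.add hM
        rw [add_zero] at h
        exact h) (fun ν hν => ?_) (fun hs ν hν => ?_)
    · obtain ⟨w, -, hwm, hwi, -, hwp, hr⟩ := hD ν hν
      have hlim := ContDiffBump.tendsto_eLpNorm_mollify_sub (μ := volume) hp.out.le hwm hwp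
        (.id ℝ _)
        hρ (fun i y => integrable_mollify hwi (ρ i) y)
      refine tendsto_of_tendsto_of_tendsto_of_le_of_le tendsto_const_nhds hlim (fun _ => zero_le)
        fun i => ?_
      change (lpNorm Ω p).toFun _ ≤ _
      rw [lpNorm_eq (hr i)]
      exact eLpNorm_mono_measure _ Measure.restrict_le_self
    · obtain ⟨w, hw, hwm, hwi, hwK, hwp, hr'⟩ := hD ν hν.le
      have hlt := (slobodeckijSeminorm_le_nonnegSobolevNorm hs hν U).trans_lt hfin
      rw [slobodeckijSeminorm_eq hw] at hlt
      have hDp := memLp_diffQuot hn hp.out (fract_pos hs) (Int.fract_lt_one s) hr hKr hwK hwm hwp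
        ⟨(measurable_diffQuot hwm _).aestronglyMeasurable, hlt⟩
      have : (volume : Measure (EuclideanSpace ℝ (Fin n) × EuclideanSpace ℝ
        (Fin n))).IsAddHaarMeasure := by
        rw [Measure.volume_eq_prod]
        infer_instance
      -- The translations run along the diagonal embedding `z ↦ (z, z)`.
      have hlim := ContDiffBump.tendsto_eLpNorm_mollify_sub (μ := volume) hp.out.le
        (measurable_diffQuot hwm _) hDp ((ContinuousLinearMap.id ℝ _).prod (.id ℝ _)) hρ
        (fun i y => (diffQuot_mollify hwi (ρ i) _ y).1)
      refine tendsto_of_tendsto_of_tendsto_of_le_of_le tendsto_const_nhds hlim (fun _ => zero_le)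
        fun i => ?_
      change (slobodeckijSeminorm Ω _ p).toFun _ ≤ _
      rw [slobodeckijSeminorm_eq (hr' i), map_sub]
      refine (eLpNorm_mono_measure _ Measure.restrict_le_self).trans_eq ?_
      congr 1
      ext y
      rw [Pi.sub_apply, (diffQuot_mollify hwi (ρ i) _ y).2]
      rfl
  refine mem_topologicalClosure_testFunctions (boundedOnTest_nonnegSobolevNorm hn).finite
    fun ε hε => ?_
  obtain ⟨i, hi⟩ := ((ENNReal.tendsto_nhds_zero.1 hmain) ε hε).exists
  exact ⟨φ i, hi⟩

end Approx

end SobolevDuality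

/-- Independence of the cutoff is contained in the quantification over all `ψ` after `R` is fixed.
The witnesses `v` and `g` express that `u` and `ψ f` lie in the closures of the test functions, and
the functional `F` that the pairing does not take its default value. `StrongDual` carries the strong
topology. -/
theorem mainTheorem3 {n : ℕ} (hn : 0 < n) (Ω : Opens (EuclideanSpace ℝ (Fin n)))
    (hΩ : (Ω : Set (EuclideanSpace ℝ (Fin n))).Nonempty) (s p p' : ℝ)
    [Fact (1 < p)] [Fact (1 < p')] (hpp' : p.HolderConjugate p')
    (h₁ : IsSmoothMultiplicationTriple Ω s p)
    (h₂ : IsSmoothMultiplicationTriple Ω (-s) p') :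
    (∀ u : SobolevComp Ω (-s) p', ∃ ψ : 𝓓(Ω, ℝ), IsCutoff ψ (SobolevComp.toDist u)) ∧
    ∃ R : SobolevComp Ω (-s) p' →ₗ[ℝ] StrongDual ℝ (SobolevLoc Ω s p),
      (∀ (u : SobolevComp Ω (-s) p') (f : SobolevLoc Ω s p) (ψ : 𝓓(Ω, ℝ)),
        IsCutoff ψ (SobolevComp.toDist u) →
          ∃ (v : SobolevZero Ω (-s) p') (g : SobolevZero Ω s p),
            v.toSpace = SobolevComp.toSobolev u ∧ g.toSpace = SobolevLoc.mul ψ f ∧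
            (∃ F : StrongDual ℝ (SobolevZero Ω s p), RestrictsTo F v.toDist) ∧
            R u f = dualPairing v g) ∧
      Function.Bijective R ∧ Continuous R := by
  exact ⟨exists_isCutoff, exists_bijective_of_isDualPair (isDualPair_sobolevNorm hn hpp'
    (fun _ _ => hasCompactApprox_nonnegSobolevNorm hn)
    (fun _ _ => hasCompactApprox_nonnegSobolevNorm hn)) h₁⟩
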